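/- For $r>0$ let $B(0,r)$ be the open Euclidean ball of radius $r$ in $\mathbb{C}^n$ and let $U=B(0,1)$. Let $a>1$ and let $\phi: B(0,3)\to\mathbb{R}$ be smooth and of Gevrey class $G^a(B(0,3))$, i.e. there are $C_0,C_1>0$ with $$|D_z^\alpha D_{\bar z}^\beta\phi(z)|\le C_0\,C_1^{|\alpha|+|\beta|}(\alpha!\,\beta!)^a\qquad\text{for all } z\in B(0,3) \text{ and all multi-indices } \alpha,\beta .$$ Assume that $\phi$ is a Kähler potential, i.e. its complex Hessian $(\phi_{i\bar j})=\big(\partial^2\phi/\partial z_i\partial\bar z_j\big)$ is positive definite at every point of $B(0,3)$; put $\omega=\frac{\sqrt{-1}}{2}\partial\bar\partial\phi$ and $d\mathrm{Vol}=\omega^n/n!$ (that is, $\det(\phi_{i\bar j})$ times Lebesgue measure). For an integer $k\ge1$ put $$(u,v)_{k\phi}=\int_U u\,\bar v\,e^{-k\phi}\,d\mathrm{Vol},\qquad \|u\|_{k\phi}^2=(u,u)_{k\phi},$$ and let $H_{k\phi}(U)$ be the space of holomorphic functions $u$ on $U$ with $\|u\|_{k\phi}<\infty$. Let $\chi$ be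 a smooth real-valued cut-off function with $\chi=1$ on $B(0,\frac12)$ and $\chi=0$ outside $B(0,\frac34)$. Then for every $\varepsilon>0$ there is a constant $C>0$ such that for every integer $N\ge0$ there are functions $K^{(N)}_{k,x}\in H_{k\phi}(U)$, for all integers $k\ge1$ and all $x\in B(0,\frac14)$ (local Bergman kernels of order $N$), with the following property: for all $k\ge1$, all $u\in H_{k\phi}(U)$ and all $x\in B(0,\frac14)$, $$u(x)=\big(\chi u,K^{(N)}_{k,x}\big)_{k\phi}+k^n e^{k\phi(x)/2}\,\mathcal R_{N+1}\,\|u\|_{k\phi},\qquad |\mathcal R_{N+1}|\le\frac{C^{N+1}\,(N+1)!^{\,2a+2\varepsilon}}{k^{N+1}} .$$ The constant $C$ does not depend on $N$, $k$, $x$ or $u$. -/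

import Mathlib

open scoped ContDiff ComplexConjugate ComplexOrder

noncomputable section

namespace LocalBergman

/-- `ℂⁿ` with its Euclidean norm; its `volume` is Lebesgue measure on `ℂⁿ = ℝ²ⁿ`. -/
abbrev Cn (n : ℕ) : Type := EuclideanSpace ℂ (Fin n)

/-- The `j`-th standard basis vector of `ℂⁿ`. -/
def stdVec {n : ℕ} (j : Fin n) : Cn n := EuclideanSpace.single j (1 : ℂ)

/-- The Wirtinger derivative `∂f/∂z_j = (∂f/∂x_j - i ∂f/∂y_j) / 2`. -/
def dz {n : ℕ} (j : Fin n) (f : Cn n → ℂ) (x : Cn n) : ℂ :=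
  (fderiv ℝ f x (stdVec j) - Complex.I * fderiv ℝ f x (Complex.I • stdVec j)) / 2

/-- The Wirtinger derivative `∂f/∂z̄_j = (∂f/∂x_j + i ∂f/∂y_j) / 2`. -/
def dzbar {n : ℕ} (j : Fin n) (f : Cn n → ℂ) (x : Cn n) : ℂ :=
  (fderiv ℝ f x (stdVec j) + Complex.I * fderiv ℝ f x (Complex.I • stdVec j)) / 2

/-- The iterated derivative `D_z^α` of a multi-index `α`. -/
def dzIter {n : ℕ} (α : Fin n → ℕ) (f : Cn n → ℂ) : Cn n → ℂ :=
  (List.finRange n).foldr (fun j g => (dz j)^[α j] g) f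

/-- The iterated derivative `D_z̄^β` of a multi-index `β`. -/
def dzbarIter {n : ℕ} (β : Fin n → ℕ) (f : Cn n → ℂ) : Cn n → ℂ :=
  (List.finRange n).foldr (fun j g => (dzbar j)^[β j] g) f

/-- The order `|α|` of a multi-index. -/
def order {n : ℕ} (α : Fin n → ℕ) : ℕ := ∑ j, α j

/-- The factorial `α!` of a multi-index. -/
def mfact {n : ℕ} (α : Fin n → ℕ) : ℕ := ∏ j, (α j).factorial

/-- The Gevrey class `G^a(V)` of an open set `V ⊆ ℂⁿ`: the smooth functions on `V` with
`|D_z^α D_z̄^β f| ≤ C₀ C₁^(|α|+|β|) (α! β!)^a` on `V` for all multi-indices `α`, `β`. -/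
def Gevrey {n : ℕ} (a : ℝ) (V : Set (Cn n)) (f : Cn n → ℂ) : Prop :=
  ContDiffOn ℝ ∞ f V ∧
    ∃ C₀ > (0 : ℝ), ∃ C₁ > (0 : ℝ), ∀ α β : Fin n → ℕ, ∀ x ∈ V,
      ‖dzIter α (dzbarIter β f) x‖ ≤
        C₀ * C₁ ^ (order α + order β) * ((mfact α * mfact β : ℕ) : ℝ) ^ a

/-- The complex Hessian `(∂²φ / ∂z_i ∂z̄_j)`. -/
def complexHessian {n : ℕ} (φ : Cn n → ℝ) (x : Cn n) : Matrix (Fin n) (Fin n) ℂ :=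
  Matrix.of fun i j => dz i (dzbar j (fun y => (φ y : ℂ))) x

/-- `φ` is a Kähler potential on `V`: the form `(i/2) ∂∂̄φ` is positive at every point of `V`. -/
def IsKahlerPotential {n : ℕ} (φ : Cn n → ℝ) (V : Set (Cn n)) : Prop :=
  ∀ x ∈ V, (complexHessian φ x).PosDef

/-- The volume form `ωⁿ / n!` of `ω = (i/2) ∂∂̄φ = (i/2) ∑ φ_{ij̄} dz_i ∧ dz̄_j`, as a measure.
As `(i/2) dz_j ∧ dz̄_j = dx_j ∧ dy_j`, its density against Lebesgue measure is `det (φ_{ij̄})`. -/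
def kahlerVolume {n : ℕ} (φ : Cn n → ℝ) : MeasureTheory.Measure (Cn n) :=
  MeasureTheory.volume.withDensity fun x => ENNReal.ofReal (complexHessian φ x).det.re

/-- The unit ball `U` of `ℂⁿ`. -/
def unitBall (n : ℕ) : Set (Cn n) := Metric.ball 0 1

/-- The pairing `(u, v)_{kφ} = ∫_U u v̄ e^{-kφ} dVol`. -/
def innerK {n : ℕ} (φ : Cn n → ℝ) (k : ℕ) (u v : Cn n → ℂ) : ℂ :=
  ∫ y in unitBall n, u y * conj (v y) * (Real.exp (-(k * φ y)) : ℂ) ∂(kahlerVolume φ)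

/-- The norm `‖u‖_{kφ} = (∫_U |u|² e^{-kφ} dVol)^{1/2}`. -/
def normK {n : ℕ} (φ : Cn n → ℝ) (k : ℕ) (u : Cn n → ℂ) : ℝ :=
  Real.sqrt (∫ y in unitBall n, ‖u y‖ ^ 2 * Real.exp (-(k * φ y)) ∂(kahlerVolume φ))

/-- The space `H_{kφ}(U)` of holomorphic functions on `U` with finite `‖·‖_{kφ}`. Its members are
functions on `ℂⁿ` of which only the values on `U` matter. -/
def bergmanSpace {n : ℕ} (φ : Cn n → ℝ) (k : ℕ) : Set (Cn n → ℂ) :=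
  {u | DifferentiableOn ℂ u (unitBall n) ∧
    MeasureTheory.IntegrableOn (fun y => ‖u y‖ ^ 2 * Real.exp (-(k * φ y)))
      (unitBall n) (kahlerVolume φ)}

/-- A smooth cut-off function on `ℂⁿ` that is `1` on `B(0, 1/2)` and `0` outside `B(0, 3/4)`. -/
structure IsCutoff {n : ℕ} (χ : Cn n → ℝ) : Prop where
  smooth : ContDiff ℝ ∞ χ
  eq_one : ∀ x ∈ Metric.ball (0 : Cn n) (1 / 2), χ x = 1
  eq_zero : ∀ x ∉ Metric.ball (0 : Cn n) (3 / 4), χ x = 0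

end LocalBergman

end

noncomputable section

namespace LocalBergman

open MeasureTheory Filter Topology
open scoped ENNReal

variable {n : ℕ}

/-! One kernel serves all orders `N`. It reproduces `u(x)` up to a constant times `k^n e^{kφ(x)/2}
e^{-σ√k} ‖u‖` (`exists_localBergmanKernel`), and `e^{-σ√k} ≤ c^m m!^2 / k^m` for every `m`
(`exp_neg_mul_sqrt_le`). As `2 ≤ 2a + 2ε`, taking `m = N + 1` gives the claim.

The kernel comes from duality in the Hilbert space `H` of square-integrable holomorphic functions.
Let `F` represent evaluation at `x`, and let `T v` be the orthogonal projection of `χ v` to `H`.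
Then `u(x) - (χ u, v) = (u, F - T v)`, so `v` is a good kernel when `T v` is close to `F`. Such a
`v` exists as soon as evaluation at `x` is small on the orthogonal complement of the range of `T`,
that is, on the `u` in `H` for which `χ u` is orthogonal to `H` (`exists_norm_sub_le`,
`IsWeight.exists_kernel`).

That smallness is an Agmon-type estimate (`integral_le_of_perp`). Let `Φ` be strictly
plurisubharmonic on all of `ℂⁿ` with `Φ = φ` on the unit ball (`exists_extension`), and let `m` be
`χ` times the volume density. Then `w = m e^{-t|z|²} u` is orthogonal to the holomorphic functions
for the weight `ψ = kΦ - t|z|²`, whose complex Hessian is at least `kc - t`. The spectral gap gives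
`(kc - t) ‖w‖² ≤ ‖∂̄w‖²`. Since `∂̄u = 0`, only derivatives of `m` and of `t|z|²` enter `∂̄w`. The
latter cost `t²`, which is absorbed when `t = s√k` with `s` small. The former are absorbed on `B(0,
1/2)`, where `m` is bounded below, and off that ball they carry a factor `e^{-t/4}`, whereas the
left side keeps `e^{-t/9}` on `B(0, 1/3)`. So `u` is small near the origin in `L²`, and pointwise by
`exists_norm_sq_le`.

The spectral gap (`LeviBound.spectral_gap`) combines the Bochner-Kodaira identity for test functions
(`integral_boxOp_sq`) with a density argument: whatever is orthogonal to the range of `∂̄* ∂̄` is a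
weak `L²` solution of `∂̄* ∂̄ v = 0` on `ℂⁿ`, and such a `v` is holomorphic, by Friedrichs
mollification, Caccioppoli's inequality on balls of radius `R → ∞` and Weyl's lemma. -/

/-- The first-order operator `(∂/∂x_j + c ∂/∂y_j) / 2`, which is `∂/∂z_j` for `c = -i` and
`∂/∂z̄_j` for `c = i`. -/
def wirt (c : ℂ) (j : Fin n) (f : Cn n → ℂ) (x : Cn n) : ℂ :=
  (fderiv ℝ f x (stdVec j) + c * fderiv ℝ f x (Complex.I • stdVec j)) / 2

lemma dz_eq_wirt (j : Fin n) (f : Cn n → ℂ) : dz j f = wirt (-Complex.I) j f := by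
  funext x; simp only [dz, wirt]; ring

lemma dzbar_eq_wirt (j : Fin n) (f : Cn n → ℂ) : dzbar j f = wirt Complex.I j f := rfl

/-! ### Wirtinger calculus and the Cauchy-Riemann equations. -/

section wirt

variable {c d : ℂ} {i j : Fin n} {f g : Cn n → ℂ} {x : Cn n}

lemma wirt_add (hf : DifferentiableAt ℝ f x) (hg : DifferentiableAt ℝ g x) :
    wirt c j (fun y => f y + g y) x = wirt c j f x + wirt c j g x := by
  simp only [wirt, fderiv_fun_add hf hg, add_apply]; ring

lemma wirt_neg : wirt c j (fun y => -f y) x = -wirt c j f x := by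
  simp only [wirt, fderiv_fun_neg, neg_apply]; ring

lemma wirt_mul (hf : DifferentiableAt ℝ f x) (hg : DifferentiableAt ℝ g x) :
    wirt c j (fun y => f y * g y) x = wirt c j f x * g x + f x * wirt c j g x := by
  simp only [wirt, fderiv_fun_mul hf hg, add_apply,
    smul_apply, smul_eq_mul]; ring

lemma wirt_const (a : ℂ) : wirt c j (fun _ => a) x = 0 := by
  simp [wirt]

lemma wirt_const_mul (a : ℂ) (hf : DifferentiableAt ℝ f x) :
    wirt c j (fun y => a * f y) x = a * wirt c j f x := by
  rw [wirt_mul (differentiableAt_const a) hf, wirt_const]; ring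

lemma wirt_sum {ι : Type*} (s : Finset ι) {F : ι → Cn n → ℂ}
    (hF : ∀ l ∈ s, DifferentiableAt ℝ (F l) x) :
    wirt c j (fun y => ∑ l ∈ s, F l y) x = ∑ l ∈ s, wirt c j (F l) x := by
  simp only [wirt, fderiv_fun_sum hF, sum_apply]
  rw [Finset.mul_sum, ← Finset.sum_add_distrib, Finset.sum_div]

lemma wirt_conj :
    wirt c j (fun y => conj (f y)) x = conj (wirt (conj c) j f x) := by
  have : fderiv ℝ (fun y => conj (f y)) x
      = (Complex.conjCLE : ℂ →L[ℝ] ℂ).comp (fderiv ℝ f x) := by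
    exact Complex.conjCLE.comp_fderiv (f := f)
  simp [wirt, this, Complex.conj_ofNat]

lemma wirt_congr (h : f =ᶠ[nhds x] g) : wirt c j f x = wirt c j g x := by
  simp only [wirt, h.fderiv_eq]

lemma wirt_ofReal_comp {h : ℝ → ℝ} {h' : ℝ} {q : Cn n → ℝ} (hh : HasDerivAt h h' (q x))
    (hq : DifferentiableAt ℝ q x) :
    wirt c j (fun y => ((h (q y) : ℝ) : ℂ)) x = h' * wirt c j (fun y => (q y : ℂ)) x := by
  have h1 : HasFDerivAt (fun y => ((h (q y) : ℝ) : ℂ))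
      (Complex.ofRealCLM.comp (h' • fderiv ℝ q x)) x :=
    Complex.ofRealCLM.hasFDerivAt.comp x (hh.comp_hasFDerivAt x hq.hasFDerivAt)
  have h2 : HasFDerivAt (fun y => (q y : ℂ)) (Complex.ofRealCLM.comp (fderiv ℝ q x)) x :=
    Complex.ofRealCLM.hasFDerivAt.comp x hq.hasFDerivAt
  simp only [wirt, h1.fderiv, h2.fderiv]
  simp
  ring

lemma wirt_eq_zero_of_notMem_tsupport (hx : x ∉ tsupport f) : wirt c j f x = 0 := by
  have : f =ᶠ[nhds x] fun _ => 0 := notMem_tsupport_iff_eventuallyEq.1 hx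
  rw [wirt_congr this, wirt_const]

lemma tsupport_wirt_subset : tsupport (wirt c j f) ⊆ tsupport f := by
  refine closure_minimal (fun y hy => ?_) (isClosed_tsupport f)
  by_contra h
  exact hy (wirt_eq_zero_of_notMem_tsupport h)

lemma hasCompactSupport_wirt (hf : HasCompactSupport f) : HasCompactSupport (wirt c j f) :=
  hf.of_isClosed_subset (isClosed_tsupport _) tsupport_wirt_subset

lemma contDiffAt_wirt (hf : ContDiffAt ℝ ∞ f x) : ContDiffAt ℝ ∞ (wirt c j f) x := by
  have h : ContDiffAt ℝ ∞ (fderiv ℝ f) x := hf.fderiv_right (by simp)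
  unfold wirt
  exact ((h.clm_apply contDiffAt_const).add
    (contDiffAt_const.mul (h.clm_apply contDiffAt_const))).div_const _

lemma contDiff_wirt (hf : ContDiff ℝ ∞ f) : ContDiff ℝ ∞ (wirt c j f) :=
  contDiff_iff_contDiffAt.2 fun _ => contDiffAt_wirt hf.contDiffAt

lemma wirt_comm (hf : ContDiffAt ℝ ∞ f x) :
    wirt c i (wirt d j f) x = wirt d j (wirt c i f) x := by
  have h : DifferentiableAt ℝ (fderiv ℝ f) x :=
    (hf.fderiv_right (m := ∞) (by simp)).differentiableAt (by simp)
  have key : ∀ v w : Cn n, fderiv ℝ (fun y => fderiv ℝ f y v) x w = fderiv ℝ (fderiv ℝ f) x w v := by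
    intro v w
    rw [fderiv_clm_apply h (differentiableAt_const v)]
    simp
  have hd : ∀ v : Cn n, DifferentiableAt ℝ (fun y => fderiv ℝ f y v) x := fun v =>
    h.clm_apply (differentiableAt_const v)
  have sym : ∀ v w : Cn n, fderiv ℝ (fderiv ℝ f) x w v = fderiv ℝ (fderiv ℝ f) x v w := by
    intro v w
    exact (hf.isSymmSndFDerivAt (by
      rw [minSmoothness_of_isRCLikeNormedField]
      exact WithTop.coe_le_coe.2 le_top)).eq w v
  have full : ∀ (d : ℂ) (j : Fin n) (w : Cn n), fderiv ℝ (wirt d j f) x w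
      = (fderiv ℝ (fderiv ℝ f) x w (stdVec j)
        + d * fderiv ℝ (fderiv ℝ f) x w (Complex.I • stdVec j)) / 2 := by
    intro d j w
    have : fderiv ℝ (wirt d j f) x = (2 : ℂ)⁻¹ • (fderiv ℝ (fun y => fderiv ℝ f y (stdVec j)) x
        + d • fderiv ℝ (fun y => fderiv ℝ f y (Complex.I • stdVec j)) x) := by
      have h1 : wirt d j f = fun y => (2 : ℂ)⁻¹ * (fderiv ℝ f y (stdVec j)
          + d * fderiv ℝ f y (Complex.I • stdVec j)) := by
        funext y; simp only [wirt]; ring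
      rw [h1, fderiv_const_mul ((hd _).fun_add ((hd _).const_mul d)),
        fderiv_fun_add (hd _) ((hd _).const_mul d), fderiv_const_mul (hd _)]
    rw [this]
    simp only [smul_apply, add_apply, key, smul_eq_mul]
    ring
  rw [wirt, wirt, full, full, full, full, sym (stdVec j) (stdVec i),
    sym (Complex.I • stdVec j) (stdVec i), sym (stdVec j) (Complex.I • stdVec i),
    sym (Complex.I • stdVec j) (Complex.I • stdVec i)]
  ring

lemma integral_mul_wirt (hf : ContDiff ℝ 1 f) (hg : ContDiff ℝ 1 g) (hc : HasCompactSupport g) :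
    ∫ y, f y * wirt c j g y = -∫ y, wirt c j f y * g y := by
  have hcg : ∀ v : Cn n, Continuous fun y => fderiv ℝ g y v := fun v =>
    (hg.continuous_fderiv (by simp)).clm_apply continuous_const
  have hcf : ∀ v : Cn n, Continuous fun y => fderiv ℝ f y v := fun v =>
    (hf.continuous_fderiv (by simp)).clm_apply continuous_const
  have hsg : ∀ v : Cn n, HasCompactSupport fun y => fderiv ℝ g y v := fun v =>
    (hc.fderiv (𝕜 := ℝ)).comp_left (g := fun L : Cn n →L[ℝ] ℂ => L v) (by simp)
  have I1 : ∀ v : Cn n, Integrable fun y => fderiv ℝ f y v * g y := fun v =>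
    ((hcf v).mul hg.continuous).integrable_of_hasCompactSupport hc.mul_left
  have I2 : ∀ v : Cn n, Integrable fun y => f y * fderiv ℝ g y v := fun v =>
    (hf.continuous.mul (hcg v)).integrable_of_hasCompactSupport (hsg v).mul_left
  have I3 : Integrable fun y => f y * g y :=
    (hf.continuous.mul hg.continuous).integrable_of_hasCompactSupport hc.mul_left
  have key : ∀ v : Cn n, ∫ y, f y * fderiv ℝ g y v = -∫ y, fderiv ℝ f y v * g y := fun v =>
    integral_mul_fderiv_eq_neg_fderiv_mul_of_integrable (I1 v) (I2 v) I3
      (fun y _ => hf.differentiable (by simp) y) (fun y _ => hg.differentiable (by simp) y)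
  have e1 : ∀ y, f y * wirt c j g y = (2 : ℂ)⁻¹ * (f y * fderiv ℝ g y (stdVec j))
      + (2⁻¹ * c) * (f y * fderiv ℝ g y (Complex.I • stdVec j)) := by
    intro y; simp only [wirt]; ring
  have e2 : ∀ y, wirt c j f y * g y = (2 : ℂ)⁻¹ * (fderiv ℝ f y (stdVec j) * g y)
      + (2⁻¹ * c) * (fderiv ℝ f y (Complex.I • stdVec j) * g y) := by
    intro y; simp only [wirt]; ring
  simp only [e1, e2]
  rw [integral_add ((I2 _).const_mul _) ((I2 _).const_mul _),
    integral_add ((I1 _).const_mul _) ((I1 _).const_mul _)]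
  simp only [integral_const_mul, key]
  ring

lemma wirt_coord (i : Fin n) :
    wirt c j (fun y : Cn n => y i) x = if i = j then (1 + c * Complex.I) / 2 else 0 := by
  have : fderiv ℝ (fun y : Cn n => y i) x = PiLp.proj (𝕜 := ℝ) 2 (fun _ : Fin n => ℂ) i :=
    (PiLp.proj (𝕜 := ℝ) 2 (fun _ : Fin n => ℂ) i).hasFDerivAt.fderiv
  simp only [wirt, this]
  by_cases h : i = j
  · subst h; simp [stdVec]
  · simp [stdVec, h]

lemma contDiff_coord (i : Fin n) : ContDiff ℝ ∞ (fun y : Cn n => y i) :=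
  (PiLp.proj (𝕜 := ℝ) 2 (fun _ : Fin n => ℂ) i).contDiff

lemma contDiff_conj {f : Cn n → ℂ} (hf : ContDiff ℝ ∞ f) :
    ContDiff ℝ ∞ (fun y => conj (f y)) :=
  (Complex.conjCLE : ℂ →L[ℝ] ℂ).contDiff.comp hf

lemma contDiff_ofReal {q : Cn n → ℝ} (hq : ContDiff ℝ ∞ q) :
    ContDiff ℝ ∞ (fun y => (q y : ℂ)) :=
  Complex.ofRealCLM.contDiff.comp hq

lemma norm_sq_eq_sum (y : Cn n) : ((‖y‖ ^ 2 : ℝ) : ℂ) = ∑ i, y i * conj (y i) := by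
  rw [EuclideanSpace.norm_sq_eq]
  push_cast
  exact Finset.sum_congr rfl fun i _ => by rw [Complex.mul_conj, Complex.normSq_eq_norm_sq]; push_cast; rfl

lemma dzbar_norm_sq (j : Fin n) (x : Cn n) :
    dzbar j (fun y => ((‖y‖ ^ 2 : ℝ) : ℂ)) x = x j := by
  simp only [norm_sq_eq_sum]
  have hd : ∀ i : Fin n, DifferentiableAt ℝ (fun y : Cn n => y i) x := fun i =>
    (contDiff_coord i).differentiable (by simp) x
  have hd' : ∀ i : Fin n, DifferentiableAt ℝ (fun y : Cn n => (conj (y i : ℂ) : ℂ)) x := fun i =>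
    (contDiff_conj (contDiff_coord i)).differentiable (by simp) x
  rw [dzbar_eq_wirt, wirt_sum _ fun i _ => (hd i).fun_mul (hd' i)]
  simp [wirt_mul (hd _) (hd' _), wirt_conj, wirt_coord, apply_ite (starRingEnd ℂ)]

lemma dz_norm_sq (j : Fin n) (x : Cn n) :
    dz j (fun y => ((‖y‖ ^ 2 : ℝ) : ℂ)) x = conj (x j) := by
  simp only [norm_sq_eq_sum]
  have hd : ∀ i : Fin n, DifferentiableAt ℝ (fun y : Cn n => y i) x := fun i =>
    (contDiff_coord i).differentiable (by simp) x
  have hd' : ∀ i : Fin n, DifferentiableAt ℝ (fun y : Cn n => (conj (y i : ℂ) : ℂ)) x := fun i =>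
    (contDiff_conj (contDiff_coord i)).differentiable (by simp) x
  rw [dz_eq_wirt, wirt_sum _ fun i _ => (hd i).fun_mul (hd' i)]
  simp [wirt_mul (hd _) (hd' _), wirt_conj, wirt_coord]

end wirt

lemma dzbar_ofReal (j : Fin n) (q : Cn n → ℝ) (x : Cn n) :
    dzbar j (fun y => (q y : ℂ)) x = conj (dz j (fun y => (q y : ℂ)) x) := by
  rw [dz_eq_wirt, dzbar_eq_wirt]
  conv_lhs => rw [show (fun y => (q y : ℂ)) = fun y => conj (q y : ℂ) by simp, wirt_conj]
  simp

/-- A holomorphic function is killed by `∂/∂z̄_j`. -/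
lemma dzbar_eq_zero_of_differentiableAt {f : Cn n → ℂ} {x : Cn n} (j : Fin n)
    (hf : DifferentiableAt ℂ f x) : dzbar j f x = 0 := by
  have h : fderiv ℝ f x = (fderiv ℂ f x).restrictScalars ℝ :=
    (hf.hasFDerivAt.restrictScalars ℝ).fderiv
  simp only [dzbar, h, ContinuousLinearMap.coe_restrictScalars', map_smul, smul_eq_mul]
  rw [← mul_assoc, Complex.I_mul_I]; ring

/-- The Cauchy-Riemann equations characterize holomorphy. -/
lemma differentiableAt_of_dzbar_eq_zero {f : Cn n → ℂ} {x : Cn n} (hf : DifferentiableAt ℝ f x)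
    (h : ∀ j, dzbar j f x = 0) : DifferentiableAt ℂ f x := by
  rw [differentiableAt_iff_restrictScalars ℝ hf]
  have hI : ∀ j, fderiv ℝ f x (Complex.I • stdVec j) = Complex.I * fderiv ℝ f x (stdVec j) := by
    intro j
    have := h j
    simp only [dzbar, div_eq_zero_iff, OfNat.ofNat_ne_zero, or_false] at this
    have h2 : fderiv ℝ f x (stdVec j) = -(Complex.I * fderiv ℝ f x (Complex.I • stdVec j)) :=
      eq_neg_of_add_eq_zero_left this
    rw [h2, mul_neg, ← mul_assoc, Complex.I_mul_I]; ring
  -- The complex-linear map with the right values on the `e_j`; the Cauchy-Riemann equations `hI`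
  -- force agreement on the `i e_j` as well.
  let g : Cn n →L[ℂ] ℂ := ∑ j, (fderiv ℝ f x (stdVec j)) •
    (PiLp.proj (𝕜 := ℂ) 2 (fun _ : Fin n => ℂ) j)
  refine ⟨g, ?_⟩
  ext v
  have hv : v = ∑ j, ((v j).re • stdVec j + (v j).im • (Complex.I • stdVec j)) := by
    ext i
    simp only [WithLp.ofLp_sum, Finset.sum_apply, stdVec, EuclideanSpace.single, PiLp.add_apply, PiLp.smul_apply,
      PiLp.single_apply, smul_eq_mul]
    rw [Finset.sum_eq_single i]
    · simp [Complex.re_add_im]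
    · intro b _ hb
      simp [hb.symm]
    · simp
  conv_rhs => rw [hv]
  simp only [map_sum, map_add, map_smul, hI]
  simp only [g, ContinuousLinearMap.coe_restrictScalars', sum_apply,
    smul_apply, PiLp.proj_apply, smul_eq_mul, Complex.real_smul]
  refine Finset.sum_congr rfl fun j _ => ?_
  conv_lhs => rw [← Complex.re_add_im (v j)]
  ring

/-! ### Test functions. -/

/-- Smooth functions with compact support. -/
structure IsTest (f : Cn n → ℂ) : Prop where
  smooth : ContDiff ℝ ∞ f
  compact : HasCompactSupport f

section test

variable {f g : Cn n → ℂ}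

lemma IsTest.wirt (hf : IsTest f) (c : ℂ) (j : Fin n) : IsTest (wirt c j f) :=
  ⟨contDiff_wirt hf.smooth, hasCompactSupport_wirt hf.compact⟩

lemma IsTest.dzbar (hf : IsTest f) (j : Fin n) : IsTest (dzbar j f) := hf.wirt _ j

lemma IsTest.dz (hf : IsTest f) (j : Fin n) : IsTest (dz j f) := by
  rw [dz_eq_wirt]; exact hf.wirt _ j

lemma IsTest.mul_right (hf : IsTest f) (hg : ContDiff ℝ ∞ g) : IsTest fun y => f y * g y :=
  ⟨hf.smooth.mul hg, hf.compact.mul_right⟩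

lemma IsTest.mul_left (hf : IsTest f) (hg : ContDiff ℝ ∞ g) : IsTest fun y => g y * f y :=
  ⟨hg.mul hf.smooth, hf.compact.mul_left⟩

lemma IsTest.add (hf : IsTest f) (hg : IsTest g) : IsTest fun y => f y + g y :=
  ⟨hf.smooth.add hg.smooth, hf.compact.add hg.compact⟩

lemma IsTest.neg (hf : IsTest f) : IsTest fun y => -f y :=
  ⟨hf.smooth.neg, hf.compact.neg⟩

lemma IsTest.conj (hf : IsTest f) : IsTest fun y => conj (f y) :=
  ⟨contDiff_conj hf.smooth, hf.compact.comp_left (map_zero _)⟩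

lemma IsTest.zero : IsTest fun _ : Cn n => (0 : ℂ) :=
  ⟨contDiff_const, HasCompactSupport.zero⟩

lemma IsTest.sum {ι : Type*} (s : Finset ι) {F : ι → Cn n → ℂ} (hF : ∀ l ∈ s, IsTest (F l)) :
    IsTest fun y => ∑ l ∈ s, F l y := by
  classical
  induction s using Finset.induction_on with
  | empty => simpa using IsTest.zero
  | insert a s ha ih =>
    simp only [Finset.sum_insert ha]
    exact (hF a (by simp)).add (ih fun l hl => hF l (by simp [hl]))

lemma IsTest.integrable (hf : IsTest f) : Integrable f :=
  hf.smooth.continuous.integrable_of_hasCompactSupport hf.compact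

lemma contDiff_dz (hf : ContDiff ℝ ∞ f) (j : Fin n) : ContDiff ℝ ∞ (dz j f) := by
  rw [dz_eq_wirt]; exact contDiff_wirt hf

lemma contDiff_dzbar (hf : ContDiff ℝ ∞ f) (j : Fin n) : ContDiff ℝ ∞ (dzbar j f) :=
  contDiff_wirt hf

end test

/-! ### Weighted adjoints and the Bochner-Kodaira identity. -/

/-- The weight `e^{-ψ}`. -/
def expWeight (ψ : Cn n → ℝ) (x : Cn n) : ℂ := (Real.exp (-ψ x) : ℂ)

lemma contDiff_expWeight {ψ : Cn n → ℝ} (hψ : ContDiff ℝ ∞ ψ) : ContDiff ℝ ∞ (expWeight ψ) :=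
  contDiff_ofReal (Real.contDiff_exp.comp hψ.neg)

lemma wirt_expWeight {ψ : Cn n → ℝ} (hψ : ContDiff ℝ ∞ ψ) (c : ℂ) (j : Fin n) (x : Cn n) :
    wirt c j (expWeight ψ) x = -wirt c j (fun y => (ψ y : ℂ)) x * expWeight ψ x := by
  have h : HasDerivAt (fun s => Real.exp (-s)) (-Real.exp (-ψ x)) (ψ x) := by
    simpa using (hasDerivAt_neg (ψ x)).exp
  have := wirt_ofReal_comp (c := c) (j := j) h (hψ.differentiable (by simp) x)
  unfold expWeight
  rw [this]; push_cast; ring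

/-- The formal adjoint of `∂/∂z̄_j` for the weight `e^{-ψ}`. -/
def adjZ (ψ : Cn n → ℝ) (j : Fin n) (f : Cn n → ℂ) (x : Cn n) : ℂ :=
  -dz j f x + dz j (fun y => (ψ y : ℂ)) x * f x

/-- The weighted Laplacian `∂̄* ∂̄` on functions. -/
def boxOp (ψ : Cn n → ℝ) (g : Cn n → ℂ) (x : Cn n) : ℂ :=
  ∑ j, adjZ ψ j (dzbar j g) x

section

variable {ψ : Cn n → ℝ}

lemma contDiff_adjZ (hψ : ContDiff ℝ ∞ ψ) {f : Cn n → ℂ} (hf : ContDiff ℝ ∞ f) (j : Fin n) :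
    ContDiff ℝ ∞ (adjZ ψ j f) :=
  (contDiff_dz hf j).neg.add ((contDiff_dz (contDiff_ofReal hψ) j).mul hf)

lemma IsTest.adjZ (hψ : ContDiff ℝ ∞ ψ) {f : Cn n → ℂ} (hf : IsTest f) (j : Fin n) :
    IsTest (adjZ ψ j f) :=
  (hf.dz j).neg.add (hf.mul_left (contDiff_dz (contDiff_ofReal hψ) j))

lemma IsTest.boxOp (hψ : ContDiff ℝ ∞ ψ) {f : Cn n → ℂ} (hf : IsTest f) :
    IsTest (boxOp ψ f) :=
  IsTest.sum _ fun j _ => (hf.dzbar j).adjZ hψ j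

/-- Integration by parts; the zeroth-order term of `adjZ` is what the derivative of `e^{-ψ}`
contributes. Compact support of either factor is enough, which matters later when the other one is
only smooth. -/
lemma integral_dzbar_mul_conj (hψ : ContDiff ℝ ∞ ψ) {a b : Cn n → ℂ} (ha : ContDiff ℝ ∞ a)
    (hb : ContDiff ℝ ∞ b) (hc : HasCompactSupport a ∨ HasCompactSupport b) (j : Fin n) :
    ∫ y, dzbar j a y * conj (b y) * expWeight ψ y
      = ∫ y, a y * conj (adjZ ψ j b y) * expWeight ψ y := by
  set q : Cn n → ℂ := fun y => conj (b y) * expWeight ψ y with hq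
  have hqs : ContDiff ℝ ∞ q := (contDiff_conj hb).mul (contDiff_expWeight hψ)
  have hdq : ∀ y, dzbar j q y = -(conj (adjZ ψ j b y) * expWeight ψ y) := by
    intro y
    rw [dzbar_eq_wirt, hq, wirt_mul ((contDiff_conj hb).differentiable (by simp) y)
      ((contDiff_expWeight hψ).differentiable (by simp) y), wirt_conj, wirt_expWeight hψ,
      ← dzbar_eq_wirt, dzbar_ofReal, Complex.conj_I, ← dz_eq_wirt]
    simp only [adjZ, map_add, map_neg, map_mul]
    ring
  have key : ∫ y, dzbar j a y * q y = -∫ y, a y * dzbar j q y := by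
    rcases hc with hc | hc
    · have := integral_mul_wirt (c := Complex.I) (j := j) (hqs.of_le (by simp))
        (ha.of_le (by simp)) hc
      simp only [dzbar_eq_wirt, mul_comm _ (q _), mul_comm (a _)]
      rw [this]
    · have hqc : HasCompactSupport q := (hc.comp_left (map_zero _)).mul_right
      have := integral_mul_wirt (c := Complex.I) (j := j) (ha.of_le (by simp))
        (hqs.of_le (by simp)) hqc
      simp only [dzbar_eq_wirt]
      rw [this, neg_neg]
  calc ∫ y, dzbar j a y * conj (b y) * expWeight ψ y = ∫ y, dzbar j a y * q y := by
        simp only [hq, mul_assoc]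
    _ = -∫ y, a y * dzbar j q y := key
    _ = _ := by
        rw [← integral_neg]
        refine integral_congr_ae (.of_forall fun y => ?_)
        simp only [hdq]; ring

lemma conj_expWeight (x : Cn n) : conj (expWeight ψ x) = expWeight ψ x := Complex.conj_ofReal _

lemma integral_adjZ_mul_conj (hψ : ContDiff ℝ ∞ ψ) {a b : Cn n → ℂ} (ha : ContDiff ℝ ∞ a)
    (hb : ContDiff ℝ ∞ b) (hc : HasCompactSupport a ∨ HasCompactSupport b) (j : Fin n) :
    ∫ y, adjZ ψ j b y * conj (a y) * expWeight ψ y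
      = ∫ y, b y * conj (dzbar j a y) * expWeight ψ y := by
  have h := congrArg conj (integral_dzbar_mul_conj hψ ha hb hc j)
  rw [← integral_conj, ← integral_conj] at h
  simp only [map_mul, Complex.conj_conj, conj_expWeight] at h
  refine Eq.trans ?_ (h.symm.trans ?_)
  · exact integral_congr_ae (.of_forall fun y => by ring)
  · exact integral_congr_ae (.of_forall fun y => by ring)

lemma integral_boxOp_mul_conj (hψ : ContDiff ℝ ∞ ψ) {a g : Cn n → ℂ} (ha : ContDiff ℝ ∞ a)
    (hg : IsTest g) :
    ∫ y, a y * conj (boxOp ψ g y) * expWeight ψ y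
      = ∑ j, ∫ y, dzbar j a y * conj (dzbar j g y) * expWeight ψ y := by
  simp only [integral_dzbar_mul_conj hψ ha (hg.dzbar _).smooth (Or.inr (hg.dzbar _).compact)]
  rw [← integral_finsetSum]
  · refine integral_congr_ae (.of_forall fun y => ?_)
    simp only [boxOp, map_sum, Finset.mul_sum, Finset.sum_mul]
  · intro j _
    exact ((((hg.dzbar j).adjZ hψ j).conj.mul_left ha).mul_right (contDiff_expWeight hψ)).integrable

/-- The commutator of `∂/∂z̄_k` with the adjoint of `∂/∂z̄_j` is multiplication by `ψ_{jk̄}`. All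
positivity in the spectral gap comes from this term. -/
lemma dzbar_adjZ (hψ : ContDiff ℝ ∞ ψ) {f : Cn n → ℂ} (hf : ContDiff ℝ ∞ f) (j k : Fin n)
    (x : Cn n) :
    dzbar k (adjZ ψ j f) x
      = adjZ ψ j (dzbar k f) x + dz j (dzbar k (fun y => (ψ y : ℂ))) x * f x := by
  have h1 := ((contDiff_dz hf j).neg).differentiable (by simp) x
  have hψ' := contDiff_ofReal hψ
  have h2 := (contDiff_dz hψ' j).differentiable (by simp) x
  have h3 := hf.differentiable (by simp) x
  have e1 : dzbar k (dz j f) x = dz j (dzbar k f) x := by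
    simp only [dz_eq_wirt, dzbar_eq_wirt]; exact wirt_comm hf.contDiffAt
  have e2 : dzbar k (dz j (fun y => (ψ y : ℂ))) x = dz j (dzbar k (fun y => (ψ y : ℂ))) x := by
    simp only [dz_eq_wirt, dzbar_eq_wirt]; exact wirt_comm hψ'.contDiffAt
  rw [dzbar_eq_wirt]
  unfold adjZ
  rw [wirt_add h1 (h2.fun_mul h3), wirt_neg, wirt_mul h2 h3]
  simp only [← dzbar_eq_wirt, e1, e2]
  ring

/-- The complex Hessian of `ψ` is bounded below by `c` on all of `ℂⁿ`. -/
def LeviBound (ψ : Cn n → ℝ) (c : ℝ) : Prop :=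
  ∀ (x : Cn n) (ζ : Fin n → ℂ), c * ∑ j, ‖ζ j‖ ^ 2 ≤
    (∑ j, ∑ k, dz j (dzbar k (fun y => (ψ y : ℂ))) x * ζ j * conj (ζ k)).re

/-- The Bochner-Kodaira identity: move one `∂̄` off `boxOp ψ g`, commute it past the adjoint by
`dzbar_adjZ`, and move the adjoint back as a `∂̄`. The price is the Levi form of `ψ` on `∂̄g`. -/
lemma integral_boxOp_sq (hψ : ContDiff ℝ ∞ ψ) {g : Cn n → ℂ} (hg : IsTest g) :
    ∫ y, boxOp ψ g y * conj (boxOp ψ g y) * expWeight ψ y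
      = ∫ y, (∑ j, ∑ k, dzbar k (dzbar j g) y * conj (dzbar k (dzbar j g) y)
        + ∑ j, ∑ k, dz j (dzbar k (fun y => (ψ y : ℂ))) y * dzbar j g y * conj (dzbar k g y))
          * expWeight ψ y := by
  have hm := contDiff_expWeight hψ
  have hψ' := contDiff_ofReal hψ
  rw [integral_boxOp_mul_conj hψ (hg.boxOp hψ).smooth hg]
  have step : ∀ k, ∫ y, dzbar k (boxOp ψ g) y * conj (dzbar k g y) * expWeight ψ y
      = ∑ j, ∫ y, (dzbar k (dzbar j g) y * conj (dzbar k (dzbar j g) y)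
        + dz j (dzbar k (fun y => (ψ y : ℂ))) y * dzbar j g y * conj (dzbar k g y))
          * expWeight ψ y := by
    intro k
    have e : ∀ y, dzbar k (boxOp ψ g) y = ∑ j, (adjZ ψ j (dzbar k (dzbar j g)) y
        + dz j (dzbar k (fun y => (ψ y : ℂ))) y * dzbar j g y) := by
      intro y
      have : dzbar k (boxOp ψ g) y = ∑ j, dzbar k (adjZ ψ j (dzbar j g)) y := by
        rw [dzbar_eq_wirt]
        exact wirt_sum _ fun j _ => ((hg.dzbar j).adjZ hψ j).smooth.differentiable (by simp) y
      rw [this]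
      exact Finset.sum_congr rfl fun j _ => dzbar_adjZ hψ (hg.dzbar j).smooth j k y
    have hT1 : ∀ j, IsTest fun y => adjZ ψ j (dzbar k (dzbar j g)) y * conj (dzbar k g y)
        * expWeight ψ y := fun j =>
      ((((hg.dzbar j).dzbar k).adjZ hψ j).mul_right (hg.dzbar k).conj.smooth).mul_right hm
    have hT2 : ∀ j, IsTest fun y => dz j (dzbar k (fun y => (ψ y : ℂ))) y * dzbar j g y
        * conj (dzbar k g y) * expWeight ψ y := fun j =>
      (((hg.dzbar j).mul_left (contDiff_dz (contDiff_dzbar hψ' k) j)).mul_right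
        (hg.dzbar k).conj.smooth).mul_right hm
    have hT3 : ∀ j, IsTest fun y => dzbar k (dzbar j g) y * conj (dzbar k (dzbar j g) y)
        * expWeight ψ y := fun j =>
      (((hg.dzbar j).dzbar k).mul_right ((hg.dzbar j).dzbar k).conj.smooth).mul_right hm
    have comm : ∀ j y, dzbar j (dzbar k g) y = dzbar k (dzbar j g) y := fun j y =>
      wirt_comm hg.smooth.contDiffAt
    calc ∫ y, dzbar k (boxOp ψ g) y * conj (dzbar k g y) * expWeight ψ y
        = ∫ y, ∑ j, (adjZ ψ j (dzbar k (dzbar j g)) y * conj (dzbar k g y) * expWeight ψ y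
          + dz j (dzbar k (fun y => (ψ y : ℂ))) y * dzbar j g y * conj (dzbar k g y)
            * expWeight ψ y) := by
          refine integral_congr_ae (.of_forall fun y => ?_)
          simp only [e, Finset.sum_mul]
          exact Finset.sum_congr rfl fun j _ => by ring
      _ = ∑ j, ((∫ y, adjZ ψ j (dzbar k (dzbar j g)) y * conj (dzbar k g y) * expWeight ψ y)
          + ∫ y, dz j (dzbar k (fun y => (ψ y : ℂ))) y * dzbar j g y * conj (dzbar k g y)
            * expWeight ψ y) := by
          rw [integral_finsetSum _ fun j _ => ((hT1 j).add (hT2 j)).integrable]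
          exact Finset.sum_congr rfl fun j _ => integral_add (hT1 j).integrable (hT2 j).integrable
      _ = _ := by
          refine Finset.sum_congr rfl fun j _ => ?_
          rw [integral_adjZ_mul_conj hψ (hg.dzbar k).smooth ((hg.dzbar j).dzbar k).smooth
            (Or.inl (hg.dzbar k).compact)]
          simp only [comm]
          rw [← integral_add (hT3 j).integrable (hT2 j).integrable]
          exact integral_congr_ae (.of_forall fun y => by ring)
  simp only [step]
  have hT : ∀ j k, IsTest fun y => (dzbar k (dzbar j g) y * conj (dzbar k (dzbar j g) y)
        + dz j (dzbar k (fun y => (ψ y : ℂ))) y * dzbar j g y * conj (dzbar k g y))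
          * expWeight ψ y := fun j k =>
    ((((hg.dzbar j).dzbar k).mul_right ((hg.dzbar j).dzbar k).conj.smooth).add
      (((hg.dzbar j).mul_left (contDiff_dz (contDiff_dzbar hψ' k) j)).mul_right
        (hg.dzbar k).conj.smooth)).mul_right hm
  rw [Finset.sum_comm]
  have : ∀ j, ∑ k, ∫ y, (dzbar k (dzbar j g) y * conj (dzbar k (dzbar j g) y)
        + dz j (dzbar k (fun y => (ψ y : ℂ))) y * dzbar j g y * conj (dzbar k g y))
          * expWeight ψ y = ∫ y, ∑ k, (dzbar k (dzbar j g) y * conj (dzbar k (dzbar j g) y)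
        + dz j (dzbar k (fun y => (ψ y : ℂ))) y * dzbar j g y * conj (dzbar k g y))
          * expWeight ψ y := fun j =>
    (integral_finsetSum _ fun k _ => (hT j k).integrable).symm
  simp only [this]
  rw [← integral_finsetSum _ fun j _ => (IsTest.sum _ fun k _ => hT j k).integrable]
  refine integral_congr_ae (.of_forall fun y => ?_)
  simp only [← Finset.sum_mul, Finset.sum_add_distrib]

lemma IsTest.integrable_normSq (hψ : ContDiff ℝ ∞ ψ) {f : Cn n → ℂ} (hf : IsTest f) :
    Integrable fun y => ‖f y‖ ^ 2 * Real.exp (-ψ y) := by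
  have : Continuous fun y => ‖f y‖ ^ 2 * Real.exp (-ψ y) :=
    (hf.smooth.continuous.norm.pow 2).mul (Real.continuous_exp.comp hψ.continuous.neg)
  exact this.integrable_of_hasCompactSupport
    ((hf.compact.comp_left (g := fun z : ℂ => ‖z‖ ^ 2) (by simp)).mul_right)

lemma mul_conj_expWeight (z : ℂ) (x : Cn n) :
    z * conj z * expWeight ψ x = ((‖z‖ ^ 2 * Real.exp (-ψ x) : ℝ) : ℂ) := by
  rw [Complex.mul_conj, Complex.normSq_eq_norm_sq, expWeight]; push_cast; ring

/-- The basic `L²` inequality: `c ‖∂̄g‖² ≤ ‖∂̄* ∂̄ g‖²`. -/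
theorem LeviBound.le_integral_boxOp_sq {c : ℝ} (hc : LeviBound ψ c) (hψ : ContDiff ℝ ∞ ψ)
    {g : Cn n → ℂ} (hg : IsTest g) :
    c * ∫ y, (∑ j, ‖dzbar j g y‖ ^ 2) * Real.exp (-ψ y)
      ≤ ∫ y, ‖boxOp ψ g y‖ ^ 2 * Real.exp (-ψ y) := by
  have h := integral_boxOp_sq hψ hg
  simp only [mul_conj_expWeight] at h
  rw [integral_complex_ofReal] at h
  have hm := contDiff_expWeight hψ
  have hψ' := contDiff_ofReal hψ
  have hI : IsTest fun y => (∑ j, ∑ k, dzbar k (dzbar j g) y * conj (dzbar k (dzbar j g) y)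
        + ∑ j, ∑ k, dz j (dzbar k (fun y => (ψ y : ℂ))) y * dzbar j g y * conj (dzbar k g y))
          * expWeight ψ y :=
    ((IsTest.sum _ fun j _ => IsTest.sum _ fun k _ =>
        ((hg.dzbar j).dzbar k).mul_right ((hg.dzbar j).dzbar k).conj.smooth).add
      (IsTest.sum _ fun j _ => IsTest.sum _ fun k _ =>
        ((hg.dzbar j).mul_left (contDiff_dz (contDiff_dzbar hψ' k) j)).mul_right
        (hg.dzbar k).conj.smooth)).mul_right hm
  have h2 := congrArg Complex.re h
  rw [Complex.ofReal_re] at h2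
  rw [h2, ← RCLike.re_eq_complex_re, ← integral_re hI.integrable, ← integral_const_mul]
  have hL : Integrable fun y => c * ((∑ j, ‖dzbar j g y‖ ^ 2) * Real.exp (-ψ y)) := by
    refine Integrable.const_mul ?_ c
    simp only [Finset.sum_mul]
    exact integrable_finsetSum _ fun j _ => (hg.dzbar j).integrable_normSq hψ
  refine integral_mono hL hI.integrable.re fun y => ?_
  have hre : ∀ z : ℂ, RCLike.re (z * expWeight ψ y) = z.re * Real.exp (-ψ y) := by
    intro z; exact Complex.re_mul_ofReal z _
  simp only [hre]
  rw [← mul_assoc]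
  refine mul_le_mul_of_nonneg_right ?_ (Real.exp_pos _).le
  rw [Complex.add_re]
  -- The Levi term is bounded below with `ζ = ∂̄g`; the squares of the second derivatives are
  -- nonnegative and are dropped.
  refine (hc y fun j => dzbar j g y).trans (le_add_of_nonneg_left ?_)
  simp only [Complex.re_sum, Complex.mul_conj, Complex.ofReal_re]
  exact Finset.sum_nonneg fun j _ => Finset.sum_nonneg fun k _ => Complex.normSq_nonneg _

end

/-! ### Convolution and radial mollifiers. -/

/-- Convolution of complex-valued functions on `ℂⁿ`. -/
def mconv (ρ v : Cn n → ℂ) (x : Cn n) : ℂ := ∫ t, ρ t * v (x - t)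

section mconv

variable {ρ v : Cn n → ℂ}

lemma mconv_eq_convolution (ρ v : Cn n → ℂ) :
    mconv ρ v = convolution ρ v (ContinuousLinearMap.mul ℝ ℂ) volume := by
  funext x; simp [mconv, convolution]

lemma mconv_eq_swap (ρ v : Cn n → ℂ) (x : Cn n) : mconv ρ v x = ∫ y, ρ (x - y) * v y := by
  rw [mconv_eq_convolution, convolution_eq_swap]; simp

lemma mconv_comm (ρ v : Cn n → ℂ) (x : Cn n) : mconv ρ v x = mconv v ρ x := by
  rw [mconv_eq_swap, mconv]; simp only [mul_comm]

lemma contDiff_mconv (hρ : IsTest ρ) (hv : LocallyIntegrable v) : ContDiff ℝ ∞ (mconv ρ v) := by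
  rw [mconv_eq_convolution]
  exact hρ.compact.contDiff_convolution_left (n := ⊤) _ hρ.smooth hv

lemma integrable_mconv (hρ : IsTest ρ) (hv : LocallyIntegrable v) (x : Cn n) :
    Integrable fun t => ρ t * v (x - t) :=
  hρ.compact.convolutionExists_left (ContinuousLinearMap.mul ℝ ℂ) hρ.smooth.continuous hv x

lemma integrable_mconv_swap (hρ : IsTest ρ) (hv : LocallyIntegrable v) (x : Cn n) :
    Integrable fun y => ρ (x - y) * v y := by
  have := (integrable_mconv hρ hv x).comp_sub_left x
  simpa using this

lemma fderiv_mconv_apply (hρ : IsTest ρ) (hv : LocallyIntegrable v) (x w : Cn n) :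
    fderiv ℝ (mconv ρ v) x w = ∫ t, fderiv ℝ ρ t w * v (x - t) := by
  have h := hρ.compact.hasFDerivAt_convolution_left (ContinuousLinearMap.mul ℝ ℂ)
    (hρ.smooth.of_le (by simp)) hv x
  rw [mconv_eq_convolution, h.fderiv, convolution]
  rw [ContinuousLinearMap.integral_apply]
  · simp [ContinuousLinearMap.precompL_apply]
  · exact (hρ.compact.fderiv (𝕜 := ℝ)).convolutionExists_left _
      (hρ.smooth.continuous_fderiv (by simp)) hv x

lemma wirt_mconv (hρ : IsTest ρ) (hv : LocallyIntegrable v) (c : ℂ) (j : Fin n) (x : Cn n) :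
    wirt c j (mconv ρ v) x = mconv (wirt c j ρ) v x := by
  have hI : ∀ w, Integrable fun t => fderiv ℝ ρ t w * v (x - t) := by
    intro w
    have h1 : HasCompactSupport fun t => fderiv ℝ ρ t w :=
      (hρ.compact.fderiv (𝕜 := ℝ)).comp_left (g := fun L : Cn n →L[ℝ] ℂ => L w) (by simp)
    exact h1.convolutionExists_left (ContinuousLinearMap.mul ℝ ℂ)
      ((hρ.smooth.continuous_fderiv (by simp)).clm_apply continuous_const) hv x
  simp only [wirt, fderiv_mconv_apply hρ hv, mconv]
  rw [← integral_const_mul, ← integral_add (hI _) ((hI _).const_mul c), ← integral_div]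
  exact integral_congr_ae (.of_forall fun t => by ring)

end mconv

/-- The unnormalized radial bump function. -/
def radialBump (x : Cn n) : ℝ := expNegInvGlue (1 - ‖x‖ ^ 2)

/-- A radial mollifier, supported in the ball of radius `ε`. -/
def mollifier (ε : ℝ) (x : Cn n) : ℝ :=
  (ε ^ Module.finrank ℝ (Cn n) * ∫ y : Cn n, radialBump y)⁻¹ * radialBump (ε⁻¹ • x)

lemma contDiff_radialBump : ContDiff ℝ ∞ (radialBump (n := n)) :=
  expNegInvGlue.contDiff (n := ⊤) |>.comp (contDiff_const.sub (contDiff_norm_sq ℝ))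

lemma radialBump_nonneg (x : Cn n) : 0 ≤ radialBump x := expNegInvGlue.nonneg _

lemma radialBump_eq_zero {x : Cn n} (hx : 1 ≤ ‖x‖) : radialBump x = 0 :=
  expNegInvGlue.zero_of_nonpos (by nlinarith)

lemma hasCompactSupport_radialBump : HasCompactSupport (radialBump (n := n)) :=
  HasCompactSupport.of_support_subset_isCompact (isCompact_closedBall 0 1) fun x hx => by
    by_contra h
    simp only [Metric.mem_closedBall, dist_zero_right, not_le] at h
    exact hx (radialBump_eq_zero h.le)

lemma integral_radialBump_pos : 0 < ∫ y : Cn n, radialBump y :=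
  contDiff_radialBump.continuous.integral_pos_of_hasCompactSupport_nonneg_nonzero
    hasCompactSupport_radialBump radialBump_nonneg (x := 0)
    (by simp [radialBump, (expNegInvGlue.pos_of_pos one_pos).ne'])

section mollifier

variable {ε : ℝ}

lemma mollifier_nonneg (hε : 0 < ε) (x : Cn n) : 0 ≤ mollifier ε x :=
  mul_nonneg (inv_nonneg.2 (mul_nonneg (pow_nonneg hε.le _) integral_radialBump_pos.le))
    (radialBump_nonneg _)

lemma mollifier_eq_zero (hε : 0 < ε) {x : Cn n} (hx : ε ≤ ‖x‖) : mollifier ε x = 0 := by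
  have : 1 ≤ ‖ε⁻¹ • x‖ := by
    rw [norm_smul, norm_inv, Real.norm_of_nonneg hε.le, inv_mul_eq_div, one_le_div hε]
    exact hx
  simp [mollifier, radialBump_eq_zero this]

/-- Invariance under the circle action is what makes these mollifiers reproduce holomorphic
functions in `mconv_mollifier_eq`. -/
lemma mollifier_smul (c : ℂ) (hc : ‖c‖ = 1) (x : Cn n) : mollifier ε (c • x) = mollifier ε x := by
  simp [mollifier, radialBump, norm_smul, hc]

lemma mollifier_neg (x : Cn n) : mollifier ε (-x) = mollifier ε x := by
  simp [mollifier, radialBump]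

lemma isTest_mollifier (hε : 0 < ε) : IsTest fun x : Cn n => (mollifier ε x : ℂ) := by
  refine ⟨contDiff_ofReal ?_, ?_⟩
  · exact contDiff_const.mul (contDiff_radialBump.comp (contDiff_const_smul _))
  · refine HasCompactSupport.of_support_subset_isCompact (isCompact_closedBall 0 ε) fun x hx => ?_
    by_contra h
    simp only [Metric.mem_closedBall, dist_zero_right, not_le] at h
    exact hx (by simp [mollifier_eq_zero hε h.le])

lemma integrable_mollifier (hε : 0 < ε) : Integrable (mollifier ε : Cn n → ℝ) := by
  simpa using (isTest_mollifier (n := n) hε).integrable.re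

lemma integral_mollifier (hε : 0 < ε) : ∫ x : Cn n, mollifier ε x = 1 := by
  have h0 := integral_radialBump_pos (n := n)
  have h1 : 0 < ε ^ Module.finrank ℝ (Cn n) := pow_pos hε _
  simp only [mollifier]
  rw [integral_const_mul, Measure.integral_comp_inv_smul, abs_of_pos h1, smul_eq_mul,
    inv_mul_cancel₀ (mul_pos h1 h0).ne']

lemma exists_mollifier_le : ∃ A : ℝ, 0 < A ∧ ∀ ε : ℝ, 0 < ε → ∀ x : Cn n,
    mollifier ε x ≤ A / ε ^ Module.finrank ℝ (Cn n) := by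
  have h0 := integral_radialBump_pos (n := n)
  refine ⟨1 / ∫ y : Cn n, radialBump y, by positivity, fun ε hε x => ?_⟩
  have h1 : 0 < ε ^ Module.finrank ℝ (Cn n) := pow_pos hε _
  have h2 : radialBump (ε⁻¹ • x) ≤ 1 := by
    rw [radialBump, expNegInvGlue]
    split_ifs
    · exact zero_le_one
    · rename_i h
      rw [Real.exp_le_one_iff, neg_nonpos]
      exact inv_nonneg.2 (not_le.1 h).le
  rw [mollifier, div_div, mul_comm (∫ _, _), one_div]
  exact mul_le_of_le_one_right (inv_nonneg.2 (mul_pos h1 h0).le) h2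

/-- By scaling, a derivative costs one more power of `ε` than in `exists_mollifier_le`. That power
is won back in `exists_commKernel_le`. -/
lemma exists_wirt_mollifier_le (c : ℂ) : ∃ A : ℝ, 0 < A ∧ ∀ ε : ℝ, 0 < ε →
    ∀ (j : Fin n) (x : Cn n), ‖wirt c j (fun y => (mollifier ε y : ℂ)) x‖
      ≤ A / ε ^ (Module.finrank ℝ (Cn n) + 1) := by
  have hb : IsTest fun x : Cn n => (mollifier 1 x : ℂ) := isTest_mollifier one_pos
  have hB : ∀ j : Fin n, ∃ B, ∀ x, ‖wirt c j (fun y => (mollifier 1 y : ℂ)) x‖ ≤ B := fun j =>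
    (hb.wirt c j).smooth.continuous.bounded_above_of_compact_support (hb.wirt c j).compact
  choose B hB using hB
  refine ⟨∑ j, |B j| + 1, by positivity, fun ε hε j x => ?_⟩
  set d := Module.finrank ℝ (Cn n)
  have e : (fun y : Cn n => (mollifier ε y : ℂ))
      = fun y => (((ε ^ d)⁻¹ : ℝ) : ℂ) * (fun z => (mollifier 1 z : ℂ)) (ε⁻¹ • y) := by
    funext y
    simp only [mollifier, one_pow, one_mul, inv_one, one_smul, mul_inv]
    push_cast
    ring
  have hd : DifferentiableAt ℝ (fun y : Cn n => (fun z => (mollifier 1 z : ℂ)) (ε⁻¹ • y)) x :=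
    (hb.smooth.comp (contDiff_const_smul _)).differentiable (by simp) x
  have h1 : wirt c j (fun y : Cn n => (fun z => (mollifier 1 z : ℂ)) (ε⁻¹ • y)) x
      = (ε⁻¹ : ℝ) * wirt c j (fun z => (mollifier 1 z : ℂ)) (ε⁻¹ • x) := by
    simp only [wirt, fderiv_comp_smul (f := fun z : Cn n => (mollifier 1 z : ℂ)), smul_apply, Complex.real_smul]
    ring
  rw [e, wirt_const_mul _ hd, h1, norm_mul, norm_mul, Complex.norm_real, Complex.norm_real,
    Real.norm_of_nonneg (by positivity), Real.norm_of_nonneg (by positivity)]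
  have h2 : ‖wirt c j (fun z => (mollifier 1 z : ℂ)) (ε⁻¹ • x)‖ ≤ ∑ j, |B j| + 1 := by
    refine (hB j _).trans ((le_abs_self _).trans ?_)
    have := Finset.single_le_sum (f := fun j => |B j|) (fun i _ => abs_nonneg _) (Finset.mem_univ j)
    linarith
  calc (ε ^ d)⁻¹ * (ε⁻¹ * ‖wirt c j (fun z => (mollifier 1 z : ℂ)) (ε⁻¹ • x)‖)
      ≤ (ε ^ d)⁻¹ * (ε⁻¹ * (∑ j, |B j| + 1)) := by gcongr
    _ = _ := by rw [pow_succ]; field_simp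

end mollifier

/-! ### Mean value property and smoothness of holomorphic functions. -/

section meanvalue

variable {ε r : ℝ} {u : Cn n → ℂ} {x : Cn n}

lemma continuous_mollifier_mul (hε : 0 < ε) (hr : ε < r) (hu : ContinuousOn u (Metric.ball x r)) :
    Continuous fun h => (mollifier ε h : ℂ) * u (x - h) := by
  rw [continuous_iff_continuousAt]
  intro h
  by_cases hh : ‖h‖ < r
  · have h1 : ContinuousAt u (x - h) :=
      hu.continuousAt (Metric.isOpen_ball.mem_nhds (by simpa [dist_eq_norm] using hh))
    exact (isTest_mollifier hε).smooth.continuous.continuousAt.mul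
      (ContinuousAt.comp (f := fun h => x - h) h1 (by fun_prop))
  · have h1 : (fun h => (mollifier ε h : ℂ) * u (x - h)) =ᶠ[nhds h] fun _ => 0 := by
      have : {y : Cn n | ε < ‖y‖} ∈ nhds h :=
        (isOpen_lt continuous_const continuous_norm).mem_nhds (hr.trans_le (not_lt.1 hh))
      filter_upwards [this] with y hy
      rw [mollifier_eq_zero hε (le_of_lt hy)]; simp
    exact continuousAt_const.congr h1.symm

lemma hasCompactSupport_mollifier_mul (hε : 0 < ε) (f : Cn n → ℂ) :
    HasCompactSupport fun h => (mollifier ε h : ℂ) * f h :=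
  (isTest_mollifier hε).compact.mul_right

/-- The mean value property of holomorphic functions. -/
lemma mconv_mollifier_eq (hε : 0 < ε) (hr : ε < r) (hu : DifferentiableOn ℂ u (Metric.ball x r)) :
    mconv (fun y => (mollifier ε y : ℂ)) u x = u x := by
  set q : Cn n → ℂ := fun h => (mollifier ε h : ℂ) * u (x - h) with hq
  have hqc : Continuous q := continuous_mollifier_mul hε hr hu.continuousOn
  have hqs : HasCompactSupport q := hasCompactSupport_mollifier_mul hε _
  obtain ⟨B, hB⟩ := hqc.bounded_above_of_compact_support hqs
  -- Multiplication by `e^{iθ}` preserves Lebesgue measure, so the integral may be averaged over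
  -- `θ`. After exchanging the integrals, the one-variable mean value property for `z ↦ u (x - z •
  -- h)` evaluates the inner one.
  have hrot : ∀ θ : ℝ, ∫ h, q (circleMap 0 1 θ • h) = ∫ h, q h := by
    intro θ
    have hc : ‖circleMap 0 1 θ‖ = 1 := by simp
    let e : Cn n ≃ₗᵢ[ℝ] Cn n :=
      { toLinearEquiv := (LinearEquiv.smulOfNeZero ℂ (Cn n) (circleMap 0 1 θ)
          (by rw [← norm_ne_zero_iff, hc]; exact one_ne_zero)).restrictScalars ℝ
        norm_map' := fun h => by
          change ‖circleMap 0 1 θ • h‖ = ‖h‖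
          rw [norm_smul, hc, one_mul] }
    exact e.measurePreserving.integral_comp e.toHomeomorph.measurableEmbedding q
  have hin : ∀ h : Cn n, ∫ θ in Set.Ioc 0 (2 * Real.pi), q (circleMap 0 1 θ • h)
      = (2 * Real.pi : ℝ) * ((mollifier ε h : ℂ) * u x) := by
    intro h
    have hm : ∀ θ : ℝ, q (circleMap 0 1 θ • h) = (mollifier ε h : ℂ) * u (x - circleMap 0 1 θ • h) := by
      intro θ
      simp only [hq]
      rw [mollifier_smul _ (by simp)]
    simp only [hm]
    rw [integral_const_mul]
    by_cases hh : ‖h‖ < ε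
    · have hd : DiffContOnCl ℂ (fun z : ℂ => u (x - z • h)) (Metric.ball 0 |1|) := by
        apply DifferentiableOn.diffContOnCl
        refine hu.comp (by fun_prop) fun z hz => ?_
        have hz' : ‖z‖ ≤ 1 := by
          have := Metric.closure_ball_subset_closedBall hz
          simpa using this
        simp only [Metric.mem_ball, dist_eq_norm, sub_sub_cancel_left, norm_neg, norm_smul]
        nlinarith [norm_nonneg h]
      have := hd.circleAverage
      rw [Real.circleAverage, intervalIntegral.integral_of_le Real.two_pi_pos.le,
        zero_smul, sub_zero] at this
      have h2 : ∫ θ in Set.Ioc 0 (2 * Real.pi), u (x - circleMap 0 1 θ • h)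
          = (2 * Real.pi : ℝ) * u x := by
        rw [← this, Complex.real_smul, ← mul_assoc, ← Complex.ofReal_mul,
          mul_inv_cancel₀ Real.two_pi_pos.ne', Complex.ofReal_one, one_mul]
      rw [h2]; ring
    · rw [mollifier_eq_zero hε (not_lt.1 hh)]; simp
  have hint : Integrable (Function.uncurry fun (θ : ℝ) (h : Cn n) => q (circleMap 0 1 θ • h))
      ((volume.restrict (Set.Ioc 0 (2 * Real.pi))).prod volume) := by
    have hdom : Integrable (fun p : ℝ × Cn n => (1 : ℝ) * (Metric.closedBall (0 : Cn n) ε).indicator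
        (fun _ => B) p.2) ((volume.restrict (Set.Ioc 0 (2 * Real.pi))).prod volume) :=
      Integrable.mul_prod (integrable_const (1 : ℝ))
        ((integrable_indicator_iff Metric.isClosed_closedBall.measurableSet).2
          (integrableOn_const (isCompact_closedBall _ _).measure_lt_top.ne))
    refine hdom.mono' ?_ (.of_forall fun p => ?_)
    · have : Continuous (Function.uncurry fun (θ : ℝ) (h : Cn n) => q (circleMap 0 1 θ • h)) := by
        exact hqc.comp (((continuous_circleMap 0 1).comp continuous_fst).smul continuous_snd)
      exact this.aestronglyMeasurable
    · simp only [Function.uncurry, one_mul]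
      by_cases hp : p.2 ∈ Metric.closedBall (0 : Cn n) ε
      · rw [Set.indicator_of_mem hp]; exact hB _
      · rw [Set.indicator_of_notMem hp]
        simp only [Metric.mem_closedBall, dist_zero_right, not_le] at hp
        simp [hq, mollifier_eq_zero (x := circleMap 0 1 p.1 • p.2) hε (by simpa [norm_smul] using hp.le)]
  have hsw := integral_integral_swap hint
  simp only [hrot, hin] at hsw
  rw [integral_const_mul, integral_mul_const, integral_complex_ofReal, integral_mollifier hε,
    integral_const] at hsw
  simp only [measureReal_restrict_apply MeasurableSet.univ, Set.univ_inter, Real.volume_real_Ioc_of_le Real.two_pi_pos.le,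
    sub_zero, Complex.ofReal_one, one_mul, Complex.real_smul] at hsw
  have h2 : ((2 * Real.pi : ℝ) : ℂ) ≠ 0 := Complex.ofReal_ne_zero.2 Real.two_pi_pos.ne'
  exact mul_left_cancel₀ h2 hsw

/-- Jensen's inequality for the probability density `mollifier ε`, obtained by integrating `(‖u x‖ -
‖u (x - h)‖)² ≥ 0`. -/
lemma norm_sq_le_integral_mollifier (hε : 0 < ε) (hr : ε < r)
    (hu : DifferentiableOn ℂ u (Metric.ball x r)) :
    ‖u x‖ ^ 2 ≤ ∫ h, mollifier ε h * ‖u (x - h)‖ ^ 2 := by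
  have hI : Integrable fun h => mollifier ε h * ‖u (x - h)‖ := by
    have h1 : Continuous fun h => (mollifier ε h : ℂ) * u (x - h) :=
      continuous_mollifier_mul hε hr hu.continuousOn
    have := (h1.integrable_of_hasCompactSupport (μ := volume)
      (hasCompactSupport_mollifier_mul hε _)).norm
    refine this.congr (.of_forall fun h => ?_)
    simp [abs_of_nonneg (mollifier_nonneg hε h)]
  have hI2 : Integrable fun h => mollifier ε h * ‖u (x - h)‖ ^ 2 := by
    have h1 : Continuous fun h => (mollifier ε h : ℂ) * (fun y => ((‖u y‖ ^ 2 : ℝ) : ℂ)) (x - h) :=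
      continuous_mollifier_mul hε hr
        (Complex.continuous_ofReal.comp_continuousOn (hu.continuousOn.norm.pow 2))
    have := (h1.integrable_of_hasCompactSupport (μ := volume)
      (hasCompactSupport_mollifier_mul hε _)).norm
    refine this.congr (.of_forall fun h => ?_)
    simp [abs_of_nonneg (mollifier_nonneg hε h)]
  have h1 : ‖u x‖ ≤ ∫ h, mollifier ε h * ‖u (x - h)‖ := by
    conv_lhs => rw [← mconv_mollifier_eq hε hr hu, mconv]
    refine (norm_integral_le_integral_norm _).trans (le_of_eq ?_)
    refine integral_congr_ae (.of_forall fun h => ?_)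
    simp [abs_of_nonneg (mollifier_nonneg hε h)]
  have h2 : 2 * ‖u x‖ * ∫ h, mollifier ε h * ‖u (x - h)‖
      ≤ (∫ h, mollifier ε h * ‖u (x - h)‖ ^ 2) + ‖u x‖ ^ 2 := by
    have e : ‖u x‖ ^ 2 = ∫ h : Cn n, mollifier ε h * ‖u x‖ ^ 2 := by
      rw [integral_mul_const, integral_mollifier hε, one_mul]
    rw [e, ← integral_add hI2 ((integrable_mollifier hε).mul_const _), ← integral_const_mul]
    refine integral_mono (hI.const_mul _)
      (hI2.add ((integrable_mollifier hε).mul_const _)) fun h => ?_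
    have := mollifier_nonneg hε h
    simp only
    nlinarith [mul_nonneg this (sq_nonneg (‖u x‖ - ‖u (x - h)‖))]
  nlinarith [mul_le_mul_of_nonneg_left h1 (norm_nonneg (u x))]

/-- Holomorphic functions of several variables are smooth. -/
lemma contDiffAt_of_differentiableOn {s : Set (Cn n)} (hs : IsOpen s) (hx : x ∈ s)
    (hu : DifferentiableOn ℂ u s) : ContDiffAt ℝ ∞ u x := by
  obtain ⟨δ, hδ, hball⟩ := Metric.isOpen_iff.1 hs x hx
  -- Near `x` the function `u` equals its own convolution with the mollifier of radius `δ / 8`. Only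
  -- values of `u` on this closed ball enter, so the cut-off `w`, which is integrable, can replace
  -- `u`.
  set w : Cn n → ℂ := (Metric.closedBall x (δ / 2)).indicator u with hw
  have hsub : Metric.closedBall x (δ / 2) ⊆ s :=
    (Metric.closedBall_subset_ball (by linarith)).trans hball
  have hwi : Integrable w := by
    rw [hw, integrable_indicator_iff Metric.isClosed_closedBall.measurableSet]
    exact (hu.continuousOn.mono hsub).integrableOn_compact (isCompact_closedBall _ _)
  have hsm := contDiff_mconv (isTest_mollifier (n := n) (ε := δ / 8) (by positivity))
    hwi.locallyIntegrable
  refine hsm.contDiffAt.congr_of_eventuallyEq ?_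
  filter_upwards [Metric.ball_mem_nhds x (show 0 < δ / 8 by positivity)] with y hy
  rw [← mconv_mollifier_eq (r := δ / 4) (ε := δ / 8) (x := y) (u := u) (by positivity) (by linarith)
    (hu.mono ((Metric.ball_subset_ball' (by
      have := Metric.mem_ball.1 hy; linarith)).trans hball))]
  refine integral_congr_ae (.of_forall fun t => ?_)
  by_cases ht : ‖t‖ < δ / 8
  · have : y - t ∈ Metric.closedBall x (δ / 2) := by
      rw [Metric.mem_closedBall, dist_eq_norm]
      have h1 := Metric.mem_ball.1 hy
      rw [dist_eq_norm] at h1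
      calc ‖y - t - x‖ = ‖(y - x) - t‖ := by congr 1; abel
        _ ≤ ‖y - x‖ + ‖t‖ := norm_sub_le _ _
        _ ≤ δ / 2 := by linarith
    simp only [hw, Set.indicator_of_mem this]
  · simp only [mollifier_eq_zero (show 0 < δ / 8 by positivity) (not_lt.1 ht)]; simp

end meanvalue

/-! ### Weyl's lemma. -/

lemma mconv_assoc {ρ σ v : Cn n → ℂ} (hρ : IsTest ρ) (hσ : IsTest σ) (hv : LocallyIntegrable v)
    (x : Cn n) : mconv (mconv ρ σ) v x = mconv ρ (mconv σ v) x := by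
  simp only [mconv_eq_convolution]
  have hσn : HasCompactSupport fun y => ‖σ y‖ := hσ.compact.norm
  have hρn : HasCompactSupport fun y => ‖ρ y‖ := hρ.compact.norm
  have hσc : Continuous fun y => ‖σ y‖ := hσ.smooth.continuous.norm
  have hvn : LocallyIntegrable fun y => ‖v y‖ := fun y =>
    let ⟨s, hs, h⟩ := hv y
    ⟨s, hs, h.norm⟩
  refine convolution_assoc _ _ _ _ (fun a b c => by simp [mul_assoc])
    hρ.smooth.continuous.aestronglyMeasurable hσ.smooth.continuous.aestronglyMeasurable
    hv.aestronglyMeasurable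
    (.of_forall fun y => hρ.compact.convolutionExists_left _ hρ.smooth.continuous
      hσ.smooth.continuous.locallyIntegrable y)
    (.of_forall fun y => hσn.convolutionExists_left _ hσc hvn y)
    (hρn.convolutionExists_left _ hρ.smooth.continuous.norm
      (Continuous.locallyIntegrable ?_) x)
  exact hσn.continuous_convolution_left _ hσc hvn

lemma mconv_left_comm {ρ σ v : Cn n → ℂ} (hρ : IsTest ρ) (hσ : IsTest σ)
    (hv : LocallyIntegrable v) (x : Cn n) :
    mconv ρ (mconv σ v) x = mconv σ (mconv ρ v) x := by
  rw [← mconv_assoc hρ hσ hv, ← mconv_assoc hσ hρ hv, funext (mconv_comm ρ σ)]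

lemma IsTest.comp_sub_left {ρ : Cn n → ℂ} (hρ : IsTest ρ) (x : Cn n) :
    IsTest fun y => ρ (x - y) := by
  refine ⟨hρ.smooth.comp (contDiff_const.sub contDiff_id), ?_⟩
  exact hρ.compact.comp_homeomorph (Homeomorph.subLeft x)

lemma wirt_comp_sub_left (c : ℂ) (j : Fin n) (ρ : Cn n → ℂ) (x y : Cn n) :
    wirt c j (fun z => ρ (x - z)) y = -wirt c j ρ (x - y) := by
  have h : fderiv ℝ (fun z => ρ (x - z)) y = -fderiv ℝ ρ (x - y) := by
    have e : (fun z => ρ (x - z)) = fun z => (fun w => ρ (x + w)) ((-1 : ℝ) • z) := by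
      funext z; simp [sub_eq_add_neg]
    rw [e, fderiv_comp_smul (f := fun w => ρ (x + w)), fderiv_comp_add_left]
    simp [sub_eq_add_neg]
  simp only [wirt, h, neg_apply]
  ring

/-- `v` satisfies the Cauchy-Riemann equations on `Ω` in the sense of distributions. -/
def WeakHolo (v : Cn n → ℂ) (Ω : Set (Cn n)) : Prop :=
  ∀ h : Cn n → ℂ, IsTest h → tsupport h ⊆ Ω → ∀ j, ∫ y, v y * dzbar j h y = 0

lemma tsupport_mollifier_sub {ε : ℝ} (hε : 0 < ε) (x : Cn n) :
    tsupport (fun y => (mollifier ε (x - y) : ℂ)) ⊆ Metric.closedBall x ε := by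
  refine closure_minimal (fun y hy => ?_) Metric.isClosed_closedBall
  by_contra h
  rw [Metric.mem_closedBall, dist_comm, dist_eq_norm, not_le] at h
  exact hy (by simp [mollifier_eq_zero hε h.le])

/-- The derivative falls on the mollifier; `mollifier ε (x - ·)` is a test function supported in
`Ω`, so the weak equation makes the result vanish. -/
lemma WeakHolo.differentiableAt {v : Cn n → ℂ} {Ω : Set (Cn n)} (h : WeakHolo v Ω)
    (hv : LocallyIntegrable v) {ε : ℝ} (hε : 0 < ε) {x : Cn n} (hx : Metric.closedBall x ε ⊆ Ω) :
    DifferentiableAt ℂ (mconv (fun y => (mollifier ε y : ℂ)) v) x := by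
  have hm := isTest_mollifier (n := n) hε
  refine differentiableAt_of_dzbar_eq_zero ((contDiff_mconv hm hv).differentiable (by simp) x)
    fun j => ?_
  rw [dzbar_eq_wirt, wirt_mconv hm hv, mconv_eq_swap]
  have := h _ (hm.comp_sub_left x) ((tsupport_mollifier_sub hε x).trans hx) j
  simp only [dzbar_eq_wirt, wirt_comp_sub_left Complex.I j (fun y => (mollifier ε y : ℂ))] at this
  rw [← neg_eq_zero, ← integral_neg, ← this]
  exact integral_congr_ae (.of_forall fun y => by ring)

/-- Each mollification is holomorphic near `x`, hence is reproduced by the other mollifier. The two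
double convolutions agree because convolutions commute. -/
lemma WeakHolo.mconv_eq {v : Cn n → ℂ} (h : WeakHolo v (unitBall n)) (hv : LocallyIntegrable v)
    {ε δ : ℝ} (hε : 0 < ε) (hδ : 0 < δ) {x : Cn n} (hx : ‖x‖ + ε + δ < 1) :
    mconv (fun y => (mollifier ε y : ℂ)) v x = mconv (fun y => (mollifier δ y : ℂ)) v x := by
  have key : ∀ {ε δ : ℝ}, 0 < ε → 0 < δ → ‖x‖ + ε + δ < 1 →
      mconv (fun y => (mollifier δ y : ℂ)) (mconv (fun y => (mollifier ε y : ℂ)) v) x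
        = mconv (fun y => (mollifier ε y : ℂ)) v x := by
    intro ε δ hε hδ hx
    refine mconv_mollifier_eq (r := 1 - ‖x‖ - ε) hδ (by linarith) fun y hy => ?_
    refine (h.differentiableAt hv hε fun z hz => ?_).differentiableWithinAt
    rw [Metric.mem_ball, dist_eq_norm] at hy
    rw [Metric.mem_closedBall, dist_eq_norm] at hz
    simp only [unitBall, Metric.mem_ball, dist_zero_right]
    calc ‖z‖ = ‖(z - y) + (y - x) + x‖ := by congr 1; abel
      _ ≤ ‖z - y‖ + ‖y - x‖ + ‖x‖ := norm_add₃_le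
      _ < 1 := by linarith
  rw [← key hε hδ hx, ← key hδ hε (by linarith),
    mconv_left_comm (isTest_mollifier hδ) (isTest_mollifier hε) hv]

/-- Since `mollifier ε ≤ A / ε^d` with support in a ball of radius `ε`, the error is at most a
constant times the mean of `‖v y - v x‖` over that ball, which tends to zero at Lebesgue points. -/
lemma ae_tendsto_mconv {v : Cn n → ℂ} (hv : LocallyIntegrable v) :
    ∀ᵐ x, Tendsto (fun ε => mconv (fun y => (mollifier ε y : ℂ)) v x) (𝓝[>] 0) (𝓝 (v x)) := by
  obtain ⟨A, hA, hAle⟩ := exists_mollifier_le (n := n)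
  filter_upwards [IsUnifLocDoublingMeasure.ae_tendsto_average_norm_sub volume hv 1] with x hx
  have h1 := hx (l := 𝓝[>] (0 : ℝ)) (fun _ => x) id tendsto_id (by
    filter_upwards [self_mem_nhdsWithin] with ε hε
    exact Metric.mem_closedBall_self (by simpa using (le_of_lt hε)))
  rw [tendsto_iff_norm_sub_tendsto_zero]
  refine squeeze_zero' (.of_forall fun _ => norm_nonneg _) ?_
    (by simpa using h1.const_mul (A * volume.real (Metric.ball (0 : Cn n) 1)))
  filter_upwards [self_mem_nhdsWithin] with ε hε
  replace hε : 0 < ε := hε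
  have hm := isTest_mollifier (n := n) hε
  have hb : 0 < volume.real (Metric.ball (0 : Cn n) 1) :=
    ENNReal.toReal_pos (Metric.measure_ball_pos _ _ one_pos).ne' measure_ball_lt_top.ne
  have e1 : v x = ∫ y, (mollifier ε (x - y) : ℂ) * v x := by
    rw [integral_mul_const, integral_complex_ofReal,
      integral_sub_left_eq_self (fun y : Cn n => mollifier ε y) volume x, integral_mollifier hε]
    simp
  have hI1 := integrable_mconv_swap hm hv x
  have hI2 : Integrable fun y => (mollifier ε (x - y) : ℂ) * v x :=
    ((hm.comp_sub_left x).integrable).mul_const _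
  have hloc : IntegrableOn (fun y => ‖v y - v x‖) (Metric.closedBall x ε) :=
    ((hv.integrableOn_isCompact (isCompact_closedBall x ε)).sub
      (integrableOn_const (isCompact_closedBall _ _).measure_lt_top.ne)).norm
  calc ‖mconv (fun y => (mollifier ε y : ℂ)) v x - v x‖
      = ‖∫ y, (mollifier ε (x - y) : ℂ) * (v y - v x)‖ := by
        conv_lhs => rw [e1, mconv_eq_swap, ← integral_sub hI1 hI2]
        simp only [mul_sub]
    _ ≤ ∫ y, ‖(mollifier ε (x - y) : ℂ) * (v y - v x)‖ := norm_integral_le_integral_norm _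
    _ = ∫ y in Metric.closedBall x ε, ‖(mollifier ε (x - y) : ℂ) * (v y - v x)‖ := by
        refine (setIntegral_eq_integral_of_forall_compl_eq_zero fun y hy => ?_).symm
        rw [Metric.mem_closedBall, dist_comm, dist_eq_norm, not_le] at hy
        simp [mollifier_eq_zero hε hy.le]
    _ ≤ ∫ y in Metric.closedBall x ε, A / ε ^ Module.finrank ℝ (Cn n) * ‖v y - v x‖ := by
        refine integral_mono_of_nonneg (.of_forall fun _ => norm_nonneg _) (hloc.const_mul _)
          (.of_forall fun y => ?_)
        simp only [norm_mul, Complex.norm_real, Real.norm_of_nonneg (mollifier_nonneg hε _)]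
        exact mul_le_mul_of_nonneg_right (hAle ε hε _) (norm_nonneg _)
    _ = _ := by
        rw [integral_const_mul, setAverage_eq, Measure.addHaar_real_closedBall _ _ (le_of_lt hε),
          smul_eq_mul]
        field_simp

/-- Weyl's lemma for the Cauchy-Riemann equations. -/
theorem WeakHolo.exists_differentiableOn {v : Cn n → ℂ} (h : WeakHolo v (unitBall n))
    (hv : LocallyIntegrable v) :
    ∃ F : Cn n → ℂ, DifferentiableOn ℂ F (unitBall n) ∧ ∀ᵐ x, x ∈ unitBall n → F x = v x := by
  -- The radius depends on `x` so that `F` is defined on the whole ball. By `WeakHolo.mconv_eq` the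
  -- value does not depend on it, so near a given point it may be frozen.
  set F : Cn n → ℂ := fun x => mconv (fun y => (mollifier ((1 - ‖x‖) / 4) y : ℂ)) v x with hF
  have hloc : ∀ x : Cn n, ‖x‖ < 1 → ∀ δ, 0 < δ → δ ≤ (1 - ‖x‖) / 2 →
      F x = mconv (fun y => (mollifier δ y : ℂ)) v x := fun x hx δ hδ hδ' =>
    h.mconv_eq hv (by linarith) hδ (by linarith)
  refine ⟨F, fun x hx => ?_, ?_⟩
  · simp only [unitBall, Metric.mem_ball, dist_zero_right] at hx
    set δ := (1 - ‖x‖) / 4 with hδ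
    have hδ0 : 0 < δ := by linarith
    have hd : DifferentiableAt ℂ (mconv (fun y => (mollifier δ y : ℂ)) v) x := by
      refine h.differentiableAt hv hδ0 fun z hz => ?_
      rw [Metric.mem_closedBall, dist_eq_norm] at hz
      simp only [unitBall, Metric.mem_ball, dist_zero_right]
      have := norm_add_le (z - x) x
      rw [sub_add_cancel] at this
      linarith
    refine (hd.congr_of_eventuallyEq ?_).differentiableWithinAt
    filter_upwards [Metric.ball_mem_nhds x hδ0] with y hy
    rw [Metric.mem_ball, dist_eq_norm] at hy
    have := norm_add_le (y - x) x
    rw [sub_add_cancel] at this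
    exact hloc y (by linarith) δ hδ0 (by linarith)
  · filter_upwards [ae_tendsto_mconv hv] with x hx hxU
    simp only [unitBall, Metric.mem_ball, dist_zero_right] at hxU
    refine tendsto_nhds_unique (tendsto_const_nhds.congr' ?_) hx
    filter_upwards [Ioo_mem_nhdsGT (show (0 : ℝ) < (1 - ‖x‖) / 2 by linarith)] with δ hδ
    exact hloc x hxU δ hδ.1 hδ.2.le

/-! ### Translations and averages in `L²`. -/

lemma eLpNorm_two_sq {X : Type*} [MeasurableSpace X] (μ : Measure X) (f : X → ℂ) :
    eLpNorm f 2 μ ^ 2 = ∫⁻ x, ‖f x‖ₑ ^ 2 ∂μ := by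
  rw [eLpNorm_eq_lintegral_rpow_enorm_toReal (by simp) (by simp), ← ENNReal.rpow_natCast,
    ← ENNReal.rpow_mul]
  simp

lemma tendsto_lintegral_translation {w : Cn n → ℂ} (hw : MemLp w 2) :
    Tendsto (fun t => ∫⁻ x, ‖w (x - t) - w x‖ₑ ^ 2) (𝓝 0) (𝓝 0) := by
  set F : Lp ℂ 2 (volume : Measure (Cn n)) := hw.toLp w with hF
  let G : C(Cn n, C(Cn n, Cn n)) :=
    ContinuousMap.curry ⟨fun p : Cn n × Cn n => p.2 - p.1, by fun_prop⟩
  have hG : ∀ t, MeasurePreserving (G t) (volume : Measure (Cn n)) volume := fun t =>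
    measurePreserving_sub_right volume t
  have h1 : Tendsto (fun t => Lp.compMeasurePreserving (G t) (hG t) F) (𝓝 0)
      (𝓝 (Lp.compMeasurePreserving (G 0) (hG 0) F)) :=
    Tendsto.compMeasurePreservingLp tendsto_const_nhds (G.continuous.tendsto 0) hG (hG 0) (by simp)
  have hcoe : ∀ t, Lp.compMeasurePreserving (G t) (hG t) F =ᵐ[volume] fun x => w (x - t) := by
    intro t
    refine (Lp.coeFn_compMeasurePreserving F (hG t)).trans ?_
    exact (hG t).quasiMeasurePreserving.ae_eq_comp hw.coeFn_toLp
  have h2 := (ENNReal.continuous_pow 2).tendsto 0 |>.comp (tendsto_iff_edist_tendsto_0.1 h1)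
  rw [zero_pow two_ne_zero] at h2
  refine h2.congr fun t => ?_
  rw [Function.comp_apply, Lp.edist_def, eLpNorm_two_sq]
  refine lintegral_congr_ae ?_
  filter_upwards [hcoe t, hcoe 0] with x hx hx0
  rw [Pi.sub_apply, hx, hx0, sub_zero]

lemma sq_lintegral_le {X : Type*} [MeasurableSpace X] (μ : Measure X) {f : X → ℝ≥0∞}
    (hf : AEMeasurable f μ) : (∫⁻ x, f x ∂μ) ^ 2 ≤ μ Set.univ * ∫⁻ x, f x ^ 2 ∂μ := by
  have h := ENNReal.lintegral_mul_le_Lp_mul_Lq μ (p := 2) (q := 2)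
    (Real.HolderConjugate.two_two) (aemeasurable_const (b := (1 : ℝ≥0∞))) hf
  simp only [Pi.mul_apply, one_mul, ENNReal.one_rpow, lintegral_const] at h
  have h2 := pow_le_pow_left₀ zero_le h 2
  refine h2.trans (le_of_eq ?_)
  rw [mul_pow, ← ENNReal.rpow_natCast, ← ENNReal.rpow_natCast, ← ENNReal.rpow_mul,
    ← ENNReal.rpow_mul]
  simp

/-- Cauchy-Schwarz in `t`, then Tonelli. For kernels of size `ε^{-d}` supported at scale `ε` the
prefactor stays bounded as `ε → 0`, so the `L²` modulus of continuity `η` of `w` controls the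
result. -/
lemma lintegral_sq_average_le {w : Cn n → ℂ} (hw : Measurable w) {K : Cn n → Cn n → ℂ}
    {S : Set (Cn n)} (hS : MeasurableSet S) {ε B : ℝ} {η : ℝ≥0∞}
    (hK : ∀ x ∈ S, ∀ t, ‖K x t‖ ≤ B) (hK0 : ∀ x ∈ S, ∀ t, ε ≤ ‖t‖ → K x t = 0)
    (hη : ∀ t, ‖t‖ < ε → ∫⁻ x, ‖w (x - t) - w x‖ₑ ^ 2 ≤ η) :
    ∫⁻ x in S, ‖∫ t, K x t * (w (x - t) - w x)‖ₑ ^ 2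
      ≤ (ENNReal.ofReal B * volume (Metric.ball (0 : Cn n) ε)) ^ 2 * η := by
  set b := Metric.ball (0 : Cn n) ε with hb
  have hbm : MeasurableSet b := Metric.isOpen_ball.measurableSet
  have hmeas : Measurable (Function.uncurry fun x t : Cn n => ‖w (x - t) - w x‖ₑ ^ 2) := by
    unfold Function.uncurry; fun_prop
  have hpt : ∀ x ∈ S, ‖∫ t, K x t * (w (x - t) - w x)‖ₑ ^ 2
      ≤ ENNReal.ofReal B ^ 2 * volume b * ∫⁻ t in b, ‖w (x - t) - w x‖ₑ ^ 2 := by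
    intro x hx
    have h1 : ‖∫ t, K x t * (w (x - t) - w x)‖ₑ
        ≤ ENNReal.ofReal B * ∫⁻ t in b, ‖w (x - t) - w x‖ₑ := by
      refine (enorm_integral_le_lintegral_enorm _).trans ?_
      rw [← lintegral_const_mul _ (by fun_prop), ← lintegral_indicator hbm]
      refine lintegral_mono fun t => ?_
      by_cases ht : t ∈ b
      · rw [Set.indicator_of_mem ht, enorm_mul]
        gcongr
        rw [← ofReal_norm]
        exact ENNReal.ofReal_le_ofReal (hK x hx t)
      · rw [hK0 x hx t (by simpa [hb] using ht)]; simp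
    calc _ ≤ (ENNReal.ofReal B * ∫⁻ t in b, ‖w (x - t) - w x‖ₑ) ^ 2 := by gcongr
      _ ≤ _ := by
        rw [mul_pow, mul_assoc]
        gcongr
        have := sq_lintegral_le (volume.restrict b)
          (f := fun t => ‖w (x - t) - w x‖ₑ) (by fun_prop)
        simpa using this
  calc ∫⁻ x in S, ‖∫ t, K x t * (w (x - t) - w x)‖ₑ ^ 2
      ≤ ∫⁻ x in S, ENNReal.ofReal B ^ 2 * volume b * ∫⁻ t in b, ‖w (x - t) - w x‖ₑ ^ 2 :=
        setLIntegral_mono' hS hpt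
    _ ≤ ∫⁻ x, ENNReal.ofReal B ^ 2 * volume b * ∫⁻ t in b, ‖w (x - t) - w x‖ₑ ^ 2 :=
        setLIntegral_le_lintegral _ _
    _ = ENNReal.ofReal B ^ 2 * volume b * ∫⁻ t in b, ∫⁻ x, ‖w (x - t) - w x‖ₑ ^ 2 := by
        have h0 : Measurable fun x => ∫⁻ t in b, ‖w (x - t) - w x‖ₑ ^ 2 :=
          hmeas.lintegral_prod_right'
        rw [lintegral_const_mul _ h0, lintegral_lintegral_swap]
        exact hmeas.aemeasurable
    _ ≤ ENNReal.ofReal B ^ 2 * volume b * ∫⁻ _ in b, η := by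
        refine mul_le_mul_right ?_ _
        exact setLIntegral_mono' hbm fun t ht => hη t (by simpa [hb] using ht)
    _ = _ := by
        rw [setLIntegral_const]; ring

/-! ### The commutator of the weighted Laplacian with convolution. -/

lemma mconv_add_left {ρ σ v : Cn n → ℂ} (hρ : IsTest ρ) (hσ : IsTest σ) (hv : LocallyIntegrable v)
    (x : Cn n) : mconv (fun t => ρ t + σ t) v x = mconv ρ v x + mconv σ v x := by
  simp only [mconv, add_mul]
  exact integral_add (integrable_mconv hρ hv x) (integrable_mconv hσ hv x)

lemma mconv_const_mul_left (a : ℂ) (ρ v : Cn n → ℂ) (x : Cn n) :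
    mconv (fun t => a * ρ t) v x = a * mconv ρ v x := by
  simp only [mconv, mul_assoc, integral_const_mul]

lemma mconv_neg_left (ρ v : Cn n → ℂ) (x : Cn n) :
    mconv (fun t => -ρ t) v x = -mconv ρ v x := by
  simp only [mconv, neg_mul, integral_neg]

lemma mconv_sum_left {ι : Type*} (s : Finset ι) {F : ι → Cn n → ℂ} {v : Cn n → ℂ}
    (hF : ∀ l ∈ s, IsTest (F l)) (hv : LocallyIntegrable v) (x : Cn n) :
    mconv (fun t => ∑ l ∈ s, F l t) v x = ∑ l ∈ s, mconv (F l) v x := by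
  simp only [mconv, Finset.sum_mul]
  exact integral_finsetSum _ fun l hl => integrable_mconv (hF l hl) hv x

/-- The kernel of the commutator of the weighted Laplacian and a convolution. -/
def commKernel (ψ : Cn n → ℝ) (ρ : Cn n → ℂ) (x t : Cn n) : ℂ :=
  ∑ j, ((dz j (fun y => (ψ y : ℂ)) x - dz j (fun y => (ψ y : ℂ)) (x - t)) * dzbar j ρ t
    + dz j (dzbar j (fun y => (ψ y : ℂ))) (x - t) * ρ t)

section commutator

variable {ψ : Cn n → ℝ}

lemma isTest_commKernel (hψ : ContDiff ℝ ∞ ψ) {ρ : Cn n → ℂ} (hρ : IsTest ρ) (x : Cn n) :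
    IsTest (commKernel ψ ρ x) := by
  have hψ' := contDiff_ofReal hψ
  have hs : ContDiff ℝ ∞ fun t : Cn n => x - t := contDiff_const.sub contDiff_id
  exact IsTest.sum _ fun j _ =>
    ((hρ.dzbar j).mul_left (contDiff_const.sub ((contDiff_dz hψ' j).comp hs))).add
      (hρ.mul_left ((contDiff_dz (contDiff_dzbar hψ' j) j).comp hs))

/-- `v` is a weak solution of `∂̄* ∂̄ v = 0`. -/
def WeakHarmonic (ψ : Cn n → ℝ) (v : Cn n → ℂ) : Prop :=
  ∀ g : Cn n → ℂ, IsTest g → ∫ y, v y * conj (boxOp ψ g y) * expWeight ψ y = 0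

lemma expWeight_mul_exp (x : Cn n) : expWeight ψ x * (Real.exp (ψ x) : ℂ) = 1 := by
  rw [expWeight, ← Complex.ofReal_mul, ← Real.exp_add]; simp

/-- Testing against `h e^ψ` cancels the weight, so the weak equation becomes an unweighted one that
can be compared with a convolution. -/
lemma boxOp_mul_exp (hψ : ContDiff ℝ ∞ ψ) {h : Cn n → ℂ} (hh : ContDiff ℝ ∞ h) (x : Cn n) :
    boxOp ψ (fun y => h y * (Real.exp (ψ y) : ℂ)) x * expWeight ψ x
      = -∑ j, (dz j (dzbar j h) x + dz j h x * dzbar j (fun y => (ψ y : ℂ)) x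
        + h x * dz j (dzbar j (fun y => (ψ y : ℂ))) x) := by
  have hψ' := contDiff_ofReal hψ
  have hE : ContDiff ℝ ∞ fun y => (Real.exp (ψ y) : ℂ) := contDiff_ofReal (Real.contDiff_exp.comp hψ)
  have dE : ∀ c j y, wirt c j (fun y => (Real.exp (ψ y) : ℂ)) y
      = (Real.exp (ψ y) : ℂ) * wirt c j (fun y => (ψ y : ℂ)) y := fun c j y =>
    wirt_ofReal_comp (Real.hasDerivAt_exp _) (hψ.differentiable (by simp) y)
  have d1 : ∀ j, dzbar j (fun y => h y * (Real.exp (ψ y) : ℂ))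
      = fun y => (dzbar j h y + h y * dzbar j (fun y => (ψ y : ℂ)) y) * (Real.exp (ψ y) : ℂ) := by
    intro j
    funext y
    rw [dzbar_eq_wirt, wirt_mul (hh.differentiable (by simp) y) (hE.differentiable (by simp) y), dE]
    simp only [dzbar_eq_wirt]; ring
  rw [boxOp, Finset.sum_mul, ← Finset.sum_neg_distrib]
  refine Finset.sum_congr rfl fun j _ => ?_
  have h1 : ContDiff ℝ ∞ fun y => h y * dzbar j (fun y => (ψ y : ℂ)) y :=
    hh.mul (contDiff_dzbar hψ' j)
  have h2 : ContDiff ℝ ∞ fun y => dzbar j h y + h y * dzbar j (fun y => (ψ y : ℂ)) y :=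
    (contDiff_dzbar hh j).add h1
  rw [adjZ, d1 j]
  simp only [dz_eq_wirt]
  rw [wirt_mul (h2.differentiable (by simp) x) (hE.differentiable (by simp) x), dE,
    wirt_add ((contDiff_dzbar hh j).differentiable (by simp) x) (h1.differentiable (by simp) x),
    wirt_mul (hh.differentiable (by simp) x)
      ((contDiff_dzbar hψ' j).differentiable (by simp) x)]
  linear_combination (-(wirt (-Complex.I) j (dzbar j h) x
    + (wirt (-Complex.I) j h x * dzbar j (fun y => (ψ y : ℂ)) x
      + h x * wirt (-Complex.I) j (dzbar j (fun y => (ψ y : ℂ))) x))) * expWeight_mul_exp (ψ := ψ) x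

lemma conj_dz_dzbar_ofReal (hψ : ContDiff ℝ ∞ ψ) (j : Fin n) (x : Cn n) :
    conj (dz j (dzbar j (fun y => (ψ y : ℂ))) x) = dz j (dzbar j (fun y => (ψ y : ℂ))) x := by
  have h1 : dz j (dzbar j (fun y => (ψ y : ℂ))) x = dzbar j (dz j (fun y => (ψ y : ℂ))) x := by
    simp only [dz_eq_wirt, dzbar_eq_wirt]; exact wirt_comm (contDiff_ofReal hψ).contDiffAt
  conv_rhs => rw [h1, show dz j (fun y => (ψ y : ℂ)) = fun y => conj (dzbar j (fun y => (ψ y : ℂ)) y) by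
    funext y; rw [dzbar_ofReal, Complex.conj_conj], dzbar_eq_wirt, wirt_conj, Complex.conj_I,
    ← dz_eq_wirt]

/-- On the left all derivatives fall on the convolution kernel, with coefficients frozen at `x`. The
weak equation tested against `ρ(x - ·) e^ψ` has the same second-order part with coefficients at `x -
t`. In the difference the second-order terms cancel, and `commKernel` is left. -/
lemma WeakHarmonic.boxOp_mconv (hψ : ContDiff ℝ ∞ ψ) {v : Cn n → ℂ} (h : WeakHarmonic ψ v)
    (hv : LocallyIntegrable v) {q : Cn n → ℝ} (hq : IsTest fun y => (q y : ℂ)) (x : Cn n) :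
    boxOp ψ (mconv (fun y => (q y : ℂ)) v) x
      = mconv (commKernel ψ (fun y => (q y : ℂ)) x) v x := by
  set ρ : Cn n → ℂ := fun y => (q y : ℂ) with hρ
  have hψ' := contDiff_ofReal hψ
  have hE : ContDiff ℝ ∞ fun y => (Real.exp (ψ y) : ℂ) := contDiff_ofReal (Real.contDiff_exp.comp hψ)
  have hs : ContDiff ℝ ∞ fun t : Cn n => x - t := contDiff_const.sub contDiff_id
  -- the convolution kernel of the left-hand side
  have hP : ∀ j, IsTest fun t => -dz j (dzbar j ρ) t + dz j (fun y => (ψ y : ℂ)) x * dzbar j ρ t :=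
    fun j => ((hq.dzbar j).dz j).neg.add ((hq.dzbar j).mul_left contDiff_const)
  have lhs : boxOp ψ (mconv ρ v) x = mconv (fun t => ∑ j, (-dz j (dzbar j ρ) t
      + dz j (fun y => (ψ y : ℂ)) x * dzbar j ρ t)) v x := by
    rw [mconv_sum_left _ (fun j _ => hP j) hv, boxOp]
    refine Finset.sum_congr rfl fun j _ => ?_
    have e1 : dzbar j (mconv ρ v) = mconv (dzbar j ρ) v :=
      funext fun y => wirt_mconv hq hv _ j y
    have e2 : dz j (mconv (dzbar j ρ) v) x = mconv (dz j (dzbar j ρ)) v x := by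
      simp only [dz_eq_wirt]; exact wirt_mconv (hq.dzbar j) hv _ j x
    rw [mconv_add_left ((hq.dzbar j).dz j).neg ((hq.dzbar j).mul_left contDiff_const) hv,
      mconv_neg_left, mconv_const_mul_left, adjZ, e1, e2]
  -- the weak equation, tested against the convolution kernel
  have hQ : ∀ j, IsTest fun t => -dz j (dzbar j ρ) t + dz j (fun y => (ψ y : ℂ)) (x - t) * dzbar j ρ t
      - dz j (dzbar j (fun y => (ψ y : ℂ))) (x - t) * ρ t := fun j => by
    simp only [sub_eq_add_neg (_ + _)]
    exact (((hq.dzbar j).dz j).neg.add ((hq.dzbar j).mul_left ((contDiff_dz hψ' j).comp hs))).add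
      (hq.mul_left ((contDiff_dz (contDiff_dzbar hψ' j) j).comp hs)).neg
  have weak : mconv (fun t => ∑ j, (-dz j (dzbar j ρ) t
      + dz j (fun y => (ψ y : ℂ)) (x - t) * dzbar j ρ t
      - dz j (dzbar j (fun y => (ψ y : ℂ))) (x - t) * ρ t)) v x = 0 := by
    have hg : IsTest fun y => ρ (x - y) := hq.comp_sub_left x
    rw [mconv_eq_swap, ← h _ (hg.mul_right hE)]
    refine integral_congr_ae (.of_forall fun y => ?_)
    have e0 : conj (boxOp ψ (fun y => ρ (x - y) * (Real.exp (ψ y) : ℂ)) y) * expWeight ψ y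
        = conj (boxOp ψ (fun y => ρ (x - y) * (Real.exp (ψ y) : ℂ)) y * expWeight ψ y) := by
      rw [map_mul, conj_expWeight]
    have dρ : ∀ c j y, wirt c j (fun y => ρ (x - y)) y = -wirt c j ρ (x - y) := fun c j y =>
      wirt_comp_sub_left c j ρ x y
    have ddρ : ∀ j, dz j (dzbar j (fun y => ρ (x - y))) y = dz j (dzbar j ρ) (x - y) := by
      intro j
      have : dzbar j (fun y => ρ (x - y)) = fun y => -dzbar j ρ (x - y) :=
        funext fun y => dρ _ j y
      rw [this, dz_eq_wirt, wirt_neg, wirt_comp_sub_left (-Complex.I) j (dzbar j ρ) x y, neg_neg,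
        ← dz_eq_wirt]
    have cdd : ∀ j y, conj (dz j (dzbar j ρ) y) = dz j (dzbar j ρ) y := by
      intro j y
      have h1 : dz j (dzbar j ρ) y = dzbar j (dz j ρ) y := by
        simp only [dz_eq_wirt, dzbar_eq_wirt]; exact wirt_comm hq.smooth.contDiffAt
      conv_rhs => rw [h1, show dz j ρ = fun y => conj (dzbar j ρ y) by
        funext y; rw [hρ, dzbar_ofReal, Complex.conj_conj], dzbar_eq_wirt, wirt_conj,
        Complex.conj_I, ← dz_eq_wirt]
    have cd : ∀ j y, conj (dz j ρ y) = dzbar j ρ y := fun j y => by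
      rw [hρ, dzbar_ofReal]
    simp only
    rw [mul_assoc, e0, boxOp_mul_exp hψ hg.smooth, map_neg, map_sum, mul_comm]
    congr 1
    rw [← Finset.sum_neg_distrib]
    refine Finset.sum_congr rfl fun j _ => ?_
    rw [ddρ]
    simp only [map_add, map_mul, cdd, conj_dz_dzbar_ofReal hψ, sub_sub_cancel]
    rw [show dz j (fun y => ρ (x - y)) y = -dz j ρ (x - y) by
      simp only [dz_eq_wirt]; exact dρ _ j y, map_neg, cd, dzbar_ofReal j ψ, Complex.conj_conj]
    rw [show conj (ρ (x - y)) = ρ (x - y) from Complex.conj_ofReal _]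
    ring
  have hT : IsTest fun t => ∑ j, (-dz j (dzbar j ρ) t
      + dz j (fun y => (ψ y : ℂ)) (x - t) * dzbar j ρ t
      - dz j (dzbar j (fun y => (ψ y : ℂ))) (x - t) * ρ t) := IsTest.sum _ fun j _ => hQ j
  have e3 : (fun t => ∑ j, (-dz j (dzbar j ρ) t + dz j (fun y => (ψ y : ℂ)) x * dzbar j ρ t))
      = fun t => commKernel ψ ρ x t + ∑ j, (-dz j (dzbar j ρ) t
      + dz j (fun y => (ψ y : ℂ)) (x - t) * dzbar j ρ t
      - dz j (dzbar j (fun y => (ψ y : ℂ))) (x - t) * ρ t) := by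
    funext t
    rw [commKernel, ← Finset.sum_add_distrib]
    exact Finset.sum_congr rfl fun j _ => by ring
  rw [lhs, e3, mconv_add_left (isTest_commKernel hψ hq x) hT hv, weak, add_zero]

lemma weakHarmonic_one (hψ : ContDiff ℝ ∞ ψ) : WeakHarmonic ψ fun _ => 1 := by
  intro g hg
  rw [integral_boxOp_mul_conj hψ contDiff_const hg]
  simp [dzbar_eq_wirt, wirt_const]

/-- The commutator identity is applied to `v = 1`, whose convolution is constant. This vanishing
mean lets `v (x - t)` be replaced by `v (x - t) - v x` in the error term. -/
lemma integral_commKernel (hψ : ContDiff ℝ ∞ ψ) {q : Cn n → ℝ} (hq : IsTest fun y => (q y : ℂ))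
    (x : Cn n) : ∫ t, commKernel ψ (fun y => (q y : ℂ)) x t = 0 := by
  have h := (weakHarmonic_one hψ).boxOp_mconv hψ continuous_const.locallyIntegrable hq x
  have e : mconv (fun y => (q y : ℂ)) (fun _ => 1) = fun _ => ∫ t, (q t : ℂ) := by
    funext y; simp [mconv]
  rw [e] at h
  simp only [mconv, mul_one] at h
  rw [← h]
  have hz : ∀ j : Fin n, dzbar j (fun _ : Cn n => ∫ t, (q t : ℂ)) = fun _ => 0 := fun j =>
    funext fun y => wirt_const _
  simp [boxOp, adjZ, hz, dz_eq_wirt, wirt_const]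

end commutator

/-! ### Friedrichs mollification of weak solutions and Caccioppoli's inequality. -/

section

variable {ψ : Cn n → ℝ} {v : Cn n → ℂ}

lemma integrableOn_norm_sq (hψ : Continuous ψ) (hv : Measurable v)
    (hv2 : Integrable fun y => ‖v y‖ ^ 2 * Real.exp (-ψ y)) (R : ℝ) :
    IntegrableOn (fun y => ‖v y‖ ^ 2) (Metric.closedBall 0 R) := by
  obtain ⟨B, hB⟩ := (isCompact_closedBall (0 : Cn n) R).exists_bound_of_continuousOn
    (Real.continuous_exp.comp hψ).continuousOn
  refine Integrable.mono' (hv2.integrableOn.const_mul B)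
    (by fun_prop) ?_
  filter_upwards [ae_restrict_mem Metric.isClosed_closedBall.measurableSet] with y hy
  have h1 : Real.exp (ψ y) ≤ B := (le_abs_self _).trans (hB y hy)
  have h2 : Real.exp (ψ y) * Real.exp (-ψ y) = 1 := by rw [← Real.exp_add]; simp
  rw [Real.norm_of_nonneg (sq_nonneg _)]
  calc ‖v y‖ ^ 2 = Real.exp (ψ y) * (‖v y‖ ^ 2 * Real.exp (-ψ y)) := by
        rw [mul_left_comm, h2, mul_one]
    _ ≤ _ := mul_le_mul_of_nonneg_right h1 (by positivity)

lemma memLp_indicator (hψ : Continuous ψ) (hv : Measurable v)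
    (hv2 : Integrable fun y => ‖v y‖ ^ 2 * Real.exp (-ψ y)) (R : ℝ) :
    MemLp ((Metric.closedBall 0 R).indicator v) 2 := by
  rw [memLp_indicator_iff_restrict Metric.isClosed_closedBall.measurableSet,
    memLp_two_iff_integrable_sq_norm hv.aestronglyMeasurable]
  exact integrableOn_norm_sq hψ hv hv2 R

lemma locallyIntegrable_of_weighted (hψ : Continuous ψ) (hv : Measurable v)
    (hv2 : Integrable fun y => ‖v y‖ ^ 2 * Real.exp (-ψ y)) : LocallyIntegrable v := by
  intro x
  refine ⟨Metric.closedBall 0 (‖x‖ + 1), Filter.mem_of_superset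
    (Metric.isOpen_ball.mem_nhds (x := x) (by simp)) Metric.ball_subset_closedBall, ?_⟩
  have h := memLp_indicator hψ hv hv2 (‖x‖ + 1)
  rw [memLp_indicator_iff_restrict Metric.isClosed_closedBall.measurableSet] at h
  have : IsFiniteMeasure (volume.restrict (Metric.closedBall (0 : Cn n) (‖x‖ + 1))) :=
    ⟨by simpa using (isCompact_closedBall _ _).measure_lt_top⟩
  exact h.integrable (by norm_num)

lemma commKernel_mollifier_eq_zero {ε : ℝ} (hε : 0 < ε) (x : Cn n) {t : Cn n} (ht : ε < ‖t‖) :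
    commKernel ψ (fun y => (mollifier ε y : ℂ)) x t = 0 := by
  have ht' : t ∉ tsupport fun y : Cn n => (mollifier ε y : ℂ) := by
    intro h
    have := tsupport_mollifier_sub hε (0 : Cn n)
    simp only [zero_sub, mollifier_neg] at this
    have := this h
    rw [mem_closedBall_zero_iff] at this
    linarith
  refine Finset.sum_eq_zero fun j _ => ?_
  rw [dzbar_eq_wirt, wirt_eq_zero_of_notMem_tsupport ht']
  simp [mollifier_eq_zero hε ht.le]

/-- Friedrichs' observation: `∂̄` of the mollifier has size `ε^{-d-1}`, but it is multiplied by a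
difference of a smooth function at distance at most `ε`. The commutator kernel is therefore no
larger than the mollifier itself. The condition `ε < 1` keeps `x - t` in the ball of radius `R + 1`.
-/
lemma exists_commKernel_le (hψ : ContDiff ℝ ∞ ψ) (R : ℝ) :
    ∃ A : ℝ, 0 < A ∧ ∀ ε : ℝ, 0 < ε → ε < 1 → ∀ x : Cn n, ‖x‖ ≤ R → ∀ t : Cn n,
      ‖commKernel ψ (fun y => (mollifier ε y : ℂ)) x t‖ ≤ A / ε ^ Module.finrank ℝ (Cn n) := by
  obtain ⟨A₁, hA₁, h₁⟩ := exists_mollifier_le (n := n)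
  obtain ⟨A₂, hA₂, h₂⟩ := exists_wirt_mollifier_le (n := n) Complex.I
  have hψ' := contDiff_ofReal hψ
  have hL : ∀ j : Fin n, ∃ L, ∀ y ∈ Metric.closedBall (0 : Cn n) (R + 1),
      ‖fderiv ℝ (dz j (fun y => (ψ y : ℂ))) y‖ ≤ L := fun j =>
    (isCompact_closedBall (0 : Cn n) (R + 1)).exists_bound_of_continuousOn
      ((contDiff_dz hψ' j).continuous_fderiv (by simp)).continuousOn
  have hB : ∀ j : Fin n, ∃ B, ∀ y ∈ Metric.closedBall (0 : Cn n) (R + 1),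
      ‖dz j (dzbar j (fun y => (ψ y : ℂ))) y‖ ≤ B := fun j =>
    (isCompact_closedBall (0 : Cn n) (R + 1)).exists_bound_of_continuousOn
      (contDiff_dz (contDiff_dzbar hψ' j) j).continuous.continuousOn
  choose L hL using hL
  choose B hB using hB
  refine ⟨∑ j, (|L j| * A₂ + |B j| * A₁) + 1, by positivity, fun ε hε hε1 x hx t => ?_⟩
  have hp : 0 < ε ^ Module.finrank ℝ (Cn n) := pow_pos hε _
  by_cases ht : ‖t‖ ≤ ε
  · have hxm : x ∈ Metric.closedBall (0 : Cn n) (R + 1) := by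
      rw [mem_closedBall_zero_iff]; linarith
    have hxt : x - t ∈ Metric.closedBall (0 : Cn n) (R + 1) := by
      rw [mem_closedBall_zero_iff]
      exact (norm_sub_le _ _).trans (by linarith)
    have hterm : ∀ j : Fin n, ‖(dz j (fun y => (ψ y : ℂ)) x - dz j (fun y => (ψ y : ℂ)) (x - t))
        * dzbar j (fun y => (mollifier ε y : ℂ)) t
        + dz j (dzbar j (fun y => (ψ y : ℂ))) (x - t) * (mollifier ε t : ℂ)‖
        ≤ (|L j| * A₂ + |B j| * A₁) / ε ^ Module.finrank ℝ (Cn n) := by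
      intro j
      have e1 : ‖dz j (fun y => (ψ y : ℂ)) x - dz j (fun y => (ψ y : ℂ)) (x - t)‖ ≤ |L j| * ε := by
        have := (convex_closedBall (0 : Cn n) (R + 1)).norm_image_sub_le_of_norm_fderiv_le
          (f := dz j (fun y => (ψ y : ℂ))) (𝕜 := ℝ) (C := |L j|)
          (fun y _ => (contDiff_dz hψ' j).differentiable (by simp) y)
          (fun y hy => (hL j y hy).trans (le_abs_self _)) hxt hxm
        rw [sub_sub_cancel] at this
        exact this.trans (by gcongr)
      have e2 : ‖dz j (dzbar j (fun y => (ψ y : ℂ))) (x - t)‖ ≤ |B j| :=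
        (hB j _ hxt).trans (le_abs_self _)
      have e3 : ‖(mollifier ε t : ℂ)‖ ≤ A₁ / ε ^ Module.finrank ℝ (Cn n) := by
        rw [Complex.norm_real, Real.norm_of_nonneg (mollifier_nonneg hε t)]; exact h₁ ε hε t
      refine (norm_add_le _ _).trans ?_
      rw [norm_mul, norm_mul]
      calc _ ≤ |L j| * ε * (A₂ / ε ^ (Module.finrank ℝ (Cn n) + 1))
            + |B j| * (A₁ / ε ^ Module.finrank ℝ (Cn n)) := by
            gcongr
            exact h₂ ε hε j t
        _ = _ := by rw [pow_succ]; field_simp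
    refine (norm_sum_le _ _).trans ((Finset.sum_le_sum fun j _ => hterm j).trans ?_)
    rw [← Finset.sum_div]
    gcongr
    linarith
  · rw [commKernel_mollifier_eq_zero hε x (not_le.1 ht), norm_zero]
    positivity

/-- Mollifications of a weak solution converge in `L²_loc`, and are almost solutions. -/
lemma WeakHarmonic.exists_mconv_close (hψ : ContDiff ℝ ∞ ψ) (h : WeakHarmonic ψ v)
    (hv : Measurable v) (hv2 : Integrable fun y => ‖v y‖ ^ 2 * Real.exp (-ψ y)) (R : ℝ)
    {δ : ℝ} (hδ : 0 < δ) :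
    ∃ ε : ℝ, 0 < ε ∧
      ∫⁻ x in Metric.closedBall 0 R, ‖mconv (fun y => (mollifier ε y : ℂ)) v x - v x‖ₑ ^ 2
        ≤ ENNReal.ofReal δ ∧
      ∫⁻ x in Metric.closedBall 0 R, ‖boxOp ψ (mconv (fun y => (mollifier ε y : ℂ)) v) x‖ₑ ^ 2
        ≤ ENNReal.ofReal δ := by
  obtain ⟨A₁, hA₁, h₁⟩ := exists_mollifier_le (n := n)
  obtain ⟨A₂, hA₂, h₂⟩ := exists_commKernel_le hψ R
  have hvl := locallyIntegrable_of_weighted hψ.continuous hv hv2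
  set d := Module.finrank ℝ (Cn n) with hd
  set b₁ := volume.real (Metric.ball (0 : Cn n) 1) with hb
  have hb0 : 0 ≤ b₁ := measureReal_nonneg
  -- The kernel bound `(A₁ + A₂) / ε^d` times the volume of the ball of radius `2ε`. The radius is
  -- doubled because `commKernel` is known to vanish only for `ε < ‖t‖`, while
  -- `lintegral_sq_average_le` needs vanishing on its boundary sphere too.
  set c := (A₁ + A₂) * (2 ^ d * b₁) with hc
  have hc0 : 0 ≤ c := by positivity
  set S := Metric.closedBall (0 : Cn n) R with hS
  have hSm : MeasurableSet S := Metric.isClosed_closedBall.measurableSet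
  set w : Cn n → ℂ := (Metric.closedBall 0 (R + 1)).indicator v with hw
  have hwm : Measurable w := hv.indicator Metric.isClosed_closedBall.measurableSet
  have htr := tendsto_lintegral_translation (memLp_indicator hψ.continuous hv hv2 (R + 1))
  have hη0 : (0 : ℝ≥0∞) < ENNReal.ofReal (δ / (c ^ 2 + 1)) := ENNReal.ofReal_pos.2 (by positivity)
  have hev := htr.eventually (gt_mem_nhds hη0)
  obtain ⟨r, hr, hball⟩ := Metric.eventually_nhds_iff.1 hev
  set ε := min (r / 2) (1 / 4) with hε
  have hε0 : 0 < ε := lt_min (by linarith) (by norm_num)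
  have hε1 : ε ≤ 1 / 4 := min_le_right _ _
  have hεr : 2 * ε ≤ r := by have := min_le_left (r / 2) (1 / 4); linarith
  have hτ : ∀ t, ‖t‖ < 2 * ε → ∫⁻ x, ‖w (x - t) - w x‖ₑ ^ 2 ≤ ENNReal.ofReal (δ / (c ^ 2 + 1)) :=
    fun t ht => (hball (by rw [dist_zero_right]; linarith)).le
  have hm := isTest_mollifier (n := n) hε0
  have hfin : (ENNReal.ofReal ((A₁ + A₂) / ε ^ d) * volume (Metric.ball (0 : Cn n) (2 * ε))) ^ 2
      * ENNReal.ofReal (δ / (c ^ 2 + 1)) ≤ ENNReal.ofReal δ := by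
    have hvol : volume (Metric.ball (0 : Cn n) (2 * ε)) = ENNReal.ofReal ((2 * ε) ^ d * b₁) := by
      rw [Measure.addHaar_ball_of_pos _ _ (by positivity), ENNReal.ofReal_mul (by positivity), hb,
        ofReal_measureReal measure_ball_lt_top.ne]
    rw [hvol, ← ENNReal.ofReal_mul (by positivity), ← ENNReal.ofReal_pow (by positivity),
      ← ENNReal.ofReal_mul (by positivity)]
    apply ENNReal.ofReal_le_ofReal
    have : (A₁ + A₂) / ε ^ d * ((2 * ε) ^ d * b₁) = c := by
      rw [hc, mul_pow]; field_simp
    rw [this, mul_div_assoc', div_le_iff₀ (by positivity)]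
    nlinarith
  have hwv : ∀ x ∈ S, ∀ t, ‖t‖ < 2 * ε → w (x - t) - w x = v (x - t) - v x := by
    intro x hx t ht
    rw [hS, mem_closedBall_zero_iff] at hx
    have h1 : x ∈ Metric.closedBall (0 : Cn n) (R + 1) := by
      rw [mem_closedBall_zero_iff]; linarith
    have h2 : x - t ∈ Metric.closedBall (0 : Cn n) (R + 1) := by
      rw [mem_closedBall_zero_iff]; exact (norm_sub_le _ _).trans (by linarith)
    rw [hw, Set.indicator_of_mem h1, Set.indicator_of_mem h2]
  -- Used for the mollifier, whose integral is `1`, and for the commutator kernel, whose integral is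
  -- `0`; the two cases give the two estimates.
  have main : ∀ K : Cn n → Cn n → ℂ, (∀ x, IsTest (K x)) →
      (∀ x ∈ S, ∀ t, ‖K x t‖ ≤ (A₁ + A₂) / ε ^ d) → (∀ x ∈ S, ∀ t, 2 * ε ≤ ‖t‖ → K x t = 0) →
      ∫⁻ x in S, ‖mconv (K x) v x - (∫ t, K x t) * v x‖ₑ ^ 2 ≤ ENNReal.ofReal δ := by
    intro K hKt hK hK0
    refine le_trans (le_of_eq ?_) ((lintegral_sq_average_le hwm hSm hK hK0 hτ).trans hfin)
    refine setLIntegral_congr_fun hSm fun x hx => ?_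
    have : ∫ t, K x t * (w (x - t) - w x) = mconv (K x) v x - (∫ t, K x t) * v x := by
      rw [mconv, ← integral_mul_const, ← integral_sub (integrable_mconv (hKt x) hvl x)
        ((hKt x).integrable.mul_const _)]
      refine integral_congr_ae (.of_forall fun t => ?_)
      simp only
      by_cases ht : ‖t‖ < 2 * ε
      · rw [hwv x hx t ht]; ring
      · rw [hK0 x hx t (not_lt.1 ht)]; ring
    simp only [this]
  refine ⟨ε, hε0, ?_, ?_⟩
  · have := main (fun _ t => (mollifier ε t : ℂ)) (fun _ => hm) (fun x _ t => by
      rw [Complex.norm_real, Real.norm_of_nonneg (mollifier_nonneg hε0 t)]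
      refine (h₁ ε hε0 t).trans ?_
      gcongr; linarith) (fun x _ t ht => by rw [mollifier_eq_zero hε0 (by linarith)]; simp)
    simpa only [integral_complex_ofReal, integral_mollifier hε0, Complex.ofReal_one, one_mul] using this
  · have := main (commKernel ψ (fun y => (mollifier ε y : ℂ))) (isTest_commKernel hψ hm)
      (fun x hx t => by
        refine (h₂ ε hε0 (by linarith) x (by simpa [hS] using hx) t).trans ?_
        gcongr; linarith) (fun x _ t ht => commKernel_mollifier_eq_zero hε0 x (by linarith))
    simpa only [integral_commKernel hψ hm, zero_mul, sub_zero, ← h.boxOp_mconv hψ hvl hm] using this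

/-- Caccioppoli's inequality for the weighted Laplacian. -/
lemma caccioppoli (hψ : ContDiff ℝ ∞ ψ) {V : Cn n → ℂ} (hV : ContDiff ℝ ∞ V) {η : Cn n → ℝ}
    (hη : IsTest fun y => (η y : ℂ)) :
    ∫ y, (∑ j, η y ^ 2 * ‖dzbar j V y‖ ^ 2) * Real.exp (-ψ y)
      ≤ 2 * (∫ y, ‖boxOp ψ V y‖ * (η y ^ 2 * ‖V y‖) * Real.exp (-ψ y))
        + 4 * ∫ y, (∑ j, ‖dzbar j (fun y => (η y : ℂ)) y‖ ^ 2) * ‖V y‖ ^ 2 * Real.exp (-ψ y) := by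
  set ηc : Cn n → ℂ := fun y => (η y : ℂ) with hηc
  have hηr : Continuous η := by
    have := Complex.continuous_re.comp hη.smooth.continuous
    simpa [hηc, Function.comp_def] using this
  have hηs : HasCompactSupport η := by
    have := hη.compact.comp_left (g := Complex.re) Complex.zero_re
    simpa [hηc, Function.comp_def] using this
  have hm := contDiff_expWeight hψ
  have hmr : Continuous fun y => Real.exp (-ψ y) := Real.continuous_exp.comp hψ.continuous.neg
  have hdV : ∀ j, Continuous (dzbar j V) := fun j => (contDiff_dzbar hV j).continuous
  have hdη : ∀ j, Continuous (dzbar j ηc) := fun j => (hη.dzbar j).smooth.continuous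
  have hbox : ContDiff ℝ ∞ (boxOp ψ V) :=
    ContDiff.sum fun j _ => contDiff_adjZ hψ (contDiff_dzbar hV j) j
  -- The equation is tested against `W = η² V`.
  set W : Cn n → ℂ := fun y => ηc y * ηc y * V y with hW
  have hWt : IsTest W := (hη.mul_right hη.smooth).mul_right hV
  have hid : ∫ y, boxOp ψ V y * conj (W y) * expWeight ψ y
      = ∫ y, ∑ j, dzbar j V y * conj (dzbar j W y) * expWeight ψ y := by
    have h1 : ∀ j, ∫ y, adjZ ψ j (dzbar j V) y * conj (W y) * expWeight ψ y
        = ∫ y, dzbar j V y * conj (dzbar j W y) * expWeight ψ y := fun j =>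
      integral_adjZ_mul_conj hψ hWt.smooth (contDiff_dzbar hV j) (Or.inl hWt.compact) j
    rw [integral_finsetSum _ fun j _ =>
      (((hWt.dzbar j).conj.mul_left (contDiff_dzbar hV j)).mul_right hm).integrable]
    simp only [← h1]
    rw [← integral_finsetSum _ fun j _ => ((hWt.conj.mul_left
      (contDiff_adjZ hψ (contDiff_dzbar hV j) j)).mul_right hm).integrable]
    simp only [boxOp, Finset.sum_mul]
  have hdW : ∀ j y, dzbar j W y = 2 * ηc y * dzbar j ηc y * V y + ηc y * ηc y * dzbar j V y := by
    intro j y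
    have h1 := hη.smooth.differentiable (by simp) y
    simp only [dzbar_eq_wirt, hW]
    rw [wirt_mul (h1.fun_mul h1) (hV.differentiable (by simp) y), wirt_mul h1 h1]
    ring
  -- The cross term, with `a = |η| |∂̄V|` and `b = |∂̄η| |V|`, is split by `2ab ≤ a²/2 + 2b²`. Half
  -- of `η² |∂̄V|²` survives, and doubling at the end produces the factors `2` and `4`.
  have hpt : ∀ y, (1 / 2) * ((∑ j, η y ^ 2 * ‖dzbar j V y‖ ^ 2) * Real.exp (-ψ y))
      - 2 * ((∑ j, ‖dzbar j ηc y‖ ^ 2) * ‖V y‖ ^ 2 * Real.exp (-ψ y))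
      ≤ (∑ j, dzbar j V y * conj (dzbar j W y) * expWeight ψ y).re := by
    intro y
    have hj : ∀ j, (1 / 2) * (η y ^ 2 * ‖dzbar j V y‖ ^ 2) - 2 * (‖dzbar j ηc y‖ ^ 2 * ‖V y‖ ^ 2)
        ≤ (dzbar j V y * conj (dzbar j W y)).re := by
      intro j
      have e : dzbar j V y * conj (dzbar j W y)
          = ((η y ^ 2 * ‖dzbar j V y‖ ^ 2 : ℝ) : ℂ)
            + dzbar j V y * conj (2 * ηc y * dzbar j ηc y * V y) := by
        have hc : conj (ηc y) = ηc y := Complex.conj_ofReal _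
        have hn : ((‖dzbar j V y‖ ^ 2 : ℝ) : ℂ) = dzbar j V y * conj (dzbar j V y) := by
          rw [Complex.mul_conj, Complex.normSq_eq_norm_sq]
        rw [hdW, Complex.ofReal_mul, hn]
        simp only [map_add, map_mul, hc]
        push_cast
        ring
      rw [e, Complex.add_re, Complex.ofReal_re]
      have h1 := (Complex.abs_re_le_norm (dzbar j V y * conj (2 * ηc y * dzbar j ηc y * V y)))
      have h2 : ‖dzbar j V y * conj (2 * ηc y * dzbar j ηc y * V y)‖
          = 2 * (|η y| * ‖dzbar j V y‖) * (‖dzbar j ηc y‖ * ‖V y‖) := by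
        simp only [norm_mul, RCLike.norm_conj, hηc, Complex.norm_real, Real.norm_eq_abs,
          RCLike.norm_ofNat]
        ring
      rw [h2] at h1
      have h3 := (abs_le.1 h1).1
      have h4 : η y ^ 2 * ‖dzbar j V y‖ ^ 2 = (|η y| * ‖dzbar j V y‖) ^ 2 := by
        rw [mul_pow, sq_abs]
      have h5 : ‖dzbar j ηc y‖ ^ 2 * ‖V y‖ ^ 2 = (‖dzbar j ηc y‖ * ‖V y‖) ^ 2 := by rw [mul_pow]
      rw [h4, h5]
      nlinarith [sq_nonneg (|η y| * ‖dzbar j V y‖ - 2 * (‖dzbar j ηc y‖ * ‖V y‖))]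
    rw [← Finset.sum_mul, expWeight, Complex.re_mul_ofReal, Complex.re_sum]
    rw [← mul_assoc, ← mul_assoc, ← sub_mul]
    refine mul_le_mul_of_nonneg_right ?_ (Real.exp_pos _).le
    calc _ = ∑ j, ((1 / 2) * (η y ^ 2 * ‖dzbar j V y‖ ^ 2)
          - 2 * (‖dzbar j ηc y‖ ^ 2 * ‖V y‖ ^ 2)) := by
          rw [Finset.sum_sub_distrib, Finset.mul_sum, Finset.sum_mul, Finset.mul_sum]
      _ ≤ _ := Finset.sum_le_sum fun j _ => hj j
  have I1 : Integrable fun y => (∑ j, η y ^ 2 * ‖dzbar j V y‖ ^ 2) * Real.exp (-ψ y) := by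
    have hc : Continuous fun y => (∑ j, η y ^ 2 * ‖dzbar j V y‖ ^ 2) * Real.exp (-ψ y) := by
      fun_prop
    refine hc.integrable_of_hasCompactSupport ?_
    refine hηs.mono' fun y hy => subset_tsupport _ fun h => hy ?_
    simp [h]
  have I2 : Integrable fun y => (∑ j, ‖dzbar j ηc y‖ ^ 2) * ‖V y‖ ^ 2 * Real.exp (-ψ y) := by
    have hVc := hV.continuous
    have hc : Continuous fun y => (∑ j, ‖dzbar j ηc y‖ ^ 2) * ‖V y‖ ^ 2 * Real.exp (-ψ y) := by
      fun_prop
    refine hc.integrable_of_hasCompactSupport ?_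
    refine hη.compact.mono' fun y hy => ?_
    by_contra h
    refine hy ?_
    simp [dzbar_eq_wirt, wirt_eq_zero_of_notMem_tsupport h]
  have I3 : Integrable fun y => ∑ j, dzbar j V y * conj (dzbar j W y) * expWeight ψ y :=
    (IsTest.sum _ fun j _ =>
      ((hWt.dzbar j).conj.mul_left (contDiff_dzbar hV j)).mul_right hm).integrable
  have I4 : Integrable fun y => boxOp ψ V y * conj (W y) * expWeight ψ y :=
    ((hWt.conj.mul_left hbox).mul_right hm).integrable
  have low : (1 / 2) * (∫ y, (∑ j, η y ^ 2 * ‖dzbar j V y‖ ^ 2) * Real.exp (-ψ y))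
      - 2 * (∫ y, (∑ j, ‖dzbar j ηc y‖ ^ 2) * ‖V y‖ ^ 2 * Real.exp (-ψ y))
      ≤ (∫ y, ∑ j, dzbar j V y * conj (dzbar j W y) * expWeight ψ y).re := by
    rw [← RCLike.re_eq_complex_re, ← integral_re I3, ← integral_const_mul, ← integral_const_mul,
      ← integral_sub (I1.const_mul _) (I2.const_mul _)]
    exact integral_mono ((I1.const_mul _).sub (I2.const_mul _)) I3.re hpt
  have up : (∫ y, boxOp ψ V y * conj (W y) * expWeight ψ y).re
      ≤ ∫ y, ‖boxOp ψ V y‖ * (η y ^ 2 * ‖V y‖) * Real.exp (-ψ y) := by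
    refine (Complex.re_le_norm _).trans ((norm_integral_le_integral_norm _).trans (le_of_eq ?_))
    refine integral_congr_ae (.of_forall fun y => ?_)
    simp only [hW, hηc, expWeight, norm_mul, RCLike.norm_conj, Complex.norm_real, Real.norm_eq_abs,
      abs_of_pos (Real.exp_pos _), abs_mul_abs_self, sq]
  rw [hid] at up
  linarith

end

/-! ### Global weak `L²` solutions are holomorphic. -/

/-- A smooth cut-off function that is `1` on the unit ball and `0` outside the ball of radius `2`. -/
def stdCutoff (x : Cn n) : ℝ := Real.smoothTransition (2 - ‖x‖ ^ 2)

lemma contDiff_stdCutoff : ContDiff ℝ ∞ (stdCutoff (n := n)) :=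
  Real.smoothTransition.contDiff (n := ⊤) |>.comp (contDiff_const.sub (contDiff_norm_sq ℝ))

lemma stdCutoff_eq_one {x : Cn n} (hx : ‖x‖ ≤ 1) : stdCutoff x = 1 :=
  Real.smoothTransition.one_of_one_le (by nlinarith [norm_nonneg x])

lemma stdCutoff_eq_zero {x : Cn n} (hx : 2 ≤ ‖x‖) : stdCutoff x = 0 :=
  Real.smoothTransition.zero_of_nonpos (by nlinarith)

lemma stdCutoff_nonneg (x : Cn n) : 0 ≤ stdCutoff x := Real.smoothTransition.nonneg _

lemma stdCutoff_le_one (x : Cn n) : stdCutoff x ≤ 1 := Real.smoothTransition.le_one _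

lemma isTest_stdCutoff {R : ℝ} (hR : 0 < R) :
    IsTest fun x : Cn n => (stdCutoff (R⁻¹ • x) : ℂ) := by
  refine ⟨contDiff_ofReal (contDiff_stdCutoff.comp (contDiff_const_smul _)), ?_⟩
  refine HasCompactSupport.of_support_subset_isCompact (isCompact_closedBall 0 (2 * R))
    fun x hx => ?_
  by_contra h
  rw [mem_closedBall_zero_iff, not_le] at h
  refine hx ?_
  have h0 : stdCutoff (R⁻¹ • x) = 0 := by
    refine stdCutoff_eq_zero ?_
    rw [norm_smul, norm_inv, Real.norm_of_nonneg hR.le, inv_mul_eq_div, le_div_iff₀ hR]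
    exact h.le
  simp [h0]

/-- The chain rule gives the decay `R^{-2}`, which makes the cut-off term of Caccioppoli's
inequality vanish as `R → ∞`. -/
lemma exists_dzbar_stdCutoff_le : ∃ C : ℝ, 0 ≤ C ∧ ∀ R : ℝ, 0 < R → ∀ x : Cn n,
    ∑ j, ‖dzbar j (fun y => (stdCutoff (R⁻¹ • y) : ℂ)) x‖ ^ 2 ≤ C / R ^ 2 := by
  have h1 : IsTest fun x : Cn n => (stdCutoff x : ℂ) := by
    simpa using isTest_stdCutoff (n := n) one_pos
  have hB : ∀ j : Fin n, ∃ B, ∀ x, ‖dzbar j (fun y => (stdCutoff y : ℂ)) x‖ ≤ B := fun j =>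
    (h1.dzbar j).smooth.continuous.bounded_above_of_compact_support (h1.dzbar j).compact
  choose B hB using hB
  refine ⟨∑ j, B j ^ 2, by positivity, fun R hR x => ?_⟩
  rw [Finset.sum_div]
  refine Finset.sum_le_sum fun j _ => ?_
  have e : dzbar j (fun y => (stdCutoff (R⁻¹ • y) : ℂ)) x
      = (R⁻¹ : ℝ) * dzbar j (fun y => (stdCutoff y : ℂ)) (R⁻¹ • x) := by
    simp only [dzbar, fderiv_comp_smul (f := fun z : Cn n => (stdCutoff z : ℂ)), smul_apply,
      Complex.real_smul]
    ring
  rw [e, norm_mul, mul_pow, Complex.norm_real, Real.norm_of_nonneg (by positivity), inv_pow,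
    inv_mul_eq_div]
  have := hB j (R⁻¹ • x)
  gcongr

lemma integral_le_of_lintegral_le {X : Type*} [MeasurableSpace X] {μ : Measure X} {f : X → ℂ}
    (hf : AEStronglyMeasurable f μ) {δ : ℝ} (hδ : 0 ≤ δ)
    (h : ∫⁻ x, ‖f x‖ₑ ^ 2 ∂μ ≤ ENNReal.ofReal δ) :
    Integrable (fun x => ‖f x‖ ^ 2) μ ∧ ∫ x, ‖f x‖ ^ 2 ∂μ ≤ δ := by
  have e : ∀ x, ENNReal.ofReal (‖f x‖ ^ 2) = ‖f x‖ₑ ^ 2 := fun x => by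
    rw [ENNReal.ofReal_pow (norm_nonneg _), ofReal_norm]
  constructor
  · refine ⟨(hf.norm.pow 2), ?_⟩
    rw [hasFiniteIntegral_iff_ofReal (.of_forall fun x => by positivity)]
    simp only [e]
    exact h.trans_lt ENNReal.ofReal_lt_top
  · rw [integral_eq_lintegral_of_nonneg_ae 
      (f := fun x => ‖f x‖ ^ 2) (.of_forall fun x => by positivity) (hf.norm.pow 2)]
    simp only [e]
    exact ENNReal.toReal_le_of_le_ofReal hδ h

/-- Young's inequality with the weight `p` shared between the factors. The parameter `R` turns a
first integral of size `R^{-2}` and a bounded second one into a total of size `R^{-1}`. -/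
lemma norm_integral_mul_le {X : Type*} [MeasurableSpace X] {μ : Measure X} {a b : X → ℂ}
    {p : X → ℝ} {R : ℝ} (hR : 0 < R) (hp : ∀ x, 0 < p x)
    (ia : Integrable (fun x => ‖a x‖ ^ 2 * p x) μ)
    (ib : Integrable (fun x => ‖b x‖ ^ 2 * (p x)⁻¹) μ) :
    ‖∫ x, a x * b x ∂μ‖
      ≤ R * (∫ x, ‖a x‖ ^ 2 * p x ∂μ) + (1 / R) * ∫ x, ‖b x‖ ^ 2 * (p x)⁻¹ ∂μ := by
  calc _ ≤ ∫ x, ‖a x * b x‖ ∂μ := norm_integral_le_integral_norm _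
    _ ≤ ∫ x, (R * (‖a x‖ ^ 2 * p x) + (1 / R) * (‖b x‖ ^ 2 * (p x)⁻¹)) ∂μ := by
      refine integral_mono_of_nonneg (.of_forall fun _ => norm_nonneg _)
        ((ia.const_mul _).add (ib.const_mul _)) (.of_forall fun x => ?_)
      simp only [norm_mul]
      have h3 := hp x
      have : R * (‖a x‖ ^ 2 * p x) + (1 / R) * (‖b x‖ ^ 2 * (p x)⁻¹) - ‖a x‖ * ‖b x‖
          = ((R * ‖a x‖ * p x - ‖b x‖) ^ 2 + (R * ‖a x‖ * p x) ^ 2 + ‖b x‖ ^ 2)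
            / (2 * R * p x) := by field_simp; ring
      have h0 : 0 ≤ ((R * ‖a x‖ * p x - ‖b x‖) ^ 2 + (R * ‖a x‖ * p x) ^ 2 + ‖b x‖ ^ 2)
            / (2 * R * p x) := by positivity
      linarith
    _ = _ := by
      rw [integral_add (ia.const_mul _) (ib.const_mul _), integral_const_mul, integral_const_mul]

section

variable {ψ : Cn n → ℝ} {v : Cn n → ℂ}

/-- The Caccioppoli estimate for mollifications of a weak solution, on large balls. -/
lemma WeakHarmonic.exists_approx (hψ : ContDiff ℝ ∞ ψ) (h : WeakHarmonic ψ v)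
    (hv : Measurable v) (hv2 : Integrable fun y => ‖v y‖ ^ 2 * Real.exp (-ψ y)) :
    ∃ C : ℝ, 0 ≤ C ∧ ∀ R : ℝ, 1 ≤ R → ∃ V : Cn n → ℂ, ContDiff ℝ ∞ V ∧
      IntegrableOn (fun y => ‖V y - v y‖ ^ 2) (Metric.closedBall 0 R) ∧
      ∫ y in Metric.closedBall 0 R, ‖V y - v y‖ ^ 2 ≤ 1 / R ^ 2 ∧
      ∫ y in Metric.closedBall 0 R, (∑ j, ‖dzbar j V y‖ ^ 2) * Real.exp (-ψ y) ≤ C / R ^ 2 := by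
  obtain ⟨C₁, hC₁, hcut⟩ := exists_dzbar_stdCutoff_le (n := n)
  set N := ∫ y, ‖v y‖ ^ 2 * Real.exp (-ψ y) with hN
  have hN0 : 0 ≤ N := integral_nonneg fun y => by positivity
  have hvl := locallyIntegrable_of_weighted hψ.continuous hv hv2
  have hmr : Continuous fun y => Real.exp (-ψ y) := Real.continuous_exp.comp hψ.continuous.neg
  -- Collected from the two terms of Caccioppoli's inequality; `2 * N + 2` bounds the weighted norm
  -- of `V` on `S`.
  refine ⟨1 + (1 + 4 * C₁) * (2 * N + 2), by positivity, fun R hR => ?_⟩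
  have hR0 : 0 < R := by linarith
  set S := Metric.closedBall (0 : Cn n) (2 * R) with hS
  have hSm : MeasurableSet S := Metric.isClosed_closedBall.measurableSet
  have hSc : IsCompact S := isCompact_closedBall _ _
  obtain ⟨B, hB⟩ := hSc.exists_bound_of_continuousOn hmr.continuousOn
  have hB' : ∀ y ∈ S, Real.exp (-ψ y) ≤ |B| + 1 := fun y hy => by
    have := hB y hy
    rw [Real.norm_of_nonneg (Real.exp_pos _).le] at this
    linarith [le_abs_self B]
  set b := |B| + 1 with hb
  have hb1 : 1 ≤ b := by have := abs_nonneg B; linarith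
  -- The `boxOp` error will be multiplied by `R² b / 2` in Young's inequality, where `b` bounds the
  -- weight on `S`. The power `R⁴` leaves a term of size `R^{-2}`.
  have hδ : 0 < 1 / (b * R ^ 4) := by positivity
  obtain ⟨ε, hε, he1, he2⟩ := h.exists_mconv_close hψ hv hv2 (2 * R) hδ
  have hm := isTest_mollifier (n := n) hε
  set V := mconv (fun y => (mollifier ε y : ℂ)) v with hV
  have hVs : ContDiff ℝ ∞ V := contDiff_mconv hm hvl
  have hbox : ContDiff ℝ ∞ (boxOp ψ V) :=
    ContDiff.sum fun j _ => contDiff_adjZ hψ (contDiff_dzbar hVs j) j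
  obtain ⟨i1, l1⟩ := integral_le_of_lintegral_le
    (f := fun x => V x - v x) (hVs.continuous.measurable.sub hv).aestronglyMeasurable hδ.le he1
  obtain ⟨i2, l2⟩ := integral_le_of_lintegral_le hbox.continuous.aestronglyMeasurable hδ.le he2
  have hsub : Metric.closedBall (0 : Cn n) R ⊆ S := Metric.closedBall_subset_closedBall (by linarith)
  have hR4 : 1 / (b * R ^ 4) ≤ 1 / R ^ 2 := by
    apply one_div_le_one_div_of_le (by positivity)
    have h1 : R ^ 2 ≤ R ^ 4 := pow_le_pow_right₀ hR (by norm_num)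
    nlinarith [pow_pos hR0 4]
  refine ⟨V, hVs, IntegrableOn.mono_set i1 hsub, ?_, ?_⟩
  · exact ((setIntegral_mono_set i1 (.of_forall fun y => by positivity)
      (.of_forall hsub)).trans l1).trans hR4
  · set η : Cn n → ℝ := fun x => stdCutoff (R⁻¹ • x) with hη
    have hηt : IsTest fun x : Cn n => (η x : ℂ) := isTest_stdCutoff hR0
    have hη0 : ∀ y, 0 ≤ η y := fun y => stdCutoff_nonneg _
    have hη1 : ∀ y, η y ≤ 1 := fun y => stdCutoff_le_one _
    have hηc : Continuous η := contDiff_stdCutoff.continuous.comp (continuous_const_smul _)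
    have hηS : ∀ y ∉ S, η y = 0 := fun y hy => by
      refine stdCutoff_eq_zero ?_
      rw [hS, mem_closedBall_zero_iff, not_le] at hy
      rw [norm_smul, norm_inv, Real.norm_of_nonneg hR0.le, inv_mul_eq_div, le_div_iff₀ hR0]
      exact hy.le
    have hηR : ∀ y ∈ Metric.closedBall (0 : Cn n) R, η y = 1 := fun y hy => by
      refine stdCutoff_eq_one ?_
      rw [mem_closedBall_zero_iff] at hy
      rw [norm_smul, norm_inv, Real.norm_of_nonneg hR0.le, inv_mul_eq_div, div_le_one hR0]
      exact hy
    have hdηS : ∀ y ∉ S, ∀ j, dzbar j (fun x => (η x : ℂ)) y = 0 := fun y hy j => by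
      refine wirt_eq_zero_of_notMem_tsupport fun hy' => hy ?_
      refine closure_minimal (fun z hz => ?_) Metric.isClosed_closedBall hy'
      by_contra hzS
      exact hz (by simp [hηS z hzS])
    have hdV : ∀ j, Continuous (dzbar j V) := fun j => (contDiff_dzbar hVs j).continuous
    have hVc := hVs.continuous
    have hbc := hbox.continuous
    have hcac := caccioppoli hψ hVs hηt
    -- the weighted norm of `V` on `S`
    have iV : IntegrableOn (fun y => ‖V y‖ ^ 2 * Real.exp (-ψ y)) S :=
      ((hVc.norm.pow 2).mul hmr).continuousOn.integrableOn_compact hSc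
    have nV : ∫ y in S, ‖V y‖ ^ 2 * Real.exp (-ψ y) ≤ 2 * N + 2 := by
      calc ∫ y in S, ‖V y‖ ^ 2 * Real.exp (-ψ y)
          ≤ ∫ y in S, (2 * (‖v y‖ ^ 2 * Real.exp (-ψ y)) + 2 * b * ‖V y - v y‖ ^ 2) := by
            refine setIntegral_mono_on iV ((hv2.integrableOn.const_mul 2).add
              (Integrable.const_mul i1 _)) hSm fun y hy => ?_
            have e1 : ‖V y‖ ^ 2 ≤ 2 * ‖v y‖ ^ 2 + 2 * ‖V y - v y‖ ^ 2 := by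
              have := norm_add_le (V y - v y) (v y)
              rw [sub_add_cancel] at this
              nlinarith [sq_nonneg (‖V y - v y‖ - ‖v y‖), norm_nonneg (V y)]
            have e2 := hB' y hy
            have e3 := Real.exp_pos (-ψ y)
            calc ‖V y‖ ^ 2 * Real.exp (-ψ y)
                ≤ (2 * ‖v y‖ ^ 2 + 2 * ‖V y - v y‖ ^ 2) * Real.exp (-ψ y) := by gcongr
              _ = 2 * (‖v y‖ ^ 2 * Real.exp (-ψ y)) + 2 * Real.exp (-ψ y) * ‖V y - v y‖ ^ 2 := by
                ring
              _ ≤ _ := by gcongr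
        _ = 2 * (∫ y in S, ‖v y‖ ^ 2 * Real.exp (-ψ y)) + 2 * b * ∫ y in S, ‖V y - v y‖ ^ 2 := by
            rw [integral_add (hv2.integrableOn.const_mul 2) (Integrable.const_mul i1 _),
              integral_const_mul, integral_const_mul]
        _ ≤ 2 * N + 2 * b * (1 / (b * R ^ 4)) := by
            gcongr
            exact setIntegral_le_integral hv2 (.of_forall fun y => by positivity)
        _ ≤ 2 * N + 2 := by
            have : 2 * b * (1 / (b * R ^ 4)) = 2 / R ^ 4 := by field_simp
            rw [this]
            have : 2 / R ^ 4 ≤ 2 := div_le_self (by norm_num) (one_le_pow₀ hR)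
            linarith
    have t1 : ∫ y, ‖boxOp ψ V y‖ * (η y ^ 2 * ‖V y‖) * Real.exp (-ψ y)
        ≤ (1 / 2) * (1 / R ^ 2) + (1 / (2 * R ^ 2)) * (2 * N + 2) := by
      rw [← setIntegral_eq_integral_of_forall_compl_eq_zero (s := S) fun y hy => by
        simp [hηS y hy]]
      calc ∫ y in S, ‖boxOp ψ V y‖ * (η y ^ 2 * ‖V y‖) * Real.exp (-ψ y)
          ≤ ∫ y in S, ((R ^ 2 * b / 2) * ‖boxOp ψ V y‖ ^ 2
            + (1 / (2 * R ^ 2)) * (‖V y‖ ^ 2 * Real.exp (-ψ y))) := by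
            have hcont : Continuous fun y => ‖boxOp ψ V y‖ * (η y ^ 2 * ‖V y‖) * Real.exp (-ψ y) := by
              fun_prop
            refine setIntegral_mono_on (hcont.continuousOn.integrableOn_compact hSc)
              ((Integrable.const_mul i2 _).add (Integrable.const_mul iV _)) hSm fun y hy => ?_
            have e2 := hB' y hy
            have e3 := Real.exp_pos (-ψ y)
            have e4 : η y ^ 2 ≤ 1 := pow_le_one₀ (hη0 y) (hη1 y)
            have e5 : ‖boxOp ψ V y‖ * ‖V y‖
                ≤ R ^ 2 / 2 * ‖boxOp ψ V y‖ ^ 2 + 1 / (2 * R ^ 2) * ‖V y‖ ^ 2 := by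
              have : R ^ 2 / 2 * ‖boxOp ψ V y‖ ^ 2 + 1 / (2 * R ^ 2) * ‖V y‖ ^ 2
                  - ‖boxOp ψ V y‖ * ‖V y‖ = (R * ‖boxOp ψ V y‖ - ‖V y‖ / R) ^ 2 / 2 := by
                field_simp; ring
              nlinarith [sq_nonneg (R * ‖boxOp ψ V y‖ - ‖V y‖ / R)]
            calc ‖boxOp ψ V y‖ * (η y ^ 2 * ‖V y‖) * Real.exp (-ψ y)
                ≤ ‖boxOp ψ V y‖ * (1 * ‖V y‖) * Real.exp (-ψ y) := by gcongr
              _ = (‖boxOp ψ V y‖ * ‖V y‖) * Real.exp (-ψ y) := by ring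
              _ ≤ (R ^ 2 / 2 * ‖boxOp ψ V y‖ ^ 2 + 1 / (2 * R ^ 2) * ‖V y‖ ^ 2)
                  * Real.exp (-ψ y) := by gcongr
              _ = R ^ 2 * Real.exp (-ψ y) / 2 * ‖boxOp ψ V y‖ ^ 2
                  + 1 / (2 * R ^ 2) * (‖V y‖ ^ 2 * Real.exp (-ψ y)) := by ring
              _ ≤ _ := by gcongr
        _ = (R ^ 2 * b / 2) * (∫ y in S, ‖boxOp ψ V y‖ ^ 2)
            + (1 / (2 * R ^ 2)) * ∫ y in S, ‖V y‖ ^ 2 * Real.exp (-ψ y) := by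
            rw [integral_add (Integrable.const_mul i2 _) (Integrable.const_mul iV _),
              integral_const_mul, integral_const_mul]
        _ ≤ (R ^ 2 * b / 2) * (1 / (b * R ^ 4)) + (1 / (2 * R ^ 2)) * (2 * N + 2) := by
            gcongr
        _ = _ := by
            congr 1
            field_simp
    have t2 : ∫ y, (∑ j, ‖dzbar j (fun y => (η y : ℂ)) y‖ ^ 2) * ‖V y‖ ^ 2 * Real.exp (-ψ y)
        ≤ C₁ / R ^ 2 * (2 * N + 2) := by
      rw [← setIntegral_eq_integral_of_forall_compl_eq_zero (s := S) fun y hy => by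
        simp [hdηS y hy]]
      calc _ ≤ ∫ y in S, C₁ / R ^ 2 * (‖V y‖ ^ 2 * Real.exp (-ψ y)) := by
            have hd : ∀ j, Continuous (dzbar j fun y => (η y : ℂ)) := fun j =>
              (hηt.dzbar j).smooth.continuous
            have hcont : Continuous fun y => (∑ j, ‖dzbar j (fun y => (η y : ℂ)) y‖ ^ 2) * ‖V y‖ ^ 2
                * Real.exp (-ψ y) := by fun_prop
            refine setIntegral_mono_on (hcont.continuousOn.integrableOn_compact hSc)
              (Integrable.const_mul iV _) hSm fun y hy => ?_
            rw [mul_assoc]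
            exact mul_le_mul_of_nonneg_right (hcut R hR0 y) (by positivity)
        _ = C₁ / R ^ 2 * ∫ y in S, ‖V y‖ ^ 2 * Real.exp (-ψ y) := integral_const_mul _ _
        _ ≤ _ := by gcongr
    have t3 : ∫ y in Metric.closedBall 0 R, (∑ j, ‖dzbar j V y‖ ^ 2) * Real.exp (-ψ y)
        ≤ ∫ y, (∑ j, η y ^ 2 * ‖dzbar j V y‖ ^ 2) * Real.exp (-ψ y) := by
      have hI : Integrable fun y => (∑ j, η y ^ 2 * ‖dzbar j V y‖ ^ 2) * Real.exp (-ψ y) := by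
        have hc : Continuous fun y => (∑ j, η y ^ 2 * ‖dzbar j V y‖ ^ 2) * Real.exp (-ψ y) := by
          fun_prop
        refine hc.integrable_of_hasCompactSupport ?_
        refine HasCompactSupport.of_support_subset_isCompact hSc fun y hy => ?_
        by_contra hyS
        exact hy (by simp [hηS y hyS])
      refine le_trans (le_of_eq ?_) (setIntegral_le_integral (s := Metric.closedBall 0 R) hI
        (.of_forall fun y => by positivity))
      refine setIntegral_congr_fun Metric.isClosed_closedBall.measurableSet fun y hy => ?_
      simp [hηR y hy]
    refine (t3.trans hcac).trans ?_
    calc _ ≤ 2 * ((1 / 2) * (1 / R ^ 2) + (1 / (2 * R ^ 2)) * (2 * N + 2))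
          + 4 * (C₁ / R ^ 2 * (2 * N + 2)) := by gcongr
      _ = _ := by field_simp; ring

/-- A weak `L²` solution of `∂̄* ∂̄ v = 0` on `ℂⁿ` is holomorphic. -/
theorem WeakHarmonic.weakHolo (hψ : ContDiff ℝ ∞ ψ) (h : WeakHarmonic ψ v)
    (hv : Measurable v) (hv2 : Integrable fun y => ‖v y‖ ^ 2 * Real.exp (-ψ y))
    (Ω : Set (Cn n)) : WeakHolo v Ω := by
  intro f hf _ j
  obtain ⟨C, hC, happ⟩ := h.exists_approx hψ hv hv2
  have hvl := locallyIntegrable_of_weighted hψ.continuous hv hv2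
  obtain ⟨R₀, hR₀⟩ := hf.compact.isBounded.subset_closedBall (0 : Cn n)
  have hmr : Continuous fun y => Real.exp (-ψ y) := Real.continuous_exp.comp hψ.continuous.neg
  have hmr' : Continuous fun y => Real.exp (ψ y) := Real.continuous_exp.comp hψ.continuous
  have hfc := hf.smooth.continuous
  have hdfc := (hf.dzbar j).smooth.continuous
  have hcF : HasCompactSupport fun y => ‖f y‖ ^ 2 :=
    hf.compact.comp_left (g := fun z : ℂ => ‖z‖ ^ 2) (by simp)
  have iF : Integrable fun y => ‖f y‖ ^ 2 * Real.exp (ψ y) :=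
    Continuous.integrable_of_hasCompactSupport (by fun_prop) hcF.mul_right
  have iG : Integrable fun y => ‖dzbar j f y‖ ^ 2 :=
    Continuous.integrable_of_hasCompactSupport (by fun_prop)
      ((hf.dzbar j).compact.comp_left (g := fun z : ℂ => ‖z‖ ^ 2) (by simp))
  set F := ∫ y, ‖f y‖ ^ 2 * Real.exp (ψ y)
  set G := ∫ y, ‖dzbar j f y‖ ^ 2
  -- Inserting the approximation `V` and integrating by parts, `∫ v ∂̄f = -∫ (V - v) ∂̄f - ∫ ∂̄V f`.
  -- Both terms are `O(1/R)`, while the left side does not depend on `R`.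
  have key : ∀ R : ℝ, 1 ≤ R → R₀ ≤ R →
      ‖∫ y, v y * dzbar j f y‖ ≤ (1 + G + C + F) / R := by
    intro R hR hRR
    obtain ⟨V, hV, i1, l1, l2⟩ := happ R hR
    have hR0 : 0 < R := by linarith
    set S := Metric.closedBall (0 : Cn n) R with hS
    have hSm : MeasurableSet S := Metric.isClosed_closedBall.measurableSet
    have hSc : IsCompact S := isCompact_closedBall _ _
    have hsupp : tsupport f ⊆ S := hR₀.trans (Metric.closedBall_subset_closedBall hRR)
    have hf0 : ∀ y ∉ S, f y = 0 := fun y hy =>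
      image_eq_zero_of_notMem_tsupport fun h => hy (hsupp h)
    have hdf0 : ∀ y ∉ S, dzbar j f y = 0 := fun y hy =>
      wirt_eq_zero_of_notMem_tsupport fun h => hy (hsupp h)
    have hdV := (contDiff_dzbar hV j).continuous
    have hVc := hV.continuous
    have hi : Integrable fun y => v y * dzbar j f y := by
      have := hvl.integrable_smul_right_of_hasCompactSupport hdfc (hf.dzbar j).compact
      simpa using this
    have hi2 : Integrable fun y => V y * dzbar j f y :=
      (hVc.mul hdfc).integrable_of_hasCompactSupport (hf.dzbar j).compact.mul_left
    have e1 : ∫ y, v y * dzbar j f y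
        = -(∫ y in S, (V y - v y) * dzbar j f y) - ∫ y in S, dzbar j V y * f y := by
      have e2 : ∫ y, V y * dzbar j f y = -∫ y, dzbar j V y * f y :=
        integral_mul_wirt (hV.of_le (by simp)) (hf.smooth.of_le (by simp)) hf.compact
      have e3 : ∫ y in S, dzbar j V y * f y = ∫ y, dzbar j V y * f y :=
        setIntegral_eq_integral_of_forall_compl_eq_zero fun y hy => by simp [hf0 y hy]
      have e4 : ∫ y in S, (V y - v y) * dzbar j f y = ∫ y, (V y - v y) * dzbar j f y :=
        setIntegral_eq_integral_of_forall_compl_eq_zero fun y hy => by simp [hdf0 y hy]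
      have e5 : ∫ y, (V y - v y) * dzbar j f y
          = (∫ y, V y * dzbar j f y) - ∫ y, v y * dzbar j f y := by
        rw [← integral_sub hi2 hi]; simp only [sub_mul]
      rw [e3, e4, e5, e2]; ring
    have b1 : ‖∫ y in S, (V y - v y) * dzbar j f y‖ ≤ (1 + G) / R := by
      have := norm_integral_mul_le (μ := volume.restrict S) (a := fun y => V y - v y)
        (b := dzbar j f) (p := fun _ => 1) hR0 (fun _ => one_pos) (by simpa [IntegrableOn] using i1)
        (by simpa [IntegrableOn] using iG.integrableOn (s := S))
      simp only [mul_one, inv_one] at this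
      refine this.trans ?_
      calc _ ≤ R * (1 / R ^ 2) + (1 / R) * G := by
            gcongr
            exact setIntegral_le_integral iG (.of_forall fun y => by positivity)
        _ = _ := by field_simp
    have b2 : ‖∫ y in S, dzbar j V y * f y‖ ≤ (C + F) / R := by
      have hd : ∀ j, Continuous (dzbar j V) := fun j => (contDiff_dzbar hV j).continuous
      have hc : Continuous fun y => (∑ j, ‖dzbar j V y‖ ^ 2) * Real.exp (-ψ y) := by fun_prop
      have hc' : Continuous fun y => ‖dzbar j V y‖ ^ 2 * Real.exp (-ψ y) := by fun_prop
      have i3 := hc.continuousOn.integrableOn_compact (μ := volume) hSc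
      have i4 := hc'.continuousOn.integrableOn_compact (μ := volume) hSc
      have := norm_integral_mul_le (μ := volume.restrict S) (a := dzbar j V)
        (b := f) (p := fun y => Real.exp (-ψ y)) hR0 (fun _ => Real.exp_pos _) i4
        (by simpa [Real.exp_neg, IntegrableOn] using iF.integrableOn (s := S))
      refine this.trans ?_
      have h1 : ∫ y in S, ‖dzbar j V y‖ ^ 2 * Real.exp (-ψ y)
          ≤ ∫ y in S, (∑ j, ‖dzbar j V y‖ ^ 2) * Real.exp (-ψ y) := by
        refine integral_mono i4 i3 fun y => ?_
        exact mul_le_mul_of_nonneg_right (Finset.single_le_sum (f := fun j => ‖dzbar j V y‖ ^ 2)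
          (fun i _ => by positivity) (Finset.mem_univ j)) (Real.exp_pos _).le
      have h2 : ∫ y in S, ‖f y‖ ^ 2 * (Real.exp (-ψ y))⁻¹ ≤ F := by
        simp only [Real.exp_neg, inv_inv]
        exact setIntegral_le_integral iF (.of_forall fun y => by positivity)
      calc _ ≤ R * (C / R ^ 2) + (1 / R) * F := by
            gcongr
            exact h1.trans l2
        _ = _ := by field_simp
    rw [e1]
    calc _ ≤ ‖-(∫ y in S, (V y - v y) * dzbar j f y)‖ + ‖∫ y in S, dzbar j V y * f y‖ :=
          norm_sub_le _ _
      _ ≤ (1 + G) / R + (C + F) / R := by rw [norm_neg]; gcongr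
      _ = _ := by ring
  have hlim : Tendsto (fun R : ℝ => (1 + G + C + F) / R) atTop (𝓝 0) :=
    tendsto_const_nhds.div_atTop tendsto_id
  have := ge_of_tendsto hlim (by
    filter_upwards [eventually_ge_atTop 1, eventually_ge_atTop R₀] with R h1 h2 using key R h1 h2)
  exact norm_le_zero_iff.1 this

end

/-! ### The spectral gap of the weighted Laplacian. -/

section

variable {ψ : Cn n → ℝ}

lemma adjZ_add (j : Fin n) {f g : Cn n → ℂ} (hf : ContDiff ℝ ∞ f) (hg : ContDiff ℝ ∞ g)
    (x : Cn n) : adjZ ψ j (fun y => f y + g y) x = adjZ ψ j f x + adjZ ψ j g x := by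
  simp only [adjZ, dz_eq_wirt]
  rw [wirt_add (hf.differentiable (by simp) x) (hg.differentiable (by simp) x)]
  ring

lemma boxOp_add {f g : Cn n → ℂ} (hf : ContDiff ℝ ∞ f) (hg : ContDiff ℝ ∞ g) (x : Cn n) :
    boxOp ψ (fun y => f y + g y) x = boxOp ψ f x + boxOp ψ g x := by
  rw [boxOp, boxOp, boxOp, ← Finset.sum_add_distrib]
  refine Finset.sum_congr rfl fun j _ => ?_
  have : dzbar j (fun y => f y + g y) = fun y => dzbar j f y + dzbar j g y := funext fun y =>
    wirt_add (hf.differentiable (by simp) y) (hg.differentiable (by simp) y)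
  rw [this, adjZ_add j (contDiff_dzbar hf j) (contDiff_dzbar hg j)]

lemma boxOp_const_mul (a : ℂ) {f : Cn n → ℂ} (hf : ContDiff ℝ ∞ f) (x : Cn n) :
    boxOp ψ (fun y => a * f y) x = a * boxOp ψ f x := by
  rw [boxOp, boxOp, Finset.mul_sum]
  refine Finset.sum_congr rfl fun j _ => ?_
  have : dzbar j (fun y => a * f y) = fun y => a * dzbar j f y := funext fun y =>
    wirt_const_mul a (hf.differentiable (by simp) y)
  rw [this]
  simp only [adjZ, dz_eq_wirt]
  rw [wirt_const_mul a ((contDiff_dzbar hf j).differentiable (by simp) x)]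
  ring

/-- The square root `e^{-ψ/2}` of the weight. -/
def halfWeight (ψ : Cn n → ℝ) (x : Cn n) : ℂ := (Real.exp (-ψ x / 2) : ℂ)

lemma contDiff_halfWeight (hψ : ContDiff ℝ ∞ ψ) : ContDiff ℝ ∞ (halfWeight ψ) :=
  contDiff_ofReal (Real.contDiff_exp.comp (hψ.neg.div_const 2))

lemma halfWeight_mul_self (x : Cn n) : halfWeight ψ x * halfWeight ψ x = expWeight ψ x := by
  rw [halfWeight, expWeight, ← Complex.ofReal_mul, ← Real.exp_add]; ring_nf

lemma conj_halfWeight (x : Cn n) : conj (halfWeight ψ x) = halfWeight ψ x := Complex.conj_ofReal _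

lemma halfWeight_ne_zero (x : Cn n) : halfWeight ψ x ≠ 0 :=
  Complex.ofReal_ne_zero.2 (Real.exp_pos _).ne'

lemma norm_sq_halfWeight (z : ℂ) (x : Cn n) :
    ‖z * halfWeight ψ x‖ ^ 2 = ‖z‖ ^ 2 * Real.exp (-ψ x) := by
  rw [norm_mul, mul_pow, halfWeight, Complex.norm_real, Real.norm_of_nonneg (Real.exp_pos _).le,
    sq (Real.exp _), ← Real.exp_add]; ring_nf

/-- The range of the weighted Laplacian on test functions, inside `L²`. -/
def boxRange (ψ : Cn n → ℝ) : Submodule ℂ (Lp ℂ 2 (volume : Measure (Cn n))) where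
  carrier := {r | ∃ g : Cn n → ℂ, IsTest g ∧ r =ᵐ[volume] fun y => boxOp ψ g y * halfWeight ψ y}
  add_mem' := by
    rintro r s ⟨g, hg, hr⟩ ⟨h, hh, hs⟩
    refine ⟨_, hg.add hh, ?_⟩
    filter_upwards [Lp.coeFn_add r s, hr, hs] with x h1 h2 h3
    rw [h1, Pi.add_apply, h2, h3, boxOp_add hg.smooth hh.smooth, add_mul]
  zero_mem' := by
    refine ⟨_, IsTest.zero, ?_⟩
    filter_upwards [Lp.coeFn_zero ℂ 2 (volume : Measure (Cn n))] with x h1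
    rw [h1]
    have : ∀ j : Fin n, dzbar j (fun _ : Cn n => (0 : ℂ)) = fun _ => 0 := fun j =>
      funext fun y => wirt_const _
    simp [boxOp, adjZ, this, dz_eq_wirt, wirt_const]
  smul_mem' := by
    rintro a r ⟨g, hg, hr⟩
    refine ⟨_, hg.mul_left (contDiff_const (c := a)), ?_⟩
    filter_upwards [Lp.coeFn_smul a r, hr] with x h1 h2
    rw [h1, Pi.smul_apply, h2, boxOp_const_mul a hg.smooth, smul_eq_mul, mul_assoc]

lemma inner_Lp_eq {X : Type*} [MeasurableSpace X] {μ : Measure X} (r s : Lp ℂ 2 μ) {f g : X → ℂ}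
    (hr : r =ᵐ[μ] f) (hs : s =ᵐ[μ] g) : inner ℂ r s = ∫ x, g x * conj (f x) ∂μ := by
  rw [L2.inner_def]
  refine integral_congr_ae ?_
  filter_upwards [hr, hs] with x h1 h2
  rw [h1, h2, RCLike.inner_apply]

lemma norm_Lp_sq_eq {X : Type*} [MeasurableSpace X] {μ : Measure X} (r : Lp ℂ 2 μ) {f : X → ℂ}
    (hr : r =ᵐ[μ] f) : ‖r‖ ^ 2 = ∫ x, ‖f x‖ ^ 2 ∂μ := by
  have h := inner_Lp_eq r r hr hr
  have e : ∀ x, f x * conj (f x) = ((‖f x‖ ^ 2 : ℝ) : ℂ) := fun x => by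
    rw [Complex.mul_conj, Complex.normSq_eq_norm_sq]
  simp only [e] at h
  rw [integral_complex_ofReal] at h
  have h2 := congrArg Complex.re h
  rw [Complex.ofReal_re] at h2
  rw [← h2]
  exact (inner_self_eq_norm_sq (𝕜 := ℂ) r).symm

lemma integrable_norm_sq_Lp {X : Type*} [MeasurableSpace X] {μ : Measure X} (r : Lp ℂ 2 μ) :
    Integrable (fun x => ‖r x‖ ^ 2) μ :=
  (memLp_two_iff_integrable_sq_norm (Lp.aestronglyMeasurable r)).1 (Lp.memLp r)

/-- The spectral gap of `∂̄* ∂̄`: a test function that is orthogonal to the holomorphic functions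
is controlled by its `∂̄`-derivatives. -/
theorem LeviBound.spectral_gap (hψ : ContDiff ℝ ∞ ψ) {c : ℝ} (hc0 : 0 < c) (hc : LeviBound ψ c)
    {w : Cn n → ℂ} (hw : IsTest w) (hwU : tsupport w ⊆ unitBall n)
    (hperp : ∀ F : Cn n → ℂ, DifferentiableOn ℂ F (unitBall n) →
      IntegrableOn (fun y => ‖F y‖ ^ 2 * Real.exp (-ψ y)) (unitBall n) →
      ∫ y, w y * conj (F y) * expWeight ψ y = 0) :
    c * ∫ y, ‖w y‖ ^ 2 * Real.exp (-ψ y) ≤ ∫ y, (∑ j, ‖dzbar j w y‖ ^ 2) * Real.exp (-ψ y) := by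
  have hUm : MeasurableSet (unitBall n) := Metric.isOpen_ball.measurableSet
  have hht := contDiff_halfWeight hψ
  have hwt : IsTest fun y => w y * halfWeight ψ y := hw.mul_right hht
  have hwm : MemLp (fun y => w y * halfWeight ψ y) 2 :=
    hwt.smooth.continuous.memLp_of_hasCompactSupport hwt.compact
  set W : Lp ℂ 2 (volume : Measure (Cn n)) := hwm.toLp _ with hW
  have hWae : W =ᵐ[volume] fun y => w y * halfWeight ψ y := hwm.coeFn_toLp
  have hWn : ‖W‖ ^ 2 = ∫ y, ‖w y‖ ^ 2 * Real.exp (-ψ y) := by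
    rw [norm_Lp_sq_eq W hWae]; simp only [norm_sq_halfWeight]
  set A := ∫ y, (∑ j, ‖dzbar j w y‖ ^ 2) * Real.exp (-ψ y) with hA
  -- `W` is a limit of elements of the range
  have hmem : W ∈ (boxRange ψ).topologicalClosure := by
    rw [← Submodule.orthogonal_orthogonal_eq_closure, Submodule.mem_orthogonal]
    intro q hq
    rw [Submodule.mem_orthogonal] at hq
    -- Undoing the factor `e^{-ψ/2}` turns orthogonality of `q` to the range into the weak equation
    -- for `v`. So `v` agrees a.e. on the ball with a holomorphic function, to which `w` is
    -- orthogonal.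
    set v : Cn n → ℂ := fun y => q y * (halfWeight ψ y)⁻¹ with hv
    have hvq : ∀ y, v y * halfWeight ψ y = q y := fun y => by
      rw [hv]; exact inv_mul_cancel_right₀ (halfWeight_ne_zero y) _
    have hvm : Measurable v :=
      (Lp.stronglyMeasurable q).measurable.mul hht.continuous.measurable.inv
    have hv2 : Integrable fun y => ‖v y‖ ^ 2 * Real.exp (-ψ y) := by
      simp only [← norm_sq_halfWeight, hvq]
      exact integrable_norm_sq_Lp q
    have hharm : WeakHarmonic ψ v := by
      intro g hg
      have hgt : IsTest fun y => boxOp ψ g y * halfWeight ψ y := (hg.boxOp hψ).mul_right hht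
      have hgm : MemLp (fun y => boxOp ψ g y * halfWeight ψ y) 2 :=
        hgt.smooth.continuous.memLp_of_hasCompactSupport hgt.compact
      have := hq (hgm.toLp _) ⟨g, hg, hgm.coeFn_toLp⟩
      rw [inner_Lp_eq _ _ hgm.coeFn_toLp (EventuallyEq.refl _ _)] at this
      rw [← this]
      refine integral_congr_ae (.of_forall fun y => ?_)
      simp only [← hvq, ← halfWeight_mul_self, map_mul, conj_halfWeight]
      ring
    obtain ⟨F, hF, hFv⟩ := (hharm.weakHolo hψ hvm hv2 (unitBall n)).exists_differentiableOn
      (locallyIntegrable_of_weighted hψ.continuous hvm hv2)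
    have hFi : IntegrableOn (fun y => ‖F y‖ ^ 2 * Real.exp (-ψ y)) (unitBall n) := by
      refine (hv2.integrableOn (s := unitBall n)).congr ?_
      filter_upwards [ae_restrict_of_ae hFv, ae_restrict_mem hUm] with y h1 h2
      rw [h1 h2]
    rw [inner_Lp_eq _ _ (EventuallyEq.refl _ _) hWae, ← hperp F hF hFi]
    refine integral_congr_ae ?_
    filter_upwards [hFv] with y hy
    by_cases hyU : y ∈ unitBall n
    · rw [hy hyU, ← hvq, ← halfWeight_mul_self, map_mul, conj_halfWeight]
      ring
    · rw [image_eq_zero_of_notMem_tsupport fun h => hyU (hwU h)]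
      simp
  -- the estimate on the range, extended by continuity
  have hclosed : IsClosed {r : Lp ℂ 2 (volume : Measure (Cn n)) |
      2 * (inner ℂ r W).re ≤ c⁻¹ * A + ‖r‖ ^ 2} :=
    isClosed_le (continuous_const.mul (Complex.continuous_re.comp
      (continuous_id.inner continuous_const)))
      (continuous_const.add (continuous_norm.pow 2))
  -- For `r` coming from `g`, the pairing with `W` is `∫ ∂̄w · conj(∂̄g) e^{-ψ}`. Young's inequality
  -- leaves `c ‖∂̄g‖²`, which is at most `‖r‖²` by the basic estimate.
  have hrange : (boxRange ψ : Set (Lp ℂ 2 (volume : Measure (Cn n)))) ⊆ {r |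
      2 * (inner ℂ r W).re ≤ c⁻¹ * A + ‖r‖ ^ 2} := by
    rintro r ⟨g, hg, hr⟩
    have hrn : ‖r‖ ^ 2 = ∫ y, ‖boxOp ψ g y‖ ^ 2 * Real.exp (-ψ y) := by
      rw [norm_Lp_sq_eq r hr]; simp only [norm_sq_halfWeight]
    have hG := hc.le_integral_boxOp_sq hψ hg
    have hin : inner ℂ r W = ∑ j, ∫ y, dzbar j w y * conj (dzbar j g y) * expWeight ψ y := by
      rw [inner_Lp_eq _ _ hr hWae, ← integral_boxOp_mul_conj hψ hw.smooth hg]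
      refine integral_congr_ae (.of_forall fun y => ?_)
      simp only [← halfWeight_mul_self, map_mul, conj_halfWeight]
      ring
    have hIt : ∀ j, IsTest fun y => dzbar j w y * conj (dzbar j g y) * expWeight ψ y := fun j =>
      ((hw.dzbar j).mul_right (hg.dzbar j).conj.smooth).mul_right (contDiff_expWeight hψ)
    rw [← integral_finsetSum _ fun j _ => (hIt j).integrable] at hin
    have hI := (IsTest.sum Finset.univ fun j _ => hIt j).integrable
    have iA : Integrable fun y => (∑ j, ‖dzbar j w y‖ ^ 2) * Real.exp (-ψ y) := by
      simp only [Finset.sum_mul]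
      exact integrable_finsetSum _ fun j _ => (hw.dzbar j).integrable_normSq hψ
    have iG : Integrable fun y => (∑ j, ‖dzbar j g y‖ ^ 2) * Real.exp (-ψ y) := by
      simp only [Finset.sum_mul]
      exact integrable_finsetSum _ fun j _ => (hg.dzbar j).integrable_normSq hψ
    have hle : 2 * (inner ℂ r W).re ≤ c⁻¹ * A
        + c * ∫ y, (∑ j, ‖dzbar j g y‖ ^ 2) * Real.exp (-ψ y) := by
      rw [hin, hA, ← RCLike.re_eq_complex_re, ← integral_re hI, ← integral_const_mul,
        ← integral_const_mul, ← integral_const_mul,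
        ← integral_add (iA.const_mul _) (iG.const_mul _)]
      refine integral_mono (hI.re.const_mul _) ((iA.const_mul _).add (iG.const_mul _)) fun y => ?_
      have hj : ∀ j, 2 * (dzbar j w y * conj (dzbar j g y)).re
          ≤ c⁻¹ * ‖dzbar j w y‖ ^ 2 + c * ‖dzbar j g y‖ ^ 2 := by
        intro j
        have h1 := Complex.re_le_norm (dzbar j w y * conj (dzbar j g y))
        rw [norm_mul, RCLike.norm_conj] at h1
        have h2 : c⁻¹ * ‖dzbar j w y‖ ^ 2 + c * ‖dzbar j g y‖ ^ 2
            - 2 * (‖dzbar j w y‖ * ‖dzbar j g y‖)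
            = (‖dzbar j w y‖ - c * ‖dzbar j g y‖) ^ 2 / c := by field_simp; ring
        have h3 : 0 ≤ (‖dzbar j w y‖ - c * ‖dzbar j g y‖) ^ 2 / c := by positivity
        linarith
      simp only [RCLike.re_eq_complex_re]
      rw [← Finset.sum_mul, expWeight, Complex.re_mul_ofReal, Complex.re_sum]
      calc 2 * ((∑ j, (dzbar j w y * conj (dzbar j g y)).re) * Real.exp (-ψ y))
          = (∑ j, 2 * (dzbar j w y * conj (dzbar j g y)).re) * Real.exp (-ψ y) := by
            rw [← Finset.mul_sum]; ring
        _ ≤ (∑ j, (c⁻¹ * ‖dzbar j w y‖ ^ 2 + c * ‖dzbar j g y‖ ^ 2)) * Real.exp (-ψ y) := by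
            gcongr with j
            exact hj j
        _ = _ := by
            rw [Finset.sum_add_distrib, ← Finset.mul_sum, ← Finset.mul_sum]; ring
    rw [Set.mem_ofPred_eq, hrn]
    linarith
  -- The inequality persists on the closure and is read at `r = W`, where it becomes `2 ‖W‖² ≤ c⁻¹ A
  -- + ‖W‖²`.
  have hWin := closure_minimal hrange hclosed hmem
  rw [Set.mem_ofPred_eq, inner_self_eq_norm_sq_to_K] at hWin
  have e : ((((‖W‖ : ℝ) : ℂ)) ^ 2).re = ‖W‖ ^ 2 := by
    rw [← Complex.ofReal_pow, Complex.ofReal_re]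
  have hWin' : 2 * ‖W‖ ^ 2 ≤ c⁻¹ * A + ‖W‖ ^ 2 := by
    rw [← e]; exact hWin.trans (by rw [e])
  rw [← hWn]
  have : ‖W‖ ^ 2 ≤ c⁻¹ * A := by linarith
  calc c * ‖W‖ ^ 2 ≤ c * (c⁻¹ * A) := by gcongr
    _ = A := by field_simp

end

/-! ### The Levi form and the global plurisubharmonic extension. -/

/-- The Levi form `∑ f_{jk̄} ζ_j ζ̄_k`. -/
def levi (f : Cn n → ℂ) (x : Cn n) (ζ : Fin n → ℂ) : ℂ :=
  ∑ j, ∑ k, dz j (dzbar k f) x * ζ j * conj (ζ k)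

lemma levi_congr {f g : Cn n → ℂ} {x : Cn n} (h : f =ᶠ[𝓝 x] g) (ζ : Fin n → ℂ) :
    levi f x ζ = levi g x ζ := by
  have : ∀ j k, dz j (dzbar k f) x = dz j (dzbar k g) x := fun j k => by
    simp only [dz_eq_wirt, dzbar_eq_wirt]
    exact wirt_congr (h.eventuallyEq_nhds.mono fun y hy => wirt_congr hy)
  simp only [levi, this]

lemma levi_add {f g : Cn n → ℂ} (hf : ContDiff ℝ ∞ f) (hg : ContDiff ℝ ∞ g) (x : Cn n)
    (ζ : Fin n → ℂ) : levi (fun y => f y + g y) x ζ = levi f x ζ + levi g x ζ := by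
  have h1 : ∀ k, dzbar k (fun y => f y + g y) = fun y => dzbar k f y + dzbar k g y := fun k => by
    funext y
    exact wirt_add (hf.differentiable (by simp) y) (hg.differentiable (by simp) y)
  have h2 : ∀ j k, dz j (dzbar k (fun y => f y + g y)) x
      = dz j (dzbar k f) x + dz j (dzbar k g) x := fun j k => by
    rw [h1, dz_eq_wirt, dz_eq_wirt, dz_eq_wirt]
    exact wirt_add ((contDiff_dzbar hf k).differentiable (by simp) x)
      ((contDiff_dzbar hg k).differentiable (by simp) x)
  simp only [levi, h2, add_mul, Finset.sum_add_distrib]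

lemma levi_const_mul (a : ℂ) {f : Cn n → ℂ} (hf : ContDiff ℝ ∞ f) (x : Cn n)
    (ζ : Fin n → ℂ) : levi (fun y => a * f y) x ζ = a * levi f x ζ := by
  have h1 : ∀ k, dzbar k (fun y => a * f y) = fun y => a * dzbar k f y := fun k => by
    funext y
    exact wirt_const_mul a (hf.differentiable (by simp) y)
  have h2 : ∀ j k, dz j (dzbar k (fun y => a * f y)) x = a * dz j (dzbar k f) x := fun j k => by
    rw [h1, dz_eq_wirt, dz_eq_wirt]
    exact wirt_const_mul a ((contDiff_dzbar hf k).differentiable (by simp) x)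
  simp only [levi, h2, Finset.mul_sum, mul_assoc]

lemma levi_smul (f : Cn n → ℂ) (x : Cn n) (r : ℝ) (ζ : Fin n → ℂ) :
    levi f x (r • ζ) = (r ^ 2 : ℝ) * levi f x ζ := by
  simp only [levi, Finset.mul_sum]
  refine Finset.sum_congr rfl fun j _ => Finset.sum_congr rfl fun k _ => ?_
  simp
  ring

lemma exists_norm_levi_le {f : Cn n → ℂ} (hf : IsTest f) :
    ∃ B : ℝ, 0 ≤ B ∧ ∀ x ζ, ‖levi f x ζ‖ ≤ B * ∑ j, ‖ζ j‖ ^ 2 := by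
  have hB : ∀ j k : Fin n, ∃ B, ∀ x, ‖dz j (dzbar k f) x‖ ≤ B := fun j k =>
    ((hf.dzbar k).dz j).smooth.continuous.bounded_above_of_compact_support
      ((hf.dzbar k).dz j).compact
  choose B hB using hB
  have hB0 : ∀ j k, 0 ≤ B j k := fun j k => (norm_nonneg _).trans (hB j k 0)
  refine ⟨∑ j, ∑ k, B j k, Finset.sum_nonneg fun j _ => Finset.sum_nonneg fun k _ => hB0 j k,
    fun x ζ => ?_⟩
  rw [Finset.sum_mul]
  refine (norm_sum_le _ _).trans (Finset.sum_le_sum fun j _ => ?_)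
  rw [Finset.sum_mul]
  refine (norm_sum_le _ _).trans (Finset.sum_le_sum fun k _ => ?_)
  rw [norm_mul, norm_mul, RCLike.norm_conj, mul_assoc]
  have h1 : ‖ζ j‖ ^ 2 ≤ ∑ j, ‖ζ j‖ ^ 2 :=
    Finset.single_le_sum (f := fun j => ‖ζ j‖ ^ 2) (fun i _ => by positivity) (Finset.mem_univ j)
  have h2 : ‖ζ k‖ ^ 2 ≤ ∑ j, ‖ζ j‖ ^ 2 :=
    Finset.single_le_sum (f := fun j => ‖ζ j‖ ^ 2) (fun i _ => by positivity) (Finset.mem_univ k)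
  have h3 : ‖ζ j‖ * ‖ζ k‖ ≤ ∑ j, ‖ζ j‖ ^ 2 := by nlinarith [sq_nonneg (‖ζ j‖ - ‖ζ k‖)]
  exact mul_le_mul (hB j k x) h3 (by positivity) (hB0 j k)

lemma levi_norm_sq (x : Cn n) (ζ : Fin n → ℂ) :
    levi (fun y => ((‖y‖ ^ 2 : ℝ) : ℂ)) x ζ = ((∑ j, ‖ζ j‖ ^ 2 : ℝ) : ℂ) := by
  have h : ∀ k : Fin n, dzbar k (fun y : Cn n => ((‖y‖ ^ 2 : ℝ) : ℂ)) = fun y => y k := fun k =>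
    funext fun y => dzbar_norm_sq k y
  simp only [levi, h, dz_eq_wirt, wirt_coord]
  push_cast
  refine Finset.sum_congr rfl fun j _ => ?_
  simp [Complex.mul_conj, Complex.normSq_eq_norm_sq]

/-- A smooth convex function on `ℝ` that vanishes on `(-∞, 1]` and grows to its right. -/
def convexGlue (s : ℝ) : ℝ := ∫ τ in (0 : ℝ)..s, expNegInvGlue (τ - 1)

lemma contDiff_expNegInvGlue_sub_one : ContDiff ℝ ∞ fun s : ℝ => expNegInvGlue (s - 1) :=
  (expNegInvGlue.contDiff (n := ⊤)).comp (contDiff_id.sub contDiff_const)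

lemma hasDerivAt_convexGlue (s : ℝ) : HasDerivAt convexGlue (expNegInvGlue (s - 1)) s :=
  (contDiff_expNegInvGlue_sub_one.continuous.integral_hasStrictDerivAt 0 s).hasDerivAt

lemma contDiff_convexGlue : ContDiff ℝ ∞ convexGlue := by
  rw [contDiff_infty_iff_deriv]
  refine ⟨fun s => (hasDerivAt_convexGlue s).differentiableAt, ?_⟩
  rw [show deriv convexGlue = fun s => expNegInvGlue (s - 1) from
    funext fun s => (hasDerivAt_convexGlue s).deriv]
  exact contDiff_expNegInvGlue_sub_one

lemma convexGlue_eq_zero {s : ℝ} (h0 : 0 ≤ s) (h1 : s ≤ 1) : convexGlue s = 0 := by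
  unfold convexGlue
  refine intervalIntegral.integral_zero_ae (.of_forall fun τ hτ => ?_)
  rw [Set.uIoc_of_le h0] at hτ
  exact expNegInvGlue.zero_of_nonpos (by linarith [hτ.2])

lemma contDiff_convexGlue_norm_sq :
    ContDiff ℝ ∞ fun x : Cn n => convexGlue (‖x‖ ^ 2) :=
  contDiff_convexGlue.comp (contDiff_norm_sq ℝ)

/-- The Levi form of `h(|z|²)` is `h' |ζ|² + h'' |∑ z̄_j ζ_j|²`, and convexity of `h` makes the
second term nonnegative. -/
lemma le_levi_convexGlue (x : Cn n) (ζ : Fin n → ℂ) :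
    expNegInvGlue (‖x‖ ^ 2 - 1) * ∑ j, ‖ζ j‖ ^ 2
      ≤ (levi (fun y => (convexGlue (‖y‖ ^ 2) : ℂ)) x ζ).re := by
  have hq : ∀ y : Cn n, DifferentiableAt ℝ (fun y : Cn n => ‖y‖ ^ 2) y := fun y =>
    (contDiff_norm_sq ℝ).differentiable (n := ∞) (by simp) y
  have h1 : ∀ k : Fin n, dzbar k (fun y : Cn n => (convexGlue (‖y‖ ^ 2) : ℂ))
      = fun y => (expNegInvGlue (‖y‖ ^ 2 - 1) : ℂ) * y k := fun k => funext fun y => by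
    rw [dzbar_eq_wirt, wirt_ofReal_comp (hasDerivAt_convexGlue _) (hq y), ← dzbar_eq_wirt,
      dzbar_norm_sq]
  set p : ℝ := deriv (fun s => expNegInvGlue (s - 1)) (‖x‖ ^ 2) with hp
  have hd : HasDerivAt (fun s => expNegInvGlue (s - 1)) p (‖x‖ ^ 2) :=
    (contDiff_expNegInvGlue_sub_one.differentiable (by simp) _).hasDerivAt
  have hp0 : 0 ≤ p := Monotone.deriv_nonneg fun a b hab =>
    expNegInvGlue.monotone (by linarith)
  have h2 : ∀ j k : Fin n, dz j (dzbar k (fun y : Cn n => (convexGlue (‖y‖ ^ 2) : ℂ))) x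
      = p * conj (x j) * x k + if k = j then (expNegInvGlue (‖x‖ ^ 2 - 1) : ℂ) else 0 := by
    intro j k
    have hs : ContDiff ℝ ∞ fun y : Cn n => (expNegInvGlue (‖y‖ ^ 2 - 1) : ℂ) :=
      contDiff_ofReal (contDiff_expNegInvGlue_sub_one.comp (contDiff_norm_sq ℝ))
    rw [h1, dz_eq_wirt, wirt_mul (hs.differentiable (by simp) x)
      ((contDiff_coord k).differentiable (by simp) x),
      wirt_ofReal_comp hd (hq x), ← dz_eq_wirt, dz_norm_sq, wirt_coord]
    congr 1
    split_ifs <;> simp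
  have h3 : levi (fun y => (convexGlue (‖y‖ ^ 2) : ℂ)) x ζ
      = ((p * ‖∑ j, conj (x j) * ζ j‖ ^ 2
        + expNegInvGlue (‖x‖ ^ 2 - 1) * ∑ j, ‖ζ j‖ ^ 2 : ℝ) : ℂ) := by
    push_cast
    rw [← Complex.mul_conj', map_sum, Finset.sum_mul_sum, Finset.mul_sum, Finset.mul_sum,
      ← Finset.sum_add_distrib]
    simp only [levi, h2, add_mul, Finset.sum_add_distrib, ite_mul, zero_mul,
      Finset.sum_ite_eq', Finset.mem_univ, if_true]
    congr 1
    · refine Finset.sum_congr rfl fun j _ => ?_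
      rw [Finset.mul_sum]
      refine Finset.sum_congr rfl fun k _ => ?_
      simp
      ring
    · refine Finset.sum_congr rfl fun j _ => ?_
      rw [mul_assoc, Complex.mul_conj']
  rw [h3, Complex.ofReal_re]
  have : 0 ≤ p * ‖∑ j, conj (x j) * ζ j‖ ^ 2 := by positivity
  linarith

section extension

variable {φ : Cn n → ℝ}

lemma contDiffAt_dz_dzbar {f : Cn n → ℂ} {x : Cn n} (hf : ContDiffAt ℝ ∞ f x) (i j : Fin n) :
    ContDiffAt ℝ ∞ (dz i (dzbar j f)) x := by
  rw [dz_eq_wirt, dzbar_eq_wirt]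
  exact contDiffAt_wirt (contDiffAt_wirt hf)

/-- Positive definiteness is made uniform by compactness of the closed ball times the unit sphere;
quadratic homogeneity in `ζ` does the rest. -/
lemma exists_pos_le_levi (hφ : ∀ x ∈ Metric.ball (0 : Cn n) 3, ContDiffAt ℝ ∞ φ x)
    (hpos : IsKahlerPotential φ (Metric.ball 0 3)) {r : ℝ} (hr : r < 3) :
    ∃ c > 0, ∀ x ∈ Metric.closedBall (0 : Cn n) r, ∀ ζ : Fin n → ℂ,
      c * ∑ j, ‖ζ j‖ ^ 2 ≤ (levi (fun y => (φ y : ℂ)) x ζ).re := by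
  have hsub : Metric.closedBall (0 : Cn n) r ⊆ Metric.ball 0 3 :=
    Metric.closedBall_subset_ball hr
  have hφ' : ∀ x ∈ Metric.ball (0 : Cn n) 3, ContDiffAt ℝ ∞ (fun y => (φ y : ℂ)) x := fun x hx =>
    Complex.ofRealCLM.contDiff.contDiffAt.comp x (hφ x hx)
  have hcont : ContinuousOn (fun p : Cn n × Cn n => (levi (fun y => (φ y : ℂ)) p.1 p.2).re)
      (Metric.closedBall 0 r ×ˢ Metric.sphere 0 1) := by
    refine Complex.continuous_re.comp_continuousOn ?_
    unfold levi
    refine continuousOn_finsetSum _ fun j _ => continuousOn_finsetSum _ fun k _ => ?_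
    refine ContinuousOn.mul (ContinuousOn.mul ?_ ?_) ?_
    · intro p hp
      have : ContinuousAt (dz j (dzbar k fun y => (φ y : ℂ))) p.1 :=
        (contDiffAt_dz_dzbar (hφ' _ (hsub hp.1)) j k).continuousAt
      exact (this.comp (f := Prod.fst) continuousAt_fst).continuousWithinAt
    · exact Continuous.continuousOn (by fun_prop)
    · exact Continuous.continuousOn (by fun_prop)
  have hp : ∀ p ∈ Metric.closedBall (0 : Cn n) r ×ˢ Metric.sphere (0 : Cn n) 1,
      0 < (levi (fun y => (φ y : ℂ)) p.1 p.2).re := by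
    rintro ⟨x, ζ⟩ ⟨hx, hζ⟩
    -- `PosDef` conjugates the left vector whereas `levi` conjugates the second one, so the Hessian
    -- is tested on `conj ζ`.
    have h0 : (fun i => conj (ζ i)) ≠ 0 := by
      intro h
      have : ζ = 0 := by
        ext i
        simpa using congrFun h i
      simp [this] at hζ
    have := (hpos x (hsub hx)).dotProduct_mulVec_pos h0
    have e : star (fun i => conj (ζ i)) ⬝ᵥ (complexHessian φ x).mulVec (fun i => conj (ζ i))
        = levi (fun y => (φ y : ℂ)) x ζ := by
      simp only [dotProduct, Matrix.mulVec, levi, complexHessian, Matrix.of_apply, Pi.star_apply,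
        Finset.mul_sum]
      refine Finset.sum_congr rfl fun j _ => Finset.sum_congr rfl fun k _ => ?_
      simp
      ring
    rw [e] at this
    exact (Complex.pos_iff.1 this).1
  obtain ⟨c, hc0, hc⟩ := ((isCompact_closedBall (0 : Cn n) r).prod
    (isCompact_sphere (0 : Cn n) 1)).exists_forall_le' hcont hp
  refine ⟨c, hc0, fun x hx ζ => ?_⟩
  set z : Cn n := WithLp.toLp 2 ζ with hz
  have hnz : ‖z‖ ^ 2 = ∑ j, ‖ζ j‖ ^ 2 := by rw [EuclideanSpace.norm_sq_eq]
  rw [← hnz]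
  rcases eq_or_ne z 0 with h0 | h0
  · have : ζ = 0 := by
      funext i
      exact congrArg (fun w : Cn n => w i) h0
    simp [h0, this, levi]
  · have hn : 0 < ‖z‖ := norm_pos_iff.2 h0
    have h1 := hc (x, ‖z‖⁻¹ • z) ⟨hx, by simp [norm_smul, hn.ne']⟩
    have h2 : levi (fun y => (φ y : ℂ)) x (‖z‖⁻¹ • z : Cn n)
        = ((‖z‖⁻¹ ^ 2 : ℝ) : ℂ) * levi (fun y => (φ y : ℂ)) x ζ := by
      rw [← levi_smul]
      rfl
    simp only [h2, Complex.re_ofReal_mul] at h1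
    rw [inv_pow, inv_mul_eq_div, le_div_iff₀ (by positivity)] at h1
    exact h1

/-- A Kähler potential on a large ball agrees on a smaller one with a strictly plurisubharmonic
function on all of `ℂⁿ`. -/
theorem exists_extension (hφ : ∀ x ∈ Metric.ball (0 : Cn n) 3, ContDiffAt ℝ ∞ φ x)
    (hpos : IsKahlerPotential φ (Metric.ball 0 3)) :
    ∃ (Φ : Cn n → ℝ) (c : ℝ), 0 < c ∧ ContDiff ℝ ∞ Φ ∧ LeviBound Φ c ∧
      ∀ x ∈ Metric.closedBall (0 : Cn n) 1, Φ x = φ x := by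
  -- Chosen with `1 < R` and `2R < 3`: the cut-off potential is `φ` up to radius `R` and vanishes
  -- from radius `2R` on, and the convex correction starts at radius `1`, so it is uniformly
  -- positive from radius `R` on.
  set R : ℝ := 5 / 4 with hR
  have hR0 : 0 < R := by norm_num [hR]
  have hone : ∀ x : Cn n, ‖x‖ ≤ R → stdCutoff (R⁻¹ • x) = 1 := fun x hx => by
    refine stdCutoff_eq_one ?_
    rw [norm_smul, norm_inv, Real.norm_of_nonneg hR0.le, inv_mul_eq_div, div_le_one hR0]
    exact hx
  have hzero : ∀ x : Cn n, 2 * R ≤ ‖x‖ → stdCutoff (R⁻¹ • x) = 0 := fun x hx => by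
    refine stdCutoff_eq_zero ?_
    rw [norm_smul, norm_inv, Real.norm_of_nonneg hR0.le, inv_mul_eq_div, le_div_iff₀ hR0]
    exact hx
  set f : Cn n → ℝ := fun x => stdCutoff (R⁻¹ • x) * φ x with hf
  have hfs : ContDiff ℝ ∞ f := by
    rw [contDiff_iff_contDiffAt]
    intro x
    rcases lt_or_ge ‖x‖ 3 with h | h
    · exact (contDiff_stdCutoff.comp (contDiff_const_smul _)).contDiffAt.mul
        (hφ x (by simpa using h))
    · have : f =ᶠ[𝓝 x] fun _ => 0 := by
        have hm : {y : Cn n | 2 * R < ‖y‖} ∈ 𝓝 x :=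
          (isOpen_lt continuous_const continuous_norm).mem_nhds (by
            simp only [Set.mem_ofPred_eq, hR]; linarith)
        filter_upwards [hm] with y hy
        simp [hf, hzero y (le_of_lt hy)]
      exact contDiffAt_const.congr_of_eventuallyEq this
  have hft : IsTest fun x => (f x : ℂ) := by
    refine ⟨contDiff_ofReal hfs, HasCompactSupport.of_support_subset_isCompact
      (isCompact_closedBall 0 (2 * R)) fun x hx => ?_⟩
    by_contra h
    rw [mem_closedBall_zero_iff, not_le] at h
    exact hx (by simp [hf, hzero x h.le])
  obtain ⟨B, hB0, hB⟩ := exists_norm_levi_le hft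
  obtain ⟨c, hc0, hc⟩ := exists_pos_le_levi hφ hpos (r := R) (by norm_num [hR])
  -- Here `9/16 = R² - 1`, so `e` bounds the Levi form of the correction from below for `‖x‖ ≥ R`.
  set e : ℝ := expNegInvGlue (9 / 16) with he
  have he0 : 0 < e := expNegInvGlue.pos_of_pos (by norm_num)
  -- Outside radius `R` the correction contributes at least `M e = B + 1`. This outweighs the
  -- possible `-B` of the cut-off region and leaves `1`.
  set M : ℝ := (B + 1) / e with hM
  have hM0 : 0 ≤ M := by positivity
  refine ⟨fun x => f x + M * convexGlue (‖x‖ ^ 2), min c 1, by positivity, ?_, ?_, ?_⟩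
  · exact hfs.add (contDiff_const.mul contDiff_convexGlue_norm_sq)
  · intro x ζ
    change _ ≤ (levi _ x ζ).re
    have hG := contDiff_ofReal (contDiff_convexGlue_norm_sq (n := n))
    have e1 : levi (fun y => ((f y + M * convexGlue (‖y‖ ^ 2) : ℝ) : ℂ)) x ζ
        = levi (fun y => (f y : ℂ)) x ζ
          + (M : ℂ) * levi (fun y => (convexGlue (‖y‖ ^ 2) : ℂ)) x ζ := by
      rw [← levi_const_mul _ hG, ← levi_add hft.smooth (contDiff_const.mul hG)]
      push_cast
      rfl
    rw [e1, Complex.add_re, Complex.re_ofReal_mul]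
    have hGx := le_levi_convexGlue x ζ
    have hS : 0 ≤ ∑ j, ‖ζ j‖ ^ 2 := by positivity
    have hmin : min c 1 * ∑ j, ‖ζ j‖ ^ 2 ≤ c * ∑ j, ‖ζ j‖ ^ 2 := by gcongr; exact min_le_left _ _
    have hmin' : min c 1 * ∑ j, ‖ζ j‖ ^ 2 ≤ 1 * ∑ j, ‖ζ j‖ ^ 2 := by
      gcongr; exact min_le_right _ _
    rcases lt_or_ge ‖x‖ R with h | h
    · have h1 : levi (fun y => (f y : ℂ)) x ζ = levi (fun y => (φ y : ℂ)) x ζ := by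
        refine levi_congr ?_ ζ
        filter_upwards [(isOpen_lt continuous_norm continuous_const).mem_nhds h] with y hy
        simp [hf, hone y (le_of_lt hy)]
      rw [h1]
      have h2 := hc x (by simpa using h.le) ζ
      have h3 : 0 ≤ (levi (fun y => (convexGlue (‖y‖ ^ 2) : ℂ)) x ζ).re :=
        (mul_nonneg (expNegInvGlue.nonneg _) hS).trans hGx
      have := mul_nonneg hM0 h3
      linarith
    · have h1 : -(B * ∑ j, ‖ζ j‖ ^ 2) ≤ (levi (fun y => (f y : ℂ)) x ζ).re :=
        (neg_le_neg (hB x ζ)).trans (neg_le_of_abs_le (Complex.abs_re_le_norm _))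
      have h2 : e ≤ expNegInvGlue (‖x‖ ^ 2 - 1) := expNegInvGlue.monotone (by
        rw [hR] at h; nlinarith)
      have h3 : (B + 1) * ∑ j, ‖ζ j‖ ^ 2
          ≤ M * (levi (fun y => (convexGlue (‖y‖ ^ 2) : ℂ)) x ζ).re := by
        calc (B + 1) * ∑ j, ‖ζ j‖ ^ 2 = M * (e * ∑ j, ‖ζ j‖ ^ 2) := by
              rw [hM]; field_simp
          _ ≤ M * (expNegInvGlue (‖x‖ ^ 2 - 1) * ∑ j, ‖ζ j‖ ^ 2) := by gcongr
          _ ≤ _ := by gcongr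
      linarith
  · intro x hx
    rw [mem_closedBall_zero_iff] at hx
    simp only [hf]
    rw [hone x (hx.trans (by norm_num [hR])), convexGlue_eq_zero (by positivity)
      (by nlinarith [norm_nonneg x])]
    ring

/-- Twisting the weight by `t|z|²` costs only `t` of the curvature `kc`, so `t` of order `√k` is
affordable. -/
lemma LeviBound.sub_norm_sq {Φ : Cn n → ℝ} {c : ℝ} (hΦ : ContDiff ℝ ∞ Φ) (hc : LeviBound Φ c)
    {k : ℝ} (hk : 0 ≤ k) (t : ℝ) : LeviBound (fun x => k * Φ x - t * ‖x‖ ^ 2) (k * c - t) := by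
  intro x ζ
  change _ ≤ (levi _ x ζ).re
  have h1 := contDiff_ofReal hΦ
  have h2 : ContDiff ℝ ∞ fun y : Cn n => ((‖y‖ ^ 2 : ℝ) : ℂ) := contDiff_ofReal (contDiff_norm_sq ℝ)
  have e1 : levi (fun y => ((k * Φ y - t * ‖y‖ ^ 2 : ℝ) : ℂ)) x ζ
      = (k : ℂ) * levi (fun y => (Φ y : ℂ)) x ζ
        + ((-t : ℝ) : ℂ) * levi (fun y => ((‖y‖ ^ 2 : ℝ) : ℂ)) x ζ := by
    rw [← levi_const_mul _ h1, ← levi_const_mul _ h2,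
      ← levi_add (contDiff_const.mul h1) (contDiff_const.mul h2)]
    push_cast
    simp only [sub_eq_add_neg, neg_mul]
  rw [e1, Complex.add_re, Complex.re_ofReal_mul, Complex.re_ofReal_mul, levi_norm_sq,
    Complex.ofReal_re]
  have := mul_le_mul_of_nonneg_left (hc x ζ) hk
  change _ ≤ k * (levi _ x ζ).re at this
  linarith

/-- The density of `ωⁿ / n!` against Lebesgue measure. -/
def kahlerDensity (φ : Cn n → ℝ) (x : Cn n) : ℝ := (complexHessian φ x).det.re

lemma kahlerDensity_pos {V : Set (Cn n)} (hpos : IsKahlerPotential φ V) {x : Cn n} (hx : x ∈ V) :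
    0 < kahlerDensity φ x :=
  (Complex.pos_iff.1 (hpos x hx).det_pos).1

lemma contDiffAt_kahlerDensity {x : Cn n} (hφ : ContDiffAt ℝ ∞ φ x) :
    ContDiffAt ℝ ∞ (kahlerDensity φ) x := by
  have h1 : ContDiffAt ℝ ∞ (fun y => (φ y : ℂ)) x :=
    Complex.ofRealCLM.contDiff.contDiffAt.comp x hφ
  have : ContDiffAt ℝ ∞ (fun y => (complexHessian φ y).det) x := by
    simp only [Matrix.det_apply]
    refine ContDiffAt.sum fun σ _ => ContDiffAt.const_smul _ ?_
    exact contDiffAt_prod fun i _ => contDiffAt_dz_dzbar h1 _ _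
  exact Complex.reCLM.contDiff.contDiffAt.comp x this

end extension

/-! ### Pointwise bounds and exponential decay. -/

lemma finrank_real_Cn : Module.finrank ℝ (Cn n) = 2 * n := by
  rw [finrank_real_of_complex, finrank_euclideanSpace_fin]

/-- The sub-mean-value estimate for holomorphic functions, at the scale `1 / k` on which a weight
`e^{-kΦ}` is nearly constant. -/
theorem exists_norm_sq_le {Φ : Cn n → ℝ} (hΦ : ContDiff ℝ ∞ Φ) :
    ∃ C > 0, ∀ k : ℕ, 1 ≤ k → ∀ u : Cn n → ℂ, DifferentiableOn ℂ u (unitBall n) →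
      IntegrableOn (fun y => ‖u y‖ ^ 2 * Real.exp (-(k * Φ y))) (unitBall n) →
      ∀ x ∈ Metric.ball (0 : Cn n) (1 / 4), ‖u x‖ ^ 2 ≤ C * ((k : ℝ) ^ n) ^ 2 * Real.exp (k * Φ x) *
        ∫ y in Metric.ball (0 : Cn n) (1 / 3), ‖u y‖ ^ 2 * Real.exp (-(k * Φ y)) := by
  obtain ⟨A, hA0, hA⟩ := exists_mollifier_le (n := n)
  obtain ⟨L, hL⟩ := (isCompact_closedBall (0 : Cn n) 1).exists_bound_of_continuousOn
    (hΦ.continuous_fderiv (by simp)).continuousOn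
  have hL0 : 0 ≤ L := (norm_nonneg _).trans (hL 0 (by simp))
  have hlip : ∀ x ∈ Metric.closedBall (0 : Cn n) 1, ∀ y ∈ Metric.closedBall (0 : Cn n) 1,
      ‖Φ y - Φ x‖ ≤ L * ‖y - x‖ := fun x hx y hy =>
    (convex_closedBall (0 : Cn n) 1).norm_image_sub_le_of_norm_fderiv_le
      (fun z _ => hΦ.differentiable (by simp) z) hL hx hy
  refine ⟨A * 24 ^ (2 * n) * Real.exp L, by positivity, fun k hk u hu hui x hx => ?_⟩
  have hk1 : (1 : ℝ) ≤ k := by exact_mod_cast hk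
  have hk0 : (0 : ℝ) < k := by linarith
  rw [mem_ball_zero_iff] at hx
  -- At this scale `kΦ` varies by at most `L / 24`, and the mollifier is bounded by a constant times
  -- `k^{2n}`. Also `ε < 1/12`, which keeps the ball around `x` inside `B(0, 1/3)`.
  set ε : ℝ := 1 / (24 * k) with hε
  have hε0 : 0 < ε := by positivity
  have hε1 : ε ≤ 1 / 24 := by
    rw [hε]; exact one_div_le_one_div_of_le (by norm_num) (by linarith)
  have hsub : Metric.ball x (1 / 12) ⊆ Metric.ball (0 : Cn n) (1 / 3) :=
    Metric.ball_subset_ball' (by rw [dist_zero_right]; linarith)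
  have hsub' : Metric.ball (0 : Cn n) (1 / 3) ⊆ unitBall n := Metric.ball_subset_ball (by norm_num)
  have h1 := norm_sq_le_integral_mollifier (r := 1 / 12) hε0 (by linarith)
    (hu.mono (hsub.trans hsub'))
  refine h1.trans ?_
  have e1 : ∫ h, mollifier ε h * ‖u (x - h)‖ ^ 2 = ∫ y, mollifier ε (x - y) * ‖u y‖ ^ 2 := by
    rw [← integral_sub_left_eq_self (fun y => mollifier ε (x - y) * ‖u y‖ ^ 2) volume x]
    simp
  rw [e1, ← integral_const_mul, ← integral_indicator Metric.isOpen_ball.measurableSet]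
  refine integral_mono_of_nonneg
    (.of_forall fun y => mul_nonneg (mollifier_nonneg hε0 _) (by positivity)) ?_ (.of_forall ?_)
  · rw [integrable_indicator_iff Metric.isOpen_ball.measurableSet]
    exact (hui.mono_set hsub').const_mul _
  · intro y
    by_cases hy : ‖x - y‖ < ε
    · have hy3 : y ∈ Metric.ball (0 : Cn n) (1 / 3) := hsub (by
        rw [Metric.mem_ball, dist_comm, dist_eq_norm]; linarith)
      have hyx := hlip y (Metric.ball_subset_closedBall (hsub' hy3)) x (by
        rw [mem_closedBall_zero_iff]; linarith)
      have h2 : k * Φ y ≤ k * Φ x + L := by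
        have h3 : Φ y - Φ x ≤ L * ε := by
          have := (abs_le.1 hyx).1
          nlinarith
        have h4 : k * (Φ y - Φ x) ≤ k * (L * ε) := by gcongr
        have h5 : k * (L * ε) = L / 24 := by rw [hε]; field_simp
        linarith
      rw [Set.indicator_of_mem hy3]
      have h6 : mollifier ε (x - y) ≤ A * 24 ^ (2 * n) * ((k : ℝ) ^ n) ^ 2 := by
        refine (hA ε hε0 _).trans_eq ?_
        rw [finrank_real_Cn, hε, one_div, inv_pow, div_inv_eq_mul, mul_pow, ← pow_mul, mul_comm n 2,
          mul_assoc]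
      have h7 : 1 ≤ Real.exp L * Real.exp (k * Φ x) * Real.exp (-(k * Φ y)) := by
        rw [← Real.exp_add, ← Real.exp_add]
        exact Real.one_le_exp (by linarith)
      calc mollifier ε (x - y) * ‖u y‖ ^ 2
          ≤ (A * 24 ^ (2 * n) * ((k : ℝ) ^ n) ^ 2) * ‖u y‖ ^ 2 * 1 := by
            rw [mul_one]; gcongr
        _ ≤ (A * 24 ^ (2 * n) * ((k : ℝ) ^ n) ^ 2) * ‖u y‖ ^ 2
            * (Real.exp L * Real.exp (k * Φ x) * Real.exp (-(k * Φ y))) := by gcongr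
        _ = _ := by ring
    · simp only [mollifier_eq_zero hε0 (not_lt.1 hy), zero_mul]
      exact Set.indicator_nonneg (fun z _ => by positivity) y

/-- The bounds on a cut-off function that the decay estimate depends on. -/
lemma exists_dzbar_bound {m : Cn n → ℝ} (hm : IsTest fun y => (m y : ℂ)) {δ : ℝ} (hδ : 0 < δ)
    (hmδ : ∀ x ∈ Metric.ball (0 : Cn n) (1 / 2), δ ≤ m x) :
    ∃ A B : ℝ, 0 ≤ A ∧ 0 ≤ B ∧ ∀ x, ∑ j, ‖dzbar j (fun y => (m y : ℂ)) x‖ ^ 2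
      ≤ (Metric.ball (0 : Cn n) (1 / 2))ᶜ.indicator (fun _ => A) x + B * m x ^ 2 := by
  have hB : ∀ j : Fin n, ∃ B, ∀ x, ‖dzbar j (fun y => (m y : ℂ)) x‖ ≤ B := fun j =>
    (hm.dzbar j).smooth.continuous.bounded_above_of_compact_support (hm.dzbar j).compact
  choose b hb using hB
  have hA : ∀ x, ∑ j, ‖dzbar j (fun y => (m y : ℂ)) x‖ ^ 2 ≤ ∑ j, b j ^ 2 := fun x =>
    Finset.sum_le_sum fun j _ => pow_le_pow_left₀ (norm_nonneg _) (hb j x) 2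
  have hA0 : 0 ≤ ∑ j, b j ^ 2 := by positivity
  -- Where `m ≥ δ`, a bounded quantity is at most a constant times `m²`; elsewhere the constant
  -- itself is kept.
  refine ⟨∑ j, b j ^ 2, (∑ j, b j ^ 2) / δ ^ 2, hA0, by positivity, fun x => (hA x).trans ?_⟩
  by_cases hx : x ∈ Metric.ball (0 : Cn n) (1 / 2)
  · rw [Set.indicator_of_notMem (by simpa using hx), zero_add, div_mul_eq_mul_div,
      le_div_iff₀ (by positivity)]
    have := hmδ x hx
    gcongr
  · rw [Set.indicator_of_mem hx]
    have : 0 ≤ (∑ j, b j ^ 2) / δ ^ 2 * m x ^ 2 := by positivity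
    linarith

/-- A holomorphic function `u` on the unit ball with `m u` orthogonal to all holomorphic functions
is small near the origin: the weight `e^{-kΦ + t|z|²}` still has a spectral gap. -/
theorem integral_le_of_perp {Φ m : Cn n → ℝ} {c k t A B δ : ℝ} (hΦ : ContDiff ℝ ∞ Φ)
    (hc : LeviBound Φ c) (hk : 0 ≤ k) (ht : 0 ≤ t)
    (hm : ContDiff ℝ ∞ m) (hm0 : ∀ x ∉ Metric.ball (0 : Cn n) (3 / 4), m x = 0)
    (hδ : 0 < δ) (hmδ : ∀ x ∈ Metric.ball (0 : Cn n) (1 / 2), δ ≤ m x) (hA : 0 ≤ A) (hB : 0 ≤ B)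
    (hAB : ∀ x, ∑ j, ‖dzbar j (fun y => (m y : ℂ)) x‖ ^ 2
      ≤ (Metric.ball (0 : Cn n) (1 / 2))ᶜ.indicator (fun _ => A) x + B * m x ^ 2)
    (hgap : 0 < k * c - t) (hgap' : 2 * (B + t ^ 2) ≤ k * c - t)
    {u : Cn n → ℂ} (hu : DifferentiableOn ℂ u (unitBall n))
    (hui : IntegrableOn (fun y => ‖u y‖ ^ 2 * Real.exp (-(k * Φ y))) (unitBall n))
    (hperp : ∀ F : Cn n → ℂ, DifferentiableOn ℂ F (unitBall n) →
      IntegrableOn (fun y => ‖F y‖ ^ 2 * Real.exp (-(k * Φ y))) (unitBall n) →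
      ∫ y in unitBall n, (m y : ℂ) * u y * conj (F y) * (Real.exp (-(k * Φ y)) : ℂ) = 0) :
    (k * c - t - 2 * (B + t ^ 2)) * (δ ^ 2 * (Real.exp (-(t / 9)) *
        ∫ y in Metric.ball (0 : Cn n) (1 / 3), ‖u y‖ ^ 2 * Real.exp (-(k * Φ y))))
      ≤ 2 * A * Real.exp (-(t / 4)) *
        ∫ y in unitBall n, ‖u y‖ ^ 2 * Real.exp (-(k * Φ y)) := by
  set θ : Cn n → ℝ := fun y => t * ‖y‖ ^ 2 with hθ
  have hθs : ContDiff ℝ ∞ θ := contDiff_const.mul (contDiff_norm_sq ℝ)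
  have hUo : IsOpen (unitBall n) := Metric.isOpen_ball
  have hUm : MeasurableSet (unitBall n) := hUo.measurableSet
  have hEs := contDiff_expWeight hθs
  have hms := contDiff_ofReal hm
  have hmU : ∀ y ∉ unitBall n, m y = 0 := fun y hy =>
    hm0 y fun h => hy (Metric.ball_subset_ball (by norm_num) h)
  have hus : ∀ y ∈ unitBall n, ContDiffAt ℝ ∞ u y := fun y hy =>
    contDiffAt_of_differentiableOn hUo hy hu
  set w : Cn n → ℂ := fun y => (m y : ℂ) * expWeight θ y * u y with hw
  have hsupp : tsupport w ⊆ Metric.closedBall 0 (3 / 4) := by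
    refine closure_minimal (fun y hy => ?_) Metric.isClosed_closedBall
    by_contra h
    exact hy (by simp [hw, hm0 y fun h' => h (Metric.ball_subset_closedBall h')])
  have hwU : tsupport w ⊆ unitBall n :=
    hsupp.trans (Metric.closedBall_subset_ball (by norm_num))
  have hwt : IsTest w := by
    refine ⟨contDiff_iff_contDiffAt.2 fun x => ?_,
      (isCompact_closedBall (0 : Cn n) (3 / 4)).of_isClosed_subset (isClosed_tsupport _) hsupp⟩
    by_cases hx : x ∈ unitBall n
    · exact (hms.mul hEs).contDiffAt.mul (hus x hx)
    · exact contDiffAt_const.congr_of_eventuallyEq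
        (notMem_tsupport_iff_eventuallyEq.1 fun h => hx (hwU h))
  set ψ : Cn n → ℝ := fun y => k * Φ y - t * ‖y‖ ^ 2 with hψ
  have hψs : ContDiff ℝ ∞ ψ := (contDiff_const.mul hΦ).sub hθs
  have hexp : ∀ y, Real.exp (-ψ y) = Real.exp (-(k * Φ y)) * Real.exp (θ y) := fun y => by
    rw [← Real.exp_add]; congr 1; simp only [hψ, hθ]; ring
  have hEE : ∀ y, Real.exp (-θ y) * Real.exp (θ y) = 1 := fun y => by
    rw [← Real.exp_add]; simp
  have hθ0 : ∀ y, 0 ≤ θ y := fun y => by positivity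
  -- Because `e^{-θ} e^{-ψ} = e^{-kΦ}`, pairing `w` in the weight `ψ` is pairing `m u` in the weight
  -- `kΦ`. Since `e^θ ≥ 1`, a finite `ψ`-norm implies a finite `kΦ`-norm.
  have hgapI := (hc.sub_norm_sq hΦ hk t).spectral_gap hψs hgap hwt hwU (by
    intro F hF hFi
    have hFi' : IntegrableOn (fun y => ‖F y‖ ^ 2 * Real.exp (-(k * Φ y))) (unitBall n) := by
      refine Integrable.mono' hFi ?_ (.of_forall fun y => ?_)
      · exact ((hF.continuousOn.norm.pow 2).mul (Real.continuous_exp.comp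
          (continuous_const.mul hΦ.continuous).neg).continuousOn).aestronglyMeasurable hUm
      · rw [Real.norm_of_nonneg (by positivity)]
        rw [hexp y, ← mul_assoc]
        exact le_mul_of_one_le_right (by positivity) (Real.one_le_exp (hθ0 y))
    rw [← hperp F hF hFi', ← integral_indicator hUm]
    refine integral_congr_ae (.of_forall fun y => ?_)
    change w y * conj (F y) * expWeight ψ y = _
    by_cases hy : y ∈ unitBall n
    · rw [Set.indicator_of_mem hy]
      have : expWeight θ y * expWeight ψ y = (Real.exp (-(k * Φ y)) : ℂ) := by
        simp only [expWeight]
        rw [hexp, ← Complex.ofReal_mul, mul_left_comm, hEE, mul_one]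
      rw [← this]; simp only [hw]; ring
    · simp [hw, hmU y hy, Set.indicator_of_notMem hy])
  set N : Cn n → ℝ := (unitBall n).indicator fun y => ‖u y‖ ^ 2 * Real.exp (-(k * Φ y)) with hN
  have hNi : Integrable N := (integrable_indicator_iff hUm).2 hui
  have hN0 : ∀ y, 0 ≤ N y := fun y => Set.indicator_nonneg (fun z _ => by positivity) y
  have hNU : ∀ y ∈ unitBall n, N y = ‖u y‖ ^ 2 * Real.exp (-(k * Φ y)) := fun y hy =>
    Set.indicator_of_mem hy _
  -- This is `‖w‖² e^{-ψ}`: two factors `e^{-θ}` from `w` against one `e^θ` from the weight.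
  set J : Cn n → ℝ := fun y => m y ^ 2 * Real.exp (-θ y) * N y with hJ
  have hJ0 : ∀ y, 0 ≤ J y := fun y => mul_nonneg (by positivity) (hN0 y)
  have hmc : HasCompactSupport m := by
    refine HasCompactSupport.of_support_subset_isCompact (isCompact_closedBall 0 (3 / 4))
      fun y hy => ?_
    by_contra h
    exact hy (hm0 y fun h' => h (Metric.ball_subset_closedBall h'))
  obtain ⟨b, hb⟩ := hm.continuous.bounded_above_of_compact_support hmc
  have hJi : Integrable J := by
    refine Integrable.mono' (hNi.const_mul (b ^ 2)) ?_ (.of_forall fun y => ?_)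
    · exact (((hm.continuous.pow 2).mul (Real.continuous_exp.comp
        hθs.continuous.neg)).aestronglyMeasurable).mul hNi.aestronglyMeasurable
    · rw [Real.norm_of_nonneg (hJ0 y)]
      have h1 : m y ^ 2 ≤ b ^ 2 := by
        rw [← sq_abs]; exact pow_le_pow_left₀ (abs_nonneg _) (hb y) 2
      have h2 : Real.exp (-θ y) ≤ 1 := Real.exp_le_one_iff.2 (by linarith [hθ0 y])
      have h3 : m y ^ 2 * Real.exp (-θ y) ≤ b ^ 2 * 1 :=
        mul_le_mul h1 h2 (by positivity) (by positivity)
      rw [mul_one] at h3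
      exact mul_le_mul_of_nonneg_right h3 (hN0 y)
  have hnE : ∀ y, ‖expWeight θ y‖ = Real.exp (-θ y) := fun y => by
    rw [expWeight, Complex.norm_real, Real.norm_of_nonneg (by positivity)]
  have e1 : ∀ y, ‖w y‖ ^ 2 * Real.exp (-ψ y) = J y := by
    intro y
    by_cases hy : y ∈ unitBall n
    · simp only [hw, hJ, hNU y hy, norm_mul, mul_pow, hnE, Complex.norm_real, Real.norm_eq_abs,
        sq_abs, hexp]
      linear_combination (m y ^ 2 * ‖u y‖ ^ 2 * Real.exp (-θ y) * Real.exp (-(k * Φ y))) * hEE y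
    · simp [hw, hJ, hmU y hy]
  have hdw : ∀ y ∈ unitBall n, ∀ j, dzbar j w y
      = (dzbar j (fun y => (m y : ℂ)) y - t * y j * m y) * expWeight θ y * u y := by
    intro y hy j
    have d1 : DifferentiableAt ℝ (fun y => (m y : ℂ)) y := hms.differentiable (by simp) y
    have d2 : DifferentiableAt ℝ (expWeight θ) y := hEs.differentiable (by simp) y
    have d3 : DifferentiableAt ℝ u y := (hus y hy).differentiableAt (by simp)
    have d4 : dzbar j u y = 0 := dzbar_eq_zero_of_differentiableAt j
      (hu.differentiableAt (hUo.mem_nhds hy))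
    have d5 : wirt Complex.I j (fun y => (θ y : ℂ)) y = t * y j := by
      have : (fun y => (θ y : ℂ)) = fun y => (t : ℂ) * ((‖y‖ ^ 2 : ℝ) : ℂ) := by
        funext z; simp only [hθ]; push_cast; rfl
      rw [this, wirt_const_mul _ ((contDiff_ofReal (contDiff_norm_sq ℝ)).differentiable
        (n := ∞) (by simp) y), ← dzbar_eq_wirt, dzbar_norm_sq]
    rw [dzbar_eq_wirt] at d4 ⊢
    simp only [hw]
    rw [wirt_mul (d1.fun_mul d2) d3, d4, wirt_mul d1 d2, wirt_expWeight hθs, d5, dzbar_eq_wirt]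
    ring
  -- Where `|y| ≥ 1/2` one has `e^{-θ} ≤ e^{-t/4}`, which handles the `A` part of `∂̄m`. The `B`
  -- part and the `t²` from `∂̄θ` are multiples of `J`, to be absorbed in the left side.
  have e2 : ∀ y, (∑ j, ‖dzbar j w y‖ ^ 2) * Real.exp (-ψ y)
      ≤ 2 * A * Real.exp (-(t / 4)) * N y + 2 * (B + t ^ 2) * J y := by
    intro y
    by_cases hy : y ∈ unitBall n
    · have hy1 : ‖y‖ ^ 2 ≤ 1 := by
        have : ‖y‖ < 1 := by simpa [unitBall] using hy
        nlinarith [norm_nonneg y]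
      have s1 : ∑ j, ‖dzbar j (fun y => (m y : ℂ)) y - t * y j * m y‖ ^ 2
          ≤ 2 * ((Metric.ball (0 : Cn n) (1 / 2))ᶜ.indicator (fun _ => A) y
            + (B + t ^ 2) * m y ^ 2) := by
        have s2 : ∀ j, ‖dzbar j (fun y => (m y : ℂ)) y - t * y j * m y‖ ^ 2
            ≤ 2 * ‖dzbar j (fun y => (m y : ℂ)) y‖ ^ 2 + 2 * t ^ 2 * m y ^ 2 * ‖y j‖ ^ 2 := by
          intro j
          have s3 := norm_sub_le (dzbar j (fun y => (m y : ℂ)) y) (t * y j * m y)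
          have s4 : ‖(t * y j * m y : ℂ)‖ ^ 2 = t ^ 2 * m y ^ 2 * ‖y j‖ ^ 2 := by
            simp only [norm_mul, Complex.norm_real, Real.norm_eq_abs, mul_pow, sq_abs]; ring
          have s5 := pow_le_pow_left₀ (norm_nonneg _) s3 2
          nlinarith [sq_nonneg (‖dzbar j (fun y => (m y : ℂ)) y‖ - ‖(t * y j * m y : ℂ)‖)]
        refine (Finset.sum_le_sum fun j _ => s2 j).trans ?_
        rw [Finset.sum_add_distrib, ← Finset.mul_sum, ← Finset.mul_sum, ← EuclideanSpace.norm_sq_eq]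
        have s6 := hAB y
        have s7 : 2 * t ^ 2 * m y ^ 2 * ‖y‖ ^ 2 ≤ 2 * t ^ 2 * m y ^ 2 :=
          mul_le_of_le_one_right (by positivity) hy1
        linarith
      have s8 : (∑ j, ‖dzbar j w y‖ ^ 2) * Real.exp (-ψ y)
          = (∑ j, ‖dzbar j (fun y => (m y : ℂ)) y - t * y j * m y‖ ^ 2)
            * (Real.exp (-θ y) * N y) := by
        rw [Finset.sum_mul, Finset.sum_mul]
        refine Finset.sum_congr rfl fun j _ => ?_
        simp only [hdw y hy, norm_mul, mul_pow, hnE, hexp, hNU y hy]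
        linear_combination (‖dzbar j (fun y => (m y : ℂ)) y - t * y j * m y‖ ^ 2
          * ‖u y‖ ^ 2 * Real.exp (-θ y) * Real.exp (-(k * Φ y))) * hEE y
      have s9 : (Metric.ball (0 : Cn n) (1 / 2))ᶜ.indicator (fun _ => A) y * Real.exp (-θ y)
          ≤ A * Real.exp (-(t / 4)) := by
        by_cases hy2 : y ∈ Metric.ball (0 : Cn n) (1 / 2)
        · rw [Set.indicator_of_notMem (by simpa using hy2), zero_mul]; positivity
        · rw [Set.indicator_of_mem hy2]
          rw [mem_ball_zero_iff, not_lt] at hy2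
          have : t / 4 ≤ θ y := by simp only [hθ]; nlinarith [mul_self_le_mul_self (by norm_num) hy2]
          gcongr
      rw [s8]
      calc _ ≤ 2 * ((Metric.ball (0 : Cn n) (1 / 2))ᶜ.indicator (fun _ => A) y
            + (B + t ^ 2) * m y ^ 2) * (Real.exp (-θ y) * N y) :=
            mul_le_mul_of_nonneg_right s1 (mul_nonneg (by positivity) (hN0 y))
        _ = 2 * ((Metric.ball (0 : Cn n) (1 / 2))ᶜ.indicator (fun _ => A) y * Real.exp (-θ y)) * N y
            + 2 * (B + t ^ 2) * J y := by simp only [hJ]; ring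
        _ ≤ 2 * (A * Real.exp (-(t / 4))) * N y + 2 * (B + t ^ 2) * J y := by
            have := mul_le_mul_of_nonneg_right s9 (hN0 y)
            linarith
        _ = _ := by ring
    · have : ∀ j, dzbar j w y = 0 := fun j =>
        wirt_eq_zero_of_notMem_tsupport fun h => hy (hwU h)
      simp only [this]
      have h1 := hN0 y
      have h2 := hJ0 y
      simp
      positivity
  have hI : (k * c - t) * ∫ y, J y
      ≤ 2 * A * Real.exp (-(t / 4)) * (∫ y, N y) + 2 * (B + t ^ 2) * ∫ y, J y := by
    change (k * c - t) * (∫ y, ‖w y‖ ^ 2 * Real.exp (-ψ y))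
      ≤ ∫ y, (∑ j, ‖dzbar j w y‖ ^ 2) * Real.exp (-ψ y) at hgapI
    simp only [e1] at hgapI
    refine hgapI.trans ?_
    rw [← integral_const_mul, ← integral_const_mul,
      ← integral_add (hNi.const_mul _) (hJi.const_mul _)]
    exact integral_mono_of_nonneg (.of_forall fun y => by positivity)
      ((hNi.const_mul _).add (hJi.const_mul _)) (.of_forall e2)
  have hlow : δ ^ 2 * (Real.exp (-(t / 9)) *
      ∫ y in Metric.ball (0 : Cn n) (1 / 3), ‖u y‖ ^ 2 * Real.exp (-(k * Φ y))) ≤ ∫ y, J y := by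
    rw [← integral_const_mul, ← integral_const_mul,
      ← integral_indicator Metric.isOpen_ball.measurableSet]
    refine integral_mono_of_nonneg
      (.of_forall fun y => Set.indicator_nonneg (fun z _ => by positivity) y) hJi
      (.of_forall fun y => ?_)
    by_cases hy : y ∈ Metric.ball (0 : Cn n) (1 / 3)
    · rw [Set.indicator_of_mem hy]
      have h1 := hmδ y (Metric.ball_subset_ball (by norm_num) hy)
      have hyU : y ∈ unitBall n := Metric.ball_subset_ball (by norm_num) hy
      rw [mem_ball_zero_iff] at hy
      have h2 : θ y ≤ t / 9 := by
        have : ‖y‖ ^ 2 ≤ 1 / 9 := by nlinarith [norm_nonneg y]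
        simp only [hθ]; nlinarith
      simp only [hJ, hNU y hyU]
      rw [← mul_assoc]
      gcongr
    · rw [Set.indicator_of_notMem hy]
      exact hJ0 y
  have hNN : ∫ y, N y = ∫ y in unitBall n, ‖u y‖ ^ 2 * Real.exp (-(k * Φ y)) :=
    integral_indicator hUm
  rw [← hNN]
  calc _ ≤ (k * c - t - 2 * (B + t ^ 2)) * ∫ y, J y :=
        mul_le_mul_of_nonneg_left hlow (by linarith)
    _ ≤ _ := by linarith

/-- The a priori estimate: point evaluations are exponentially small on the functions `u` for
which `m u` is orthogonal to all holomorphic functions. -/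
theorem exists_norm_sq_le_of_perp {Φ m : Cn n → ℝ} {c δ : ℝ} (hΦ : ContDiff ℝ ∞ Φ) (hc0 : 0 < c)
    (hc : LeviBound Φ c)
    (hm : ContDiff ℝ ∞ m) (hm0 : ∀ x ∉ Metric.ball (0 : Cn n) (3 / 4), m x = 0)
    (hδ : 0 < δ) (hmδ : ∀ x ∈ Metric.ball (0 : Cn n) (1 / 2), δ ≤ m x) :
    ∃ C > 0, ∃ s > 0, ∀ k : ℕ, 1 ≤ k → ∀ u : Cn n → ℂ, DifferentiableOn ℂ u (unitBall n) →
      IntegrableOn (fun y => ‖u y‖ ^ 2 * Real.exp (-(k * Φ y))) (unitBall n) →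
      (∀ F : Cn n → ℂ, DifferentiableOn ℂ F (unitBall n) →
        IntegrableOn (fun y => ‖F y‖ ^ 2 * Real.exp (-(k * Φ y))) (unitBall n) →
        ∫ y in unitBall n, (m y : ℂ) * u y * conj (F y) * (Real.exp (-(k * Φ y)) : ℂ) = 0) →
      ∀ x ∈ Metric.ball (0 : Cn n) (1 / 4), ‖u x‖ ^ 2 ≤ C * ((k : ℝ) ^ n) ^ 2 * Real.exp (k * Φ x) *
        Real.exp (-(s * √k)) * ∫ y in unitBall n, ‖u y‖ ^ 2 * Real.exp (-(k * Φ y)) := by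
  obtain ⟨C₁, hC₁, hsub⟩ := exists_norm_sq_le hΦ
  have hmt : IsTest fun y => (m y : ℂ) := by
    refine ⟨contDiff_ofReal hm, HasCompactSupport.of_support_subset_isCompact
      (isCompact_closedBall 0 (3 / 4)) fun y hy => ?_⟩
    by_contra h
    exact hy (by simp [hm0 y fun h' => h (Metric.ball_subset_closedBall h')])
  obtain ⟨A, B, hA, hB, hAB⟩ := exists_dzbar_bound hmt hδ hmδ
  -- With `t = s√k` and `k ≥ 1` this makes both `t` and `t²` at most `kc/16`.
  set s : ℝ := min 1 (c / 16) with hs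
  have hs0 : 0 < s := by positivity
  have hs1 : s ≤ 1 := min_le_left _ _
  have hsc : s ≤ c / 16 := min_le_right _ _
  -- For `k ≥ k₀` also `B ≤ kc/16`, so more than half of the gap `kc` survives. For `k ≤ k₀` the
  -- claim is trivial, thanks to the term `e^{s√k₀}` of `C₂`.
  set k₀ : ℝ := 16 * B / c with hk₀
  have hk₀0 : 0 ≤ k₀ := by positivity
  set C₂ : ℝ := 8 * A / (c * δ ^ 2) + Real.exp (s * √k₀) with hC₂
  have hC₂0 : 0 < C₂ := by positivity
  -- The gain `5/36 = 1/4 - 1/9` compares the twist at radius `1/2` with the twist at radius `1/3`.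
  refine ⟨C₁ * C₂, by positivity, 5 / 36 * s, by positivity, fun k hk u hu hui hperp x hx => ?_⟩
  have hk1 : (1 : ℝ) ≤ k := by exact_mod_cast hk
  set N := ∫ y in unitBall n, ‖u y‖ ^ 2 * Real.exp (-(k * Φ y)) with hN
  have hN0 : 0 ≤ N := integral_nonneg fun y => by positivity
  suffices h : (∫ y in Metric.ball (0 : Cn n) (1 / 3), ‖u y‖ ^ 2 * Real.exp (-(k * Φ y)))
      ≤ C₂ * Real.exp (-(5 / 36 * s * √k)) * N by
    refine (hsub k hk u hu hui x hx).trans ?_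
    calc _ ≤ C₁ * ((k : ℝ) ^ n) ^ 2 * Real.exp (k * Φ x)
          * (C₂ * Real.exp (-(5 / 36 * s * √k)) * N) := by gcongr
      _ = _ := by ring
  rcases le_total k₀ k with hkk | hkk
  · set t : ℝ := s * √k with ht
    have hsq : √(k : ℝ) ^ 2 = k := Real.sq_sqrt (by linarith)
    have hsk : √(k : ℝ) ≤ k := by
      have : 1 ≤ √(k : ℝ) := Real.one_le_sqrt.2 hk1
      nlinarith
    have ht0 : 0 ≤ t := by positivity
    have ht1 : t ≤ k * c / 16 := by
      calc t ≤ c / 16 * k := by rw [ht]; gcongr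
        _ = _ := by ring
    have ht2 : t ^ 2 ≤ k * c / 16 := by
      rw [ht, mul_pow, hsq]
      have : s ^ 2 ≤ c / 16 := by nlinarith
      nlinarith
    have hB2 : B ≤ k * c / 16 := by
      rw [hk₀, div_le_iff₀ hc0] at hkk; linarith
    have hkc : 0 < k * c := by positivity
    have key := integral_le_of_perp hΦ hc (by linarith) ht0 hm hm0 hδ hmδ hA hB hAB
      (by linarith) (by linarith) hu hui hperp
    set I := ∫ y in Metric.ball (0 : Cn n) (1 / 3), ‖u y‖ ^ 2 * Real.exp (-(k * Φ y)) with hI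
    have hI0 : 0 ≤ I := integral_nonneg fun y => by positivity
    have h1 : c / 4 * (δ ^ 2 * (Real.exp (-(t / 9)) * I)) ≤ 2 * A * Real.exp (-(t / 4)) * N := by
      refine le_trans ?_ key
      gcongr
      nlinarith
    have h2 : Real.exp (-(t / 4)) = Real.exp (-(5 / 36 * t)) * Real.exp (-(t / 9)) := by
      rw [← Real.exp_add]; congr 1; ring
    rw [h2] at h1
    have h3 : c / 4 * δ ^ 2 * I ≤ 2 * A * Real.exp (-(5 / 36 * t)) * N := by
      refine le_of_mul_le_mul_right ?_ (Real.exp_pos (-(t / 9)))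
      linarith
    have h4 : I ≤ 8 * A / (c * δ ^ 2) * Real.exp (-(5 / 36 * t)) * N := by
      rw [div_mul_eq_mul_div, div_mul_eq_mul_div, le_div_iff₀ (by positivity)]
      linarith
    refine h4.trans ?_
    rw [ht, ← mul_assoc]
    gcongr
    rw [hC₂]
    linarith [Real.exp_pos (s * √k₀)]
  · have h1 : (∫ y in Metric.ball (0 : Cn n) (1 / 3), ‖u y‖ ^ 2 * Real.exp (-(k * Φ y))) ≤ N :=
      setIntegral_mono_set hui (.of_forall fun y => by positivity)
        (LE.le.eventuallyLE (Metric.ball_subset_ball (by norm_num)))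
    refine h1.trans (le_mul_of_one_le_left hN0 ?_)
    have h2 : √(k : ℝ) ≤ √k₀ := Real.sqrt_le_sqrt hkk
    calc (1 : ℝ) ≤ Real.exp (s * √k₀) * Real.exp (-(5 / 36 * s * √k)) := by
          rw [← Real.exp_add]
          refine Real.one_le_exp ?_
          have h3 : s * √(k : ℝ) ≤ s * √k₀ := by gcongr
          have h4 : 0 ≤ s * √(k : ℝ) := by positivity
          linarith
      _ ≤ _ := by
          gcongr
          rw [hC₂]
          have : 0 ≤ 8 * A / (c * δ ^ 2) := by positivity
          linarith

/-! ### The Hilbert space of holomorphic functions and the duality argument. -/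

/-- A continuous density on the unit ball that is bounded away from zero. -/
structure IsWeight (d : Cn n → ℝ) : Prop where
  cont : ContinuousOn d (unitBall n)
  below : ∃ b > 0, ∀ y ∈ unitBall n, b ≤ d y

/-- The measure on the unit ball with density `d`. -/
def weightMeasure (d : Cn n → ℝ) : Measure (Cn n) :=
  (volume.restrict (unitBall n)).withDensity fun y => ENNReal.ofReal (d y)

lemma isOpen_unitBall : IsOpen (unitBall n) := Metric.isOpen_ball

lemma measurableSet_unitBall : MeasurableSet (unitBall n) := isOpen_unitBall.measurableSet

section weight

variable {d : Cn n → ℝ}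

lemma IsWeight.pos (hd : IsWeight d) {y : Cn n} (hy : y ∈ unitBall n) : 0 < d y := by
  obtain ⟨b, hb, h⟩ := hd.below
  exact hb.trans_le (h y hy)

lemma IsWeight.aemeasurable (hd : IsWeight d) :
    AEMeasurable (fun y => ENNReal.ofReal (d y)) (volume.restrict (unitBall n)) :=
  (hd.cont.aemeasurable measurableSet_unitBall).ennreal_ofReal

lemma IsWeight.integral_eq (hd : IsWeight d) (f : Cn n → ℂ) :
    ∫ y, f y ∂weightMeasure d = ∫ y in unitBall n, f y * d y := by
  rw [weightMeasure, integral_withDensity_eq_integral_toReal_smul₀ hd.aemeasurable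
    (.of_forall fun _ => ENNReal.ofReal_lt_top)]
  refine setIntegral_congr_fun measurableSet_unitBall fun y hy => ?_
  simp only [ENNReal.toReal_ofReal (hd.pos hy).le, Complex.real_smul]
  ring

lemma IsWeight.integral_eq_real (hd : IsWeight d) (f : Cn n → ℝ) :
    ∫ y, f y ∂weightMeasure d = ∫ y in unitBall n, f y * d y := by
  rw [weightMeasure, integral_withDensity_eq_integral_toReal_smul₀ hd.aemeasurable
    (.of_forall fun _ => ENNReal.ofReal_lt_top)]
  refine setIntegral_congr_fun measurableSet_unitBall fun y hy => ?_
  simp only [ENNReal.toReal_ofReal (hd.pos hy).le, smul_eq_mul]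
  ring

lemma IsWeight.integrable_iff (hd : IsWeight d) (f : Cn n → ℝ) :
    Integrable f (weightMeasure d) ↔ IntegrableOn (fun y => f y * d y) (unitBall n) := by
  rw [weightMeasure, integrable_withDensity_iff_integrable_smul₀' hd.aemeasurable
    (.of_forall fun _ => ENNReal.ofReal_lt_top)]
  refine integrable_congr ?_
  filter_upwards [ae_restrict_mem measurableSet_unitBall] with y hy
  simp only [ENNReal.toReal_ofReal (hd.pos hy).le, smul_eq_mul]
  ring

lemma IsWeight.ae_iff (hd : IsWeight d) {p : Cn n → Prop} :
    (∀ᵐ y ∂weightMeasure d, p y) ↔ ∀ᵐ y ∂volume.restrict (unitBall n), p y := by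
  constructor
  · intro h
    refine (withDensity_absolutelyContinuous' hd.aemeasurable ?_).ae_le h
    filter_upwards [ae_restrict_mem measurableSet_unitBall] with y hy
    exact (ENNReal.ofReal_pos.2 (hd.pos hy)).ne'
  · intro h
    exact (withDensity_absolutelyContinuous _ _).ae_le h

lemma IsWeight.memLp_iff (hd : IsWeight d) {u : Cn n → ℂ} (hu : ContinuousOn u (unitBall n)) :
    MemLp u 2 (weightMeasure d) ↔ IntegrableOn (fun y => ‖u y‖ ^ 2 * d y) (unitBall n) := by
  rw [memLp_two_iff_integrable_sq_norm, hd.integrable_iff]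
  exact (hu.aestronglyMeasurable measurableSet_unitBall).mono_ac
    (withDensity_absolutelyContinuous _ _)

/-- The square-integrable holomorphic functions on the unit ball, as a subspace of `L²`. -/
def holoSubmodule (d : Cn n → ℝ) : Submodule ℂ (Lp ℂ 2 (weightMeasure d)) where
  carrier := {f | ∃ u, DifferentiableOn ℂ u (unitBall n) ∧ f =ᵐ[weightMeasure d] u}
  add_mem' := by
    rintro f g ⟨u, hu, hfu⟩ ⟨v, hv, hgv⟩
    exact ⟨u + v, hu.add hv, (Lp.coeFn_add f g).trans (hfu.add hgv)⟩
  zero_mem' := ⟨0, differentiableOn_const 0, Lp.coeFn_zero _ _ _⟩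
  smul_mem' := by
    rintro a f ⟨u, hu, hfu⟩
    exact ⟨a • u, hu.const_smul a, (Lp.coeFn_smul a f).trans (hfu.const_smul a)⟩

/-- Holomorphic functions are weakly holomorphic. -/
lemma integral_mul_dzbar_eq_zero {u h : Cn n → ℂ} (hu : DifferentiableOn ℂ u (unitBall n))
    (hh : IsTest h) (hU : tsupport h ⊆ unitBall n) (j : Fin n) :
    ∫ y in unitBall n, u y * dzbar j h y = 0 := by
  have hs : tsupport (fun y => u y * h y) ⊆ tsupport h := tsupport_mul_subset_right
  have ht : IsTest fun y => u y * h y := by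
    refine ⟨contDiff_iff_contDiffAt.2 fun x => ?_,
      hh.compact.of_isClosed_subset (isClosed_tsupport _) hs⟩
    by_cases hx : x ∈ unitBall n
    · exact (contDiffAt_of_differentiableOn isOpen_unitBall hx hu).mul hh.smooth.contDiffAt
    · exact contDiffAt_const.congr_of_eventuallyEq
        (notMem_tsupport_iff_eventuallyEq.1 fun h' => hx (hU (hs h')))
  have h0 : ∫ y, (1 : ℂ) * wirt Complex.I j (fun y => u y * h y) y = 0 := by
    rw [integral_mul_wirt contDiff_const (ht.smooth.of_le (by simp)) ht.compact]
    simp [wirt_const]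
  rw [← h0, ← integral_indicator measurableSet_unitBall]
  refine integral_congr_ae (.of_forall fun y => ?_)
  by_cases hy : y ∈ unitBall n
  · have d1 : DifferentiableAt ℂ u y := hu.differentiableAt (isOpen_unitBall.mem_nhds hy)
    have d2 := dzbar_eq_zero_of_differentiableAt j d1
    rw [dzbar_eq_wirt] at d2
    simp only [Set.indicator_of_mem hy, one_mul]
    rw [wirt_mul (d1.restrictScalars ℝ) (hh.smooth.differentiable (by simp) y), d2, dzbar_eq_wirt]
    ring
  · simp only [Set.indicator_of_notMem hy]
    rw [wirt_eq_zero_of_notMem_tsupport fun h' => hy (hU (hs h')), mul_zero]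

/-- Dividing by the density expresses the unweighted pairing with a test function as an inner
product with a fixed element of the weighted `L²`. -/
lemma IsWeight.memLp_conj_div (hd : IsWeight d) {h : Cn n → ℂ} (hh : IsTest h) :
    MemLp (fun y => conj (h y) / d y) 2 (weightMeasure d) := by
  obtain ⟨b, hb0, hb⟩ := hd.below
  have hgc : ContinuousOn (fun y => conj (h y) / d y) (unitBall n) :=
    hh.conj.smooth.continuous.continuousOn.div (Complex.continuous_ofReal.comp_continuousOn
      hd.cont) fun y hy => by exact_mod_cast (hd.pos hy).ne'
  rw [hd.memLp_iff hgc]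
  have hcs : HasCompactSupport fun y => ‖h y‖ ^ 2 :=
    hh.compact.comp_left (g := fun z : ℂ => ‖z‖ ^ 2) (by simp)
  have hi : Integrable fun y => ‖h y‖ ^ 2 :=
    Continuous.integrable_of_hasCompactSupport (hh.smooth.continuous.norm.pow 2) hcs
  refine Integrable.mono' ((hi.const_mul b⁻¹).integrableOn) ?_ ?_
  · exact ((hgc.norm.pow 2).mul hd.cont).aestronglyMeasurable measurableSet_unitBall
  · filter_upwards [ae_restrict_mem measurableSet_unitBall] with y hy
    have hp := hd.pos hy
    rw [Real.norm_of_nonneg (by positivity)]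
    simp only [norm_div, RCLike.norm_conj, Complex.norm_real, Real.norm_of_nonneg hp.le]
    have e : (‖h y‖ / d y) ^ 2 * d y = (d y)⁻¹ * ‖h y‖ ^ 2 := by
      field_simp
    rw [e]
    have := hb y hy
    gcongr

/-- The weak Cauchy-Riemann equations are orthogonality relations in `L²`, so they pass to limits;
Weyl's lemma then supplies a holomorphic representative. -/
lemma IsWeight.isClosed_holoSubmodule (hd : IsWeight d) :
    IsClosed (holoSubmodule d : Set (Lp ℂ 2 (weightMeasure d))) := by
  obtain ⟨b, hb0, hb⟩ := hd.below
  refine isClosed_of_closure_subset fun f hf => ?_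
  have hweak : WeakHolo ((unitBall n).indicator f) (unitBall n) := by
    intro h hh hU j
    set g : Cn n → ℂ := fun y => conj (dzbar j h y) / d y with hg
    have hdz := hh.dzbar j
    have hgm : MemLp g 2 (weightMeasure d) := hd.memLp_conj_div hdz
    have hin : ∀ q : Lp ℂ 2 (weightMeasure d), inner ℂ (hgm.toLp g) q
        = ∫ y in unitBall n, q y * dzbar j h y := by
      intro q
      rw [inner_Lp_eq _ _ hgm.coeFn_toLp (EventuallyEq.refl _ _), hd.integral_eq]
      refine setIntegral_congr_fun measurableSet_unitBall fun y hy => ?_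
      have : (d y : ℂ) ≠ 0 := by exact_mod_cast (hd.pos hy).ne'
      simp only [hg, map_div₀, Complex.conj_conj, Complex.conj_ofReal]
      field_simp
    have hcl : IsClosed {q : Lp ℂ 2 (weightMeasure d) | inner ℂ (hgm.toLp g) q = 0} :=
      isClosed_eq (continuous_const.inner continuous_id) continuous_const
    have hsub : (holoSubmodule d : Set (Lp ℂ 2 (weightMeasure d)))
        ⊆ {q | inner ℂ (hgm.toLp g) q = 0} := by
      rintro q ⟨u, hu, hqu⟩
      change inner ℂ (hgm.toLp g) q = 0
      rw [hin, ← integral_mul_dzbar_eq_zero hu hh hU j]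
      refine integral_congr_ae ?_
      filter_upwards [hd.ae_iff.1 hqu] with y hy
      rw [hy]
    have h0 : inner ℂ (hgm.toLp g) f = 0 := closure_minimal hsub hcl hf
    rw [hin, ← integral_indicator measurableSet_unitBall] at h0
    rw [← h0]
    refine integral_congr_ae (.of_forall fun y => ?_)
    by_cases hy : y ∈ unitBall n
    · simp [hy]
    · simp [hy]
  have hloc : LocallyIntegrable ((unitBall n).indicator f) := by
    refine MemLp.locallyIntegrable (p := 2) ?_ (by norm_num)
    have hfm : AEStronglyMeasurable f (volume.restrict (unitBall n)) :=
      (Lp.stronglyMeasurable f).aestronglyMeasurable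
    rw [memLp_indicator_iff_restrict measurableSet_unitBall, memLp_two_iff_integrable_sq_norm hfm]
    have hi := (hd.integrable_iff _).1 (integrable_norm_sq_Lp f)
    refine Integrable.mono' (hi.const_mul b⁻¹) (hfm.norm.pow 2) ?_
    filter_upwards [ae_restrict_mem measurableSet_unitBall] with y hy
    rw [Real.norm_of_nonneg (by positivity), inv_mul_eq_div, le_div_iff₀ hb0]
    have := hb y hy
    gcongr
  obtain ⟨F, hF, hFf⟩ := hweak.exists_differentiableOn hloc
  refine ⟨F, hF, ?_⟩
  refine hd.ae_iff.2 ?_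
  filter_upwards [ae_restrict_of_ae hFf, ae_restrict_mem measurableSet_unitBall] with y h1 h2
  rw [h1 h2, Set.indicator_of_mem h2]

/-- Multiplication by a bounded continuous function, as an operator on `L²`. -/
lemma exists_mul_operator {X : Type*} [TopologicalSpace X] [MeasurableSpace X]
    [OpensMeasurableSpace X] (μ : Measure X) {χ : X → ℝ} (hχ : Continuous χ) {b : ℝ}
    (hb : ∀ y, ‖χ y‖ ≤ b) :
    ∃ T : Lp ℂ 2 μ →L[ℂ] Lp ℂ 2 μ, ∀ f, T f =ᵐ[μ] fun y => (χ y : ℂ) * f y := by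
  have hm : ∀ f : Lp ℂ 2 μ, MemLp (fun y => (χ y : ℂ) * f y) 2 μ := fun f => by
    refine MemLp.of_le_mul (c := b) (Lp.memLp f) ?_ (.of_forall fun y => ?_)
    · exact (Complex.continuous_ofReal.comp hχ).measurable.aestronglyMeasurable.mul
        (Lp.aestronglyMeasurable f)
    · rw [norm_mul, Complex.norm_real]
      exact mul_le_mul_of_nonneg_right (hb y) (norm_nonneg _)
  let S : Lp ℂ 2 μ →ₗ[ℂ] Lp ℂ 2 μ :=
    { toFun := fun f => (hm f).toLp _
      map_add' := fun f g => by
        refine Lp.ext ?_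
        filter_upwards [(hm (f + g)).coeFn_toLp, (hm f).coeFn_toLp, (hm g).coeFn_toLp,
          Lp.coeFn_add f g, Lp.coeFn_add ((hm f).toLp _) ((hm g).toLp _)] with y h1 h2 h3 h4 h5
        rw [h1, h5, Pi.add_apply, h2, h3, h4, Pi.add_apply, mul_add]
      map_smul' := fun a f => by
        refine Lp.ext ?_
        filter_upwards [(hm (a • f)).coeFn_toLp, (hm f).coeFn_toLp,
          Lp.coeFn_smul a f, Lp.coeFn_smul a ((hm f).toLp _)] with y h1 h2 h3 h4
        rw [h1, RingHom.id_apply, h4, Pi.smul_apply, h2, h3, Pi.smul_apply, smul_eq_mul,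
          smul_eq_mul]
        ring }
  refine ⟨S.mkContinuous b fun f => ?_, fun f => (hm f).coeFn_toLp⟩
  refine Lp.norm_le_mul_norm_of_ae_le_mul ?_
  filter_upwards [(hm f).coeFn_toLp] with y hy
  change ‖((hm f).toLp _ : Lp ℂ 2 μ) y‖ ≤ _
  rw [hy, norm_mul, Complex.norm_real]
  exact mul_le_mul_of_nonneg_right (hb y) (norm_nonneg _)

/-- A vector that is nearly orthogonal to the orthogonal complement of the range of `T` is nearly
in the range of `T`. -/
lemma exists_norm_sub_le {E : Type*} [NormedAddCommGroup E] [InnerProductSpace ℂ E]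
    [CompleteSpace E] (T : E →L[ℂ] E) (F : E) {D : ℝ} (hD : 0 < D)
    (h : ∀ G : E, (∀ v, inner ℂ (T v) G = 0) → ‖inner ℂ F G‖ ≤ D * ‖G‖) :
    ∃ v, ‖F - T v‖ ≤ 2 * D := by
  set V : Submodule ℂ E := (LinearMap.range (T : E →ₗ[ℂ] E)).topologicalClosure with hV
  have : CompleteSpace V := (Submodule.isClosed_topologicalClosure _).completeSpace_coe
  -- The hypothesis for `G = F₂` reads `‖F₂‖² ≤ D ‖F₂‖`. The second `D` pays for replacing `F₁`,
  -- which lies only in the closure of the range, by some `T v`.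
  obtain ⟨F₁, hF₁, F₂, hF₂, rfl⟩ := V.exists_add_mem_mem_orthogonal F
  have h1 : ∀ v, inner ℂ (T v) F₂ = 0 := fun v =>
    (Submodule.mem_orthogonal _ _).1 hF₂ (T v) (Submodule.le_topologicalClosure _ ⟨v, rfl⟩)
  have h2 := h F₂ h1
  rw [inner_add_left, (Submodule.mem_orthogonal _ _).1 hF₂ F₁ hF₁, zero_add,
    inner_self_eq_norm_sq_to_K, norm_pow, RCLike.norm_ofReal, abs_norm] at h2
  have h3 : ‖F₂‖ ≤ D := by
    rcases (norm_nonneg F₂).eq_or_lt with h0 | h0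
    · rw [← h0]; exact hD.le
    · rw [pow_two] at h2; exact le_of_mul_le_mul_right h2 h0
  obtain ⟨w, ⟨v, rfl⟩, hv⟩ := Metric.mem_closure_iff.1 (show F₁ ∈ closure
    ((LinearMap.range (T : E →ₗ[ℂ] E) : Submodule ℂ E) : Set E) from hF₁) D hD
  rw [dist_eq_norm] at hv
  refine ⟨v, ?_⟩
  calc ‖F₁ + F₂ - T v‖ = ‖(F₁ - T v) + F₂‖ := by congr 1; abel
    _ ≤ ‖F₁ - T v‖ + ‖F₂‖ := norm_add_le _ _
    _ ≤ 2 * D := by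
      have : ‖F₁ - T v‖ < D := hv
      linarith

/-- If point evaluation at `x` is small on the holomorphic functions `u` with `χ u` orthogonal to
all holomorphic functions, then it is nearly given by pairing `χ u` with a holomorphic function. -/
theorem IsWeight.exists_kernel (hd : IsWeight d) {χ : Cn n → ℝ} (hχ : Continuous χ) {b : ℝ}
    (hb : ∀ y, ‖χ y‖ ≤ b) {x : Cn n} (hx : x ∈ unitBall n) {M D : ℝ} (hD : 0 < D)
    (heval : ∀ u : Cn n → ℂ, DifferentiableOn ℂ u (unitBall n) →
      IntegrableOn (fun y => ‖u y‖ ^ 2 * d y) (unitBall n) →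
      ‖u x‖ ^ 2 ≤ M ^ 2 * ∫ y in unitBall n, ‖u y‖ ^ 2 * d y)
    (hperp : ∀ u : Cn n → ℂ, DifferentiableOn ℂ u (unitBall n) →
      IntegrableOn (fun y => ‖u y‖ ^ 2 * d y) (unitBall n) →
      (∀ F : Cn n → ℂ, DifferentiableOn ℂ F (unitBall n) →
        IntegrableOn (fun y => ‖F y‖ ^ 2 * d y) (unitBall n) →
        ∫ y in unitBall n, (χ y : ℂ) * u y * conj (F y) * d y = 0) →
      ‖u x‖ ^ 2 ≤ D ^ 2 * ∫ y in unitBall n, ‖u y‖ ^ 2 * d y) :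
    ∃ v : Cn n → ℂ, DifferentiableOn ℂ v (unitBall n) ∧
      IntegrableOn (fun y => ‖v y‖ ^ 2 * d y) (unitBall n) ∧
      ∀ u : Cn n → ℂ, DifferentiableOn ℂ u (unitBall n) →
        IntegrableOn (fun y => ‖u y‖ ^ 2 * d y) (unitBall n) →
        ‖u x - ∫ y in unitBall n, (χ y : ℂ) * u y * conj (v y) * d y‖
          ≤ 2 * D * √(∫ y in unitBall n, ‖u y‖ ^ 2 * d y) := by
  set H := holoSubmodule d with hH
  have : CompleteSpace H := hd.isClosed_holoSubmodule.completeSpace_coe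
  have hrep : ∀ f : H, ∃ u, DifferentiableOn ℂ u (unitBall n) ∧
      (f : Lp ℂ 2 (weightMeasure d)) =ᵐ[weightMeasure d] u := fun f => f.2
  -- Elements of `H` are classes of functions. Two holomorphic representatives agree on the open
  -- ball by continuity, so the value at `x` is well defined (`huniq`).
  choose rep hrepd hrepe using hrep
  have huniq : ∀ (f : H) (u : Cn n → ℂ), DifferentiableOn ℂ u (unitBall n) →
      (f : Lp ℂ 2 (weightMeasure d)) =ᵐ[weightMeasure d] u → u x = rep f x := by
    intro f u hu hfu
    refine Measure.eqOn_open_of_ae_eq (μ := volume) (hd.ae_iff.1 (hfu.symm.trans (hrepe f)))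
      isOpen_unitBall hu.continuousOn (hrepd f).continuousOn hx
  have hnorm : ∀ (f : H) (u : Cn n → ℂ),
      (f : Lp ℂ 2 (weightMeasure d)) =ᵐ[weightMeasure d] u →
      ‖f‖ ^ 2 = ∫ y in unitBall n, ‖u y‖ ^ 2 * d y := by
    intro f u hfu
    rw [Submodule.coe_norm, norm_Lp_sq_eq _ hfu, hd.integral_eq_real]
  have hint : ∀ f : H, IntegrableOn (fun y => ‖rep f y‖ ^ 2 * d y) (unitBall n) := fun f => by
    rw [← hd.memLp_iff (hrepd f).continuousOn]
    exact (memLp_congr_ae (hrepe f)).1 (Lp.memLp _)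
  let ℓ : H →ₗ[ℂ] ℂ :=
    { toFun := fun f => rep f x
      map_add' := fun f g => (huniq (f + g) (rep f + rep g) ((hrepd f).add (hrepd g))
        ((Lp.coeFn_add _ _).trans ((hrepe f).add (hrepe g)))).symm
      map_smul' := fun a f => (huniq (a • f) (a • rep f) ((hrepd f).const_smul a)
        ((Lp.coeFn_smul _ _).trans ((hrepe f).const_smul a))).symm }
  have hℓ : ∀ f : H, ‖ℓ f‖ ≤ |M| * ‖f‖ := by
    intro f
    have h1 := heval _ (hrepd f) (hint f)
    rw [← hnorm f _ (hrepe f), ← mul_pow] at h1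
    have h3 := sq_le_sq.1 h1
    rw [abs_norm, abs_mul, abs_norm] at h3
    exact h3
  set L : H →L[ℂ] ℂ := ℓ.mkContinuous |M| hℓ with hL
  -- The Riesz representative of evaluation at `x`, i.e. the Bergman kernel itself. The constant `M`
  -- serves only to make evaluation continuous.
  set F : H := (InnerProductSpace.toDual ℂ H).symm L with hF
  have hFin : ∀ f : H, inner ℂ F f = rep f x := fun f => InnerProductSpace.toDual_symm_apply
  obtain ⟨T₀, hT₀⟩ := exists_mul_operator (weightMeasure d) hχ hb
  -- The Toeplitz operator with symbol `χ`. By `hTin`, a `G` orthogonal to its range is one with `χ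
  -- G` orthogonal to all of `H`, which is the situation of `hperp`.
  set T : H →L[ℂ] H := (H.orthogonalProjectionOnto.comp T₀).comp H.subtypeL with hT
  have hTin : ∀ f g : H, inner ℂ (T f) g
      = ∫ y in unitBall n, (χ y : ℂ) * rep g y * conj (rep f y) * d y := by
    intro f g
    have e1 : inner ℂ (T f) g = inner ℂ (T₀ f) (g : Lp ℂ 2 (weightMeasure d)) :=
      Submodule.inner_orthogonalProjectionOnto_eq_of_mem_right g _
    have e2 : T₀ f =ᵐ[weightMeasure d] fun y => (χ y : ℂ) * rep f y := by
      filter_upwards [hT₀ f, hrepe f] with y h1 h2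
      rw [h1, h2]
    rw [e1, inner_Lp_eq _ _ e2 (hrepe g), hd.integral_eq]
    refine setIntegral_congr_fun measurableSet_unitBall fun y _ => ?_
    simp only [map_mul, Complex.conj_ofReal]
    ring
  obtain ⟨v, hv⟩ := exists_norm_sub_le T F hD (by
    intro G hG
    rw [hFin]
    have h1 : ‖rep G x‖ ^ 2 ≤ D ^ 2 * ∫ y in unitBall n, ‖rep G y‖ ^ 2 * d y := by
      refine hperp _ (hrepd G) (hint G) fun u hu hui => ?_
      have hum := (hd.memLp_iff hu.continuousOn).2 hui
      set f : H := ⟨hum.toLp u, u, hu, hum.coeFn_toLp⟩ with hf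
      rw [← hG f, hTin]
      refine integral_congr_ae ?_
      have h2 : u =ᵐ[weightMeasure d] rep f := hum.coeFn_toLp.symm.trans (hrepe f)
      filter_upwards [hd.ae_iff.1 h2] with y hy
      rw [hy]
    rw [← hnorm G _ (hrepe G), ← mul_pow] at h1
    exact (pow_le_pow_iff_left₀ (norm_nonneg _) (by positivity) two_ne_zero).1 h1)
  refine ⟨rep v, hrepd v, hint v, fun u hu hui => ?_⟩
  have hum := (hd.memLp_iff hu.continuousOn).2 hui
  set f : H := ⟨hum.toLp u, u, hu, hum.coeFn_toLp⟩ with hf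
  have hfu : (f : Lp ℂ 2 (weightMeasure d)) =ᵐ[weightMeasure d] u := hum.coeFn_toLp
  have e1 : ∫ y in unitBall n, (χ y : ℂ) * u y * conj (rep v y) * d y = inner ℂ (T v) f := by
    rw [hTin]
    refine integral_congr_ae ?_
    filter_upwards [hd.ae_iff.1 (hfu.symm.trans (hrepe f))] with y hy
    rw [hy]
  have e2 : inner ℂ F f - inner ℂ (T v) f = inner ℂ (F - T v) f := (inner_sub_left F (T v) f).symm
  rw [e1, huniq f u hu hfu, ← hFin f, e2, ← hnorm f u hfu, Real.sqrt_sq (norm_nonneg _)]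
  exact (norm_inner_le_norm _ _).trans (mul_le_mul_of_nonneg_right hv (norm_nonneg _))

end weight

/-! ### Local Bergman kernels of a Kähler potential and the bounds of order `N`. -/

section kahler

variable {φ : Cn n → ℝ}

lemma Gevrey.contDiffAt {a r : ℝ} (hφ : Gevrey a (Metric.ball 0 r) fun x => (φ x : ℂ))
    {x : Cn n} (hx : x ∈ Metric.ball (0 : Cn n) r) : ContDiffAt ℝ ∞ φ x :=
  Complex.reCLM.contDiff.contDiffAt.comp x (hφ.1.contDiffAt (Metric.isOpen_ball.mem_nhds hx))

/-- Positivity on the closed ball, not just the open one, supplies the uniform lower bound by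
compactness. -/
lemma isWeight_of_continuousOn {d : Cn n → ℝ} (hd : ContinuousOn d (Metric.closedBall 0 1))
    (hpos : ∀ y ∈ Metric.closedBall (0 : Cn n) 1, 0 < d y) : IsWeight d := by
  refine ⟨hd.mono Metric.ball_subset_closedBall, ?_⟩
  obtain ⟨b, hb, h⟩ := (isCompact_closedBall (0 : Cn n) 1).exists_forall_le' hd hpos
  exact ⟨b, hb, fun y hy => h y (Metric.ball_subset_closedBall hy)⟩

lemma kahlerVolume_restrict :
    (kahlerVolume φ).restrict (unitBall n) = weightMeasure (kahlerDensity φ) :=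
  restrict_withDensity measurableSet_unitBall _

/-- The density `e^{-kφ} det (φ_{ij̄})` of the norm of `H_{kφ}`. -/
def bergmanDensity (φ : Cn n → ℝ) (k : ℕ) (y : Cn n) : ℝ :=
  Real.exp (-(k * φ y)) * kahlerDensity φ y

lemma innerK_eq (h : IsWeight (kahlerDensity φ)) (k : ℕ) (u v : Cn n → ℂ) :
    innerK φ k u v = ∫ y in unitBall n, u y * conj (v y) * bergmanDensity φ k y := by
  rw [innerK, kahlerVolume_restrict, h.integral_eq]
  simp only [bergmanDensity, Complex.ofReal_mul, mul_assoc]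

lemma normK_eq (h : IsWeight (kahlerDensity φ)) (k : ℕ) (u : Cn n → ℂ) :
    normK φ k u = √(∫ y in unitBall n, ‖u y‖ ^ 2 * bergmanDensity φ k y) := by
  rw [normK, kahlerVolume_restrict, h.integral_eq_real]
  simp only [bergmanDensity, mul_assoc]

lemma mem_bergmanSpace_iff (h : IsWeight (kahlerDensity φ)) (k : ℕ) (u : Cn n → ℂ) :
    u ∈ bergmanSpace φ k ↔ DifferentiableOn ℂ u (unitBall n) ∧
      IntegrableOn (fun y => ‖u y‖ ^ 2 * bergmanDensity φ k y) (unitBall n) := by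
  rw [bergmanSpace, Set.mem_ofPred_eq, IntegrableOn, kahlerVolume_restrict, h.integrable_iff]
  simp only [bergmanDensity, mul_assoc]

/-- Existence of local Bergman kernels with an error that decays like `e^{-σ√k}`. -/
theorem exists_localBergmanKernel
    (hφ : ∀ x ∈ Metric.ball (0 : Cn n) 3, ContDiffAt ℝ ∞ φ x)
    (hpos : IsKahlerPotential φ (Metric.ball 0 3)) {χ : Cn n → ℝ} (hχ : IsCutoff χ) :
    ∃ C > 0, ∃ σ > 0, ∀ k : ℕ, 1 ≤ k → ∀ x ∈ Metric.ball (0 : Cn n) (1 / 4),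
      ∃ v ∈ bergmanSpace φ k, ∀ u ∈ bergmanSpace φ k,
        ‖u x - innerK φ k (fun y => (χ y : ℂ) * u y) v‖
          ≤ C * (k : ℝ) ^ n * Real.exp (k * φ x / 2) * Real.exp (-(σ * √k)) * normK φ k u := by
  have hsub3 : Metric.closedBall (0 : Cn n) 1 ⊆ Metric.ball 0 3 :=
    Metric.closedBall_subset_ball (by norm_num)
  have hsub1 : unitBall n ⊆ Metric.closedBall 0 1 := Metric.ball_subset_closedBall
  have hφc : ContinuousOn φ (Metric.closedBall 0 1) := fun y hy =>
    (hφ y (hsub3 hy)).continuousAt.continuousWithinAt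
  have hΔc : ContinuousOn (kahlerDensity φ) (Metric.closedBall 0 1) := fun y hy =>
    (contDiffAt_kahlerDensity (hφ y (hsub3 hy))).continuousAt.continuousWithinAt
  have hΔp : ∀ y ∈ Metric.closedBall (0 : Cn n) 1, 0 < kahlerDensity φ y := fun y hy =>
    kahlerDensity_pos hpos (hsub3 hy)
  have hΔw : IsWeight (kahlerDensity φ) := isWeight_of_continuousOn hΔc hΔp
  obtain ⟨b, hb0, hb⟩ := hΔw.below
  obtain ⟨B, hB⟩ := (isCompact_closedBall (0 : Cn n) 1).exists_bound_of_continuousOn hΔc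
  have hdw : ∀ k, IsWeight (bergmanDensity φ k) := fun k =>
    isWeight_of_continuousOn ((Real.continuous_exp.comp_continuousOn
      (continuousOn_const.mul hφc).neg).mul hΔc) fun y hy => mul_pos (Real.exp_pos _) (hΔp y hy)
  obtain ⟨Φ, c, hc0, hΦ, hLevi, hΦφ⟩ := exists_extension hφ hpos
  have hχ0 : ∀ x ∉ Metric.ball (0 : Cn n) (3 / 4), χ x = 0 := hχ.eq_zero
  obtain ⟨bχ, hbχ⟩ := hχ.smooth.continuous.bounded_above_of_compact_support
    (HasCompactSupport.of_support_subset_isCompact (isCompact_closedBall (0 : Cn n) (3 / 4))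
      fun y hy => by
        by_contra h
        exact hy (hχ0 y fun h' => h (Metric.ball_subset_closedBall h')))
  -- The volume density is moved from the measure into the cut-off, so the estimates for Lebesgue
  -- measure with weight `e^{-kΦ}` apply. This `m` is not constant on `B(0, 1/2)`, only at least `b`
  -- there.
  set m : Cn n → ℝ := fun y => χ y * kahlerDensity φ y with hm
  have hms : ContDiff ℝ ∞ m := by
    rw [contDiff_iff_contDiffAt]
    intro x
    rcases lt_or_ge ‖x‖ 3 with h | h
    · exact hχ.smooth.contDiffAt.mul (contDiffAt_kahlerDensity (hφ x (by simpa using h)))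
    · have : m =ᶠ[𝓝 x] fun _ => 0 := by
        have hmem : {y : Cn n | 3 / 4 < ‖y‖} ∈ 𝓝 x :=
          (isOpen_lt continuous_const continuous_norm).mem_nhds (by
            simp only [Set.mem_ofPred_eq]; linarith)
        filter_upwards [hmem] with y hy
        simp [hm, hχ0 y (by rw [mem_ball_zero_iff, not_lt]; exact hy.le)]
      exact contDiffAt_const.congr_of_eventuallyEq this
  have hm0 : ∀ x ∉ Metric.ball (0 : Cn n) (3 / 4), m x = 0 := fun x hx => by simp [hm, hχ0 x hx]
  have hmb : ∀ x ∈ Metric.ball (0 : Cn n) (1 / 2), b ≤ m x := fun x hx => by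
    simp only [hm, hχ.eq_one x hx, one_mul]
    exact hb x (Metric.ball_subset_ball (by norm_num) hx)
  obtain ⟨C₁, hC₁, hev⟩ := exists_norm_sq_le hΦ
  obtain ⟨C₂, hC₂, s, hs, hpp⟩ := exists_norm_sq_le_of_perp hΦ hc0 hLevi hms hm0 hb0 hmb
  -- Square roots are taken of a bound on `‖u x‖²`, which halves the decay rate. The factor `1 / b`
  -- compares Lebesgue measure with the Kähler volume, and `2` comes from `IsWeight.exists_kernel`.
  refine ⟨2 * √(C₂ / b), by positivity, s / 2, by positivity, fun k hk x hx => ?_⟩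
  have hk0 : (0 : ℝ) < k := by exact_mod_cast hk
  have hxU : x ∈ unitBall n := Metric.ball_subset_ball (by norm_num) hx
  have hdens : ∀ y ∈ unitBall n,
      bergmanDensity φ k y = Real.exp (-(k * Φ y)) * kahlerDensity φ y := fun y hy => by
    rw [bergmanDensity, hΦφ y (hsub1 hy)]
  have hplain : ∀ u : Cn n → ℂ, DifferentiableOn ℂ u (unitBall n) →
      IntegrableOn (fun y => ‖u y‖ ^ 2 * bergmanDensity φ k y) (unitBall n) →
      IntegrableOn (fun y => ‖u y‖ ^ 2 * Real.exp (-(k * Φ y))) (unitBall n) ∧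
      ∫ y in unitBall n, ‖u y‖ ^ 2 * Real.exp (-(k * Φ y))
        ≤ b⁻¹ * ∫ y in unitBall n, ‖u y‖ ^ 2 * bergmanDensity φ k y := by
    intro u hu hui
    have hle : ∀ y ∈ unitBall n, ‖u y‖ ^ 2 * Real.exp (-(k * Φ y))
        ≤ b⁻¹ * (‖u y‖ ^ 2 * bergmanDensity φ k y) := fun y hy => by
      rw [hdens y hy, inv_mul_eq_div, le_div_iff₀ hb0, ← mul_assoc]
      have := hb y hy
      gcongr
    have hi : IntegrableOn (fun y => ‖u y‖ ^ 2 * Real.exp (-(k * Φ y))) (unitBall n) := by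
      refine Integrable.mono' (hui.const_mul b⁻¹) ?_ ?_
      · exact ((hu.continuousOn.norm.pow 2).mul (Real.continuous_exp.comp
          (continuous_const.mul hΦ.continuous).neg).continuousOn).aestronglyMeasurable
          measurableSet_unitBall
      · filter_upwards [ae_restrict_mem measurableSet_unitBall] with y hy
        rw [Real.norm_of_nonneg (by positivity)]
        exact hle y hy
    refine ⟨hi, ?_⟩
    rw [← integral_const_mul]
    exact setIntegral_mono_on hi (hui.const_mul _) measurableSet_unitBall hle
  have hback : ∀ F : Cn n → ℂ, DifferentiableOn ℂ F (unitBall n) →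
      IntegrableOn (fun y => ‖F y‖ ^ 2 * Real.exp (-(k * Φ y))) (unitBall n) →
      IntegrableOn (fun y => ‖F y‖ ^ 2 * bergmanDensity φ k y) (unitBall n) := by
    intro F hF hFi
    refine Integrable.mono' (hFi.const_mul B) ?_ ?_
    · exact ((hF.continuousOn.norm.pow 2).mul (hdw k).cont).aestronglyMeasurable
        measurableSet_unitBall
    · filter_upwards [ae_restrict_mem measurableSet_unitBall] with y hy
      have h1 := hB y (hsub1 hy)
      have h2 : kahlerDensity φ y ≤ B := (le_abs_self _).trans h1
      have h3 := (hdw k).pos hy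
      rw [Real.norm_of_nonneg (by positivity), hdens y hy]
      calc ‖F y‖ ^ 2 * (Real.exp (-(k * Φ y)) * kahlerDensity φ y)
          ≤ ‖F y‖ ^ 2 * (Real.exp (-(k * Φ y)) * B) := by gcongr
        _ = _ := by ring
  set D : ℝ := √(C₂ / b) * (k : ℝ) ^ n * Real.exp (k * φ x / 2) * Real.exp (-(s / 2 * √k)) with hD
  have hD0 : 0 < D := by positivity
  have hD2 : D ^ 2 = C₂ * ((k : ℝ) ^ n) ^ 2 * Real.exp (k * Φ x) * Real.exp (-(s * √k)) * b⁻¹ := by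
    have e1 : Real.exp (k * φ x / 2) ^ 2 = Real.exp (k * Φ x) := by
      rw [← Real.exp_nat_mul, hΦφ x (hsub1 hxU)]; congr 1; push_cast; ring
    have e2 : Real.exp (-(s / 2 * √k)) ^ 2 = Real.exp (-(s * √k)) := by
      rw [← Real.exp_nat_mul]; congr 1; push_cast; ring
    rw [hD, mul_pow, mul_pow, mul_pow, e1, e2, Real.sq_sqrt (by positivity)]
    ring
  set M : ℝ := √(C₁ * ((k : ℝ) ^ n) ^ 2 * Real.exp (k * Φ x) * b⁻¹) with hM
  have hM2 : M ^ 2 = C₁ * ((k : ℝ) ^ n) ^ 2 * Real.exp (k * Φ x) * b⁻¹ :=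
    Real.sq_sqrt (by positivity)
  obtain ⟨v, hv, hvi, hvu⟩ := (hdw k).exists_kernel hχ.smooth.continuous hbχ hxU (M := M) hD0
    (by
      intro u hu hui
      obtain ⟨h1, h2⟩ := hplain u hu hui
      refine (hev k hk u hu h1 x hx).trans ?_
      rw [hM2, mul_assoc _ b⁻¹]
      refine mul_le_mul_of_nonneg_left (le_trans ?_ h2) (by positivity)
      exact setIntegral_mono_set h1 (.of_forall fun y => by positivity)
        (LE.le.eventuallyLE (Metric.ball_subset_ball (by norm_num))))
    (by
      intro u hu hui hperp
      obtain ⟨h1, h2⟩ := hplain u hu hui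
      refine (hpp k hk u hu h1 (fun F hF hFi => ?_) x hx).trans ?_
      · rw [← hperp F hF (hback F hF hFi)]
        refine setIntegral_congr_fun measurableSet_unitBall fun y hy => ?_
        simp only [hdens y hy, hm]
        push_cast
        ring
      · rw [hD2, mul_assoc _ b⁻¹]
        exact mul_le_mul_of_nonneg_left h2 (by positivity))
  refine ⟨v, (mem_bergmanSpace_iff hΔw k v).2 ⟨hv, hvi⟩, fun u hu => ?_⟩
  obtain ⟨hu1, hu2⟩ := (mem_bergmanSpace_iff hΔw k u).1 hu
  rw [innerK_eq hΔw, normK_eq hΔw]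
  refine (hvu u hu1 hu2).trans_eq ?_
  rw [hD]
  ring

end kahler

/-- Keep only the term of degree `2m` in the series of `e^{σ√k}`, which yields `k^m`, and use `(2m)!
≤ 4^m m!²`. The square root is thus responsible for the exponent `2` of the factorial. -/
lemma exp_neg_mul_sqrt_le {σ k : ℝ} (hσ : 0 < σ) (hk : 0 < k) (m : ℕ) :
    Real.exp (-(σ * √k)) ≤ (4 / σ ^ 2) ^ m * (m.factorial : ℝ) ^ 2 / k ^ m := by
  have h1 := Real.pow_div_factorial_le_exp (σ * √k) (by positivity) (2 * m)
  have h2 : (σ * √k) ^ (2 * m) = (σ ^ 2) ^ m * k ^ m := by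
    rw [pow_mul, mul_pow, Real.sq_sqrt hk.le, mul_pow]
  have h3 : ((2 * m).factorial : ℝ) ≤ 4 ^ m * (m.factorial : ℝ) ^ 2 := by
    have e := Nat.add_choose_mul_factorial_mul_factorial m m
    have l := Nat.choose_le_two_pow (m + m) m
    have e2 : 2 ^ (m + m) = 4 ^ m := by rw [← two_mul, pow_mul]; norm_num
    rw [e2] at l
    rw [two_mul, ← e]
    push_cast
    rw [mul_assoc, ← pow_two]
    gcongr
    exact_mod_cast l
  rw [h2] at h1
  rw [Real.exp_neg, div_pow, div_mul_eq_mul_div, div_div]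
  refine (inv_anti₀ (by positivity) h1).trans ?_
  rw [inv_div]
  gcongr

end LocalBergman

end

theorem proposition2p1 (n : ℕ) (a ε : ℝ) (ha : 1 < a) (hε : 0 < ε)
    (φ : LocalBergman.Cn n → ℝ)
    (hφ : LocalBergman.Gevrey a (Metric.ball 0 3) (fun x => (φ x : ℂ)))
    (hpos : LocalBergman.IsKahlerPotential φ (Metric.ball 0 3))
    (χ : LocalBergman.Cn n → ℝ) (hχ : LocalBergman.IsCutoff χ) :
    ∃ C : ℝ, 0 < C ∧ ∀ N : ℕ,
      ∃ K : ℕ → LocalBergman.Cn n → LocalBergman.Cn n → ℂ,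
        ∀ k : ℕ, 1 ≤ k →
          (∀ x ∈ Metric.ball (0 : LocalBergman.Cn n) (1 / 4),
            K k x ∈ LocalBergman.bergmanSpace φ k) ∧
          ∀ u ∈ LocalBergman.bergmanSpace φ k,
            ∀ x ∈ Metric.ball (0 : LocalBergman.Cn n) (1 / 4),
              ∃ R : ℂ,
                u x = LocalBergman.innerK φ k (fun y => (χ y : ℂ) * u y) (K k x) +
                  (k : ℂ) ^ n * (Real.exp (k * φ x / 2) : ℂ) * R *
                    (LocalBergman.normK φ k u : ℂ) ∧
                ‖R‖ ≤ C ^ (N + 1) * ((N + 1).factorial : ℝ) ^ (2 * a + 2 * ε) /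
                  (k : ℝ) ^ (N + 1) := by
  obtain ⟨C, hC, σ, hσ, hker⟩ :=
    LocalBergman.exists_localBergmanKernel (fun x hx => hφ.contDiffAt hx) hpos hχ
  -- The prefactor `C` occurs only once but has to fit under an `(N + 1)`-st power, hence `max 1 C`.
  refine ⟨max 1 C * (4 / σ ^ 2), by positivity, fun N => ?_⟩
  -- Stated for all `k` and `x`, with the zero function as default value, so that a choice gives a
  -- total function `K`.
  have hker' : ∀ (k : ℕ) (x : LocalBergman.Cn n), ∃ v : LocalBergman.Cn n → ℂ,
      1 ≤ k → x ∈ Metric.ball (0 : LocalBergman.Cn n) (1 / 4) →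
        v ∈ LocalBergman.bergmanSpace φ k ∧ ∀ u ∈ LocalBergman.bergmanSpace φ k,
          ‖u x - LocalBergman.innerK φ k (fun y => (χ y : ℂ) * u y) v‖
            ≤ C * (k : ℝ) ^ n * Real.exp (k * φ x / 2) * Real.exp (-(σ * √k))
              * LocalBergman.normK φ k u := by
    intro k x
    by_cases h : 1 ≤ k ∧ x ∈ Metric.ball (0 : LocalBergman.Cn n) (1 / 4)
    · obtain ⟨v, hv⟩ := hker k h.1 x h.2
      exact ⟨v, fun _ _ => hv⟩
    · exact ⟨0, fun h1 h2 => absurd ⟨h1, h2⟩ h⟩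
  choose K hK using hker'
  refine ⟨K, fun k hk => ⟨fun x hx => (hK k x hk hx).1, fun u hu x hx => ?_⟩⟩
  have hk0 : (0 : ℝ) < k := by exact_mod_cast hk
  have hkC : (k : ℂ) ≠ 0 := by exact_mod_cast hk0.ne'
  have hest := (hK k x hk hx).2 u hu
  set p := LocalBergman.innerK φ k (fun y => (χ y : ℂ) * u y) (K k x) with hp
  set ν := LocalBergman.normK φ k u with hν
  have hν0 : 0 ≤ ν := Real.sqrt_nonneg _
  have hee : (Real.exp (k * φ x / 2) : ℂ) ≠ 0 := by exact_mod_cast (Real.exp_pos _).ne'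
  have hbound : C * Real.exp (-(σ * √k)) ≤ (max 1 C * (4 / σ ^ 2)) ^ (N + 1)
      * ((N + 1).factorial : ℝ) ^ (2 * a + 2 * ε) / (k : ℝ) ^ (N + 1) := by
    have h1 := LocalBergman.exp_neg_mul_sqrt_le hσ hk0 (N + 1)
    have h2 : C ≤ max 1 C ^ (N + 1) :=
      (le_max_right 1 C).trans (le_self_pow₀ (le_max_left 1 C) (by simp))
    -- Factorials are at least `1`, and `2 ≤ 2a + 2ε`.
    have h3 : (((N + 1).factorial : ℝ)) ^ 2 ≤ ((N + 1).factorial : ℝ) ^ (2 * a + 2 * ε) := by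
      rw [← Real.rpow_natCast]
      refine Real.rpow_le_rpow_of_exponent_le ?_ (by push_cast; linarith)
      exact_mod_cast Nat.succ_le_of_lt (Nat.factorial_pos _)
    calc C * Real.exp (-(σ * √k))
        ≤ max 1 C ^ (N + 1) * ((4 / σ ^ 2) ^ (N + 1) * ((N + 1).factorial : ℝ) ^ 2
          / (k : ℝ) ^ (N + 1)) := by gcongr
      _ = (max 1 C * (4 / σ ^ 2)) ^ (N + 1) * ((N + 1).factorial : ℝ) ^ 2
          / (k : ℝ) ^ (N + 1) := by rw [mul_pow]; ring
      _ ≤ _ := by gcongr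
  -- If the norm of `u` vanishes, the estimate forces exact reproduction and `R = 0` works;
  -- otherwise `R` is obtained by division.
  rcases hν0.eq_or_lt with h0 | h0
  · refine ⟨0, ?_, ?_⟩
    · rw [← h0, mul_zero] at hest
      have : u x - p = 0 := norm_le_zero_iff.1 hest
      rw [sub_eq_zero] at this
      rw [this]
      ring
    · rw [norm_zero]
      positivity
  · have hνC : (ν : ℂ) ≠ 0 := by exact_mod_cast h0.ne'
    refine ⟨(u x - p) / ((k : ℂ) ^ n * (Real.exp (k * φ x / 2) : ℂ) * ν), ?_, ?_⟩
    · field_simp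
      ring
    · refine le_trans ?_ hbound
      rw [norm_div, norm_mul, norm_mul, norm_pow, Complex.norm_natCast, Complex.norm_real,
        Complex.norm_real, Real.norm_of_nonneg (Real.exp_pos _).le, Real.norm_of_nonneg hν0,
        div_le_iff₀ (by positivity)]
      refine hest.trans_eq ?_
      ring
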